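/- **Biquandles.** A biquandle is a set $X$ with two operations $x^y=x\,\underline{\triangleright}\,y$ and $x_y=x\,\overline{\triangleright}\,y$ such that for all $x,y,z\in X$: $x^x=x_x$; the maps $y\mapsto y_x$, $y\mapsto y^x$ of $X$ and $S(x,y)=(y_x,x^y)$ of $X\times X$ are bijective; and $$(x^y)^{(z^y)}=(x^z)^{(y_z)},\qquad (x^y)_{(z^y)}=(x_z)^{(y_z)},\qquad (x_y)_{(z_y)}=(x_z)_{(y^z)} .$$ **Brackets.** Let $X$ be a biquandle and $R$ a commutative ring with identity. A biquandle virtual bracket $\beta$ consists of maps $A,B,C,D,U,V:X\times X\to R$ and elements $\delta\in R$, $w\in R^\times$ such that for all $x,y\in X$ $$w=\delta A_{x,x}+B_{x,x}+V_{x,x},\qquad w^{-1}=\delta C_{x,x}+D_{x,x}+U_{x,x},$$ $$1=A_{x,y}C_{x,y}+V_{x,y}U_{x,y}=B_{x,y}D_{x,y}+V_{x,y}U_{x,y},\quad 0=A_{x,y}U_{x,y}+V_{x,y}C_{x,y}=B_{x,y}U_{x,y}+V_{x,y}D_{x,y},$$ $$0=\delta B_{x,y}D_{x,y}+A_{x,y}D_{x,y}+B_{x,y}C_{x,y}=\delta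 A_{x,y}C_{x,y}+A_{x,y}D_{x,y}+B_{x,y}C_{x,y},$$ and such that the following hold for all $x,y,z\in X$, where for $P,Q,T\in\{A,B,V\}$ we write $[PQT]=P_{x,y}\,Q_{x^y,z_y}\,T_{y,z}$ and $\langle PQT\rangle=P_{y_x,z_x}\,Q_{x,z}\,T_{x^z,y^z}$: $$\begin{aligned} &[AAA]+[VAV]=\langle AAA\rangle+\langle VAV\rangle,\\ &[AAB]+[BAA]+\delta[BAB]+[BAV]+[BBB]+[BVB]+[VAB]=\langle ABA\rangle,\\ &[ABA]=\langle AAB\rangle+\langle BAA\rangle+\delta\langle BAB\rangle+\langle BAV\rangle+\langle BBB\rangle+\langle BVB\rangle+\langle VAB\rangle,\\ &[AVA]=\langle AAV\rangle+\langle VAA\rangle,\qquad [AAV]+[VAA]=\langle AVA\rangle,\\ &[BBA]+[BVV]=\langle ABB\rangle+\langle VVB\rangle,\qquad [ABB]+[VVB]=\langle BBA\rangle+\langle BVV\rangle,\\ &[BBV]+[BVA]=\langle ABV\rangle,\qquad [ABV]=\langle BBV\rangle+\langle BVA\rangle,\\ &[VBA]=\langle AVB\rangle+\langle VBB\rangle,\qquad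 [AVB]+[VBB]=\langle VBA\rangle,\\ &[VVA]=\langle AVV\rangle,\quad [AVV]=\langle VVA\rangle,\quad [VBV]=\langle VBV\rangle,\quad [VVV]=\langle VVV\rangle . \end{aligned}$$ **Links and colorings.** An oriented virtual link is represented by an oriented diagram with classical (positive or negative) and virtual crossings; two diagrams represent the same virtual link if they are related by the oriented virtual Reidemeister moves (classical moves I, II, III, their purely virtual analogues, and the mixed move taking a strand with two virtual crossings past a classical crossing). Classical links are those with a planar diagram without virtual crossings. An $X$-coloring of a diagram assigns elements of $X$ to its semiarcs so that colors do not change at virtual crossings and, at each classical crossing, the following holds. Let $x$ and $y$ be the colors of the part of the under-strand and the part of the over-strand that border the region to the left of both strands; then the other part of the under-strand has color $x^y$ and the other part of the over-strand has color $y_x$. The fundamental biquandle $\mathcal B(L)$ is the biquandle generated by the semiarcs of a diagram of $L$ subject to these crossing relations, so that $X$-colorings are given by homomorphisms $f\in\mathrm{Hom}(\mathcal B(L),X)$. The biquandle counting invariant $\Phi_X^{\mathbb Z}(L)$ is the number of $X$-colorings. **State sums.** Let $f$ be an $X$-coloring of a diagram with $p$ positive and $n$ negative classical crossings. A state $S$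 is a choice, at each classical crossing, of one of three replacements: smoothing with the orientation, smoothing against the orientation, or making the crossing virtual. With $x,y$ as above at that crossing, these choices have coefficients $A_{x,y},B_{x,y},V_{x,y}$ respectively at a positive crossing and $C_{x,y},D_{x,y},U_{x,y}$ respectively at a negative one. The value $\beta_S$ is the product of the chosen coefficients times $\delta^k w^{n-p}$, where $k$ is the number of closed curves of the state, and $\beta_f=\sum_S\beta_S$, the sum being over all states. **Statement.** For any biquandle $X$, biquandle virtual bracket $\beta$ over a commutative ring $R$, and oriented virtual link $L$, the multiset $$\Phi_X^{\beta,M}(L)=\{\beta_f \mid f\in\mathrm{Hom}(\mathcal B(L),X)\}$$ does not depend on the diagram chosen to represent $L$, i.e. it is an invariant of classical and virtual links. Its cardinality is the biquandle counting invariant $\Phi_X^{\mathbb Z}(L)$. (If $X$ is infinite, multiplicities in the multiset are cardinal numbers.) -/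

import Mathlib

universe u v

/-! ## Biquandles -/

/-- A biquandle. `underBy x y` is $x\,\underline{\triangleright}\,y$ (also written $x^y$) and
`overBy x y` is $x\,\overline{\triangleright}\,y$ (also written $x_y$). -/
class Biquandle (X : Type u) where
  underBy : X → X → X
  overBy : X → X → X
  under_self : ∀ x, underBy x x = overBy x x
  over_bijective : ∀ x, Function.Bijective fun y => overBy y x
  under_bijective : ∀ x, Function.Bijective fun y => underBy y x
  sideways_bijective : Function.Bijective fun p : X × X => (overBy p.2 p.1, underBy p.1 p.2)
  under_under : ∀ x y z,
    underBy (underBy x y) (underBy z y) = underBy (underBy x z) (overBy y z)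
  under_over : ∀ x y z,
    overBy (underBy x y) (underBy z y) = underBy (overBy x z) (overBy y z)
  over_over : ∀ x y z,
    overBy (overBy x y) (overBy z y) = overBy (overBy x z) (underBy y z)

namespace Biquandle

/-- Biquandle homomorphisms. -/
@[ext]
structure Hom (X : Type u) (Y : Type v) [Biquandle X] [Biquandle Y] where
  toFun : X → Y
  map_under : ∀ x y, toFun (underBy x y) = underBy (toFun x) (toFun y)
  map_over : ∀ x y, toFun (overBy x y) = overBy (toFun x) (toFun y)

/-- A biquandle virtual bracket over `X` with values in `R`: six coefficient maps, the value `δ`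
of a closed curve and the writhe correction `w`. -/
structure VirtualBracket (X : Type u) [Biquandle X] (R : Type v) [CommRing R] where
  A : X → X → R
  B : X → X → R
  C : X → X → R
  D : X → X → R
  U : X → X → R
  V : X → X → R
  δ : R
  w : Rˣ
  i_1 : ∀ x, (w : R) = δ * A x x + B x x + V x x
  i_2 : ∀ x, ((w⁻¹ : Rˣ) : R) = δ * C x x + D x x + U x x
  ii_1 : ∀ x y, 1 = A x y * C x y + V x y * U x y
  ii_2 : ∀ x y, 1 = B x y * D x y + V x y * U x y
  ii_3 : ∀ x y, 0 = A x y * U x y + V x y * C x y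
  ii_4 : ∀ x y, 0 = B x y * U x y + V x y * D x y
  ii_5 : ∀ x y, 0 = δ * (B x y * D x y) + A x y * D x y + B x y * C x y
  ii_6 : ∀ x y, 0 = δ * (A x y * C x y) + A x y * D x y + B x y * C x y
  iii_1 : ∀ x y z,
    A x y * A (underBy x y) (overBy z y) * A y z + V x y * A (underBy x y) (overBy z y) * V y z
      = A (overBy y x) (overBy z x) * A x z * A (underBy x z) (underBy y z)
        + V (overBy y x) (overBy z x) * A x z * V (underBy x z) (underBy y z)
  iii_2 : ∀ x y z,
    A x y * A (underBy x y) (overBy z y) * B y z + B x y * A (underBy x y) (overBy z y) * A y z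
        + δ * (B x y * A (underBy x y) (overBy z y) * B y z)
        + B x y * A (underBy x y) (overBy z y) * V y z
        + B x y * B (underBy x y) (overBy z y) * B y z
        + B x y * V (underBy x y) (overBy z y) * B y z
        + V x y * A (underBy x y) (overBy z y) * B y z
      = A (overBy y x) (overBy z x) * B x z * A (underBy x z) (underBy y z)
  iii_3 : ∀ x y z,
    A x y * B (underBy x y) (overBy z y) * A y z
      = A (overBy y x) (overBy z x) * A x z * B (underBy x z) (underBy y z)
        + B (overBy y x) (overBy z x) * A x z * A (underBy x z) (underBy y z)
        + δ * (B (overBy y x) (overBy z x) * A x z * B (underBy x z) (underBy y z))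
        + B (overBy y x) (overBy z x) * A x z * V (underBy x z) (underBy y z)
        + B (overBy y x) (overBy z x) * B x z * B (underBy x z) (underBy y z)
        + B (overBy y x) (overBy z x) * V x z * B (underBy x z) (underBy y z)
        + V (overBy y x) (overBy z x) * A x z * B (underBy x z) (underBy y z)
  iii_4 : ∀ x y z,
    A x y * V (underBy x y) (overBy z y) * A y z
      = A (overBy y x) (overBy z x) * A x z * V (underBy x z) (underBy y z)
        + V (overBy y x) (overBy z x) * A x z * A (underBy x z) (underBy y z)
  iii_5 : ∀ x y z,
    A x y * A (underBy x y) (overBy z y) * V y z + V x y * A (underBy x y) (overBy z y) * A y z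
      = A (overBy y x) (overBy z x) * V x z * A (underBy x z) (underBy y z)
  iii_6 : ∀ x y z,
    B x y * B (underBy x y) (overBy z y) * A y z + B x y * V (underBy x y) (overBy z y) * V y z
      = A (overBy y x) (overBy z x) * B x z * B (underBy x z) (underBy y z)
        + V (overBy y x) (overBy z x) * V x z * B (underBy x z) (underBy y z)
  iii_7 : ∀ x y z,
    A x y * B (underBy x y) (overBy z y) * B y z + V x y * V (underBy x y) (overBy z y) * B y z
      = B (overBy y x) (overBy z x) * B x z * A (underBy x z) (underBy y z)
        + B (overBy y x) (overBy z x) * V x z * V (underBy x z) (underBy y z)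
  iii_8 : ∀ x y z,
    B x y * B (underBy x y) (overBy z y) * V y z + B x y * V (underBy x y) (overBy z y) * A y z
      = A (overBy y x) (overBy z x) * B x z * V (underBy x z) (underBy y z)
  iii_9 : ∀ x y z,
    A x y * B (underBy x y) (overBy z y) * V y z
      = B (overBy y x) (overBy z x) * B x z * V (underBy x z) (underBy y z)
        + B (overBy y x) (overBy z x) * V x z * A (underBy x z) (underBy y z)
  iii_10 : ∀ x y z,
    V x y * B (underBy x y) (overBy z y) * A y z
      = A (overBy y x) (overBy z x) * V x z * B (underBy x z) (underBy y z)
        + V (overBy y x) (overBy z x) * B x z * B (underBy x z) (underBy y z)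
  iii_11 : ∀ x y z,
    A x y * V (underBy x y) (overBy z y) * B y z + V x y * B (underBy x y) (overBy z y) * B y z
      = V (overBy y x) (overBy z x) * B x z * A (underBy x z) (underBy y z)
  iii_12 : ∀ x y z,
    V x y * V (underBy x y) (overBy z y) * A y z
      = A (overBy y x) (overBy z x) * V x z * V (underBy x z) (underBy y z)
  iii_13 : ∀ x y z,
    A x y * V (underBy x y) (overBy z y) * V y z
      = V (overBy y x) (overBy z x) * V x z * A (underBy x z) (underBy y z)
  iii_14 : ∀ x y z,
    V x y * B (underBy x y) (overBy z y) * V y z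
      = V (overBy y x) (overBy z x) * B x z * V (underBy x z) (underBy y z)
  iii_15 : ∀ x y z,
    V x y * V (underBy x y) (overBy z y) * V y z
      = V (overBy y x) (overBy z x) * V x z * V (underBy x z) (underBy y z)

end Biquandle

/-! ## Oriented virtual link diagrams

A diagram is given by an oriented planar-diagram code. Edges are labelled by natural numbers.
Every crossing, classical or virtual, is turned until both of its strands point upwards; its four
edges are then `sw`, `se` (incoming) and `nw`, `ne` (outgoing), and its strands run from `sw` to
`ne` and from `se` to `nw`. In addition a diagram may carry marked points on its strands, which
only serve to subdivide edges: `(a, b)` is a marked point at which edge `a` ends and edge `b`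
begins. A component without crossings is a circle carrying marked points.

A diagram drawn in the plane gives such a code. Codes of diagrams that cannot be drawn in the plane
without further virtual crossings are admitted as well, so that whatever holds for all codes and
all moves between codes holds in particular for planar diagrams and planar moves, and, among those,
for diagrams and moves without virtual crossings, that is, for classical links. -/

namespace VirtualLink

/-- A crossing is positive (the strand from `sw` to `ne` is the over-strand), negative (the strand
from `se` to `nw` is the over-strand) or virtual. -/
inductive Kind where
  | pos
  | neg
  | virt
  deriving DecidableEq

/-- Exchange the over- and under-strand. -/
def Kind.flip : Kind → Kind
  | pos => neg
  | neg => pos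
  | virt => virt

structure Crossing where
  kind : Kind
  sw : ℕ
  se : ℕ
  nw : ℕ
  ne : ℕ
  deriving DecidableEq

/-- The edges at a classical crossing. The two strands have a common left-hand region;
`underLeft` and `overLeft` are the edges of the under- and over-strand that border it (so
`underLeft` lies to the left of the oriented over-strand, and `overLeft` to the left of the
oriented under-strand), `underRight` and `overRight` are the continuations of these across the
other strand. (Not used at virtual crossings.) -/
def Crossing.underLeft (c : Crossing) : ℕ :=
  match c.kind with
  | .neg => c.sw
  | _ => c.nw

def Crossing.overLeft (c : Crossing) : ℕ :=
  match c.kind with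
  | .neg => c.nw
  | _ => c.sw

def Crossing.underRight (c : Crossing) : ℕ :=
  match c.kind with
  | .neg => c.ne
  | _ => c.se

def Crossing.overRight (c : Crossing) : ℕ :=
  match c.kind with
  | .neg => c.se
  | _ => c.ne

/-- A list of crossings and marked points: a piece of a diagram. -/
@[ext]
structure Code where
  crossings : Multiset Crossing
  marks : Multiset (ℕ × ℕ)

namespace Code

/-- The edges that end at the crossings and marked points of the code. -/
def incoming (T : Code) : Multiset ℕ :=
  T.crossings.map Crossing.sw + T.crossings.map Crossing.se + T.marks.map Prod.fst

/-- The edges that begin at the crossings and marked points of the code. -/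
def outgoing (T : Code) : Multiset ℕ :=
  T.crossings.map Crossing.nw + T.crossings.map Crossing.ne + T.marks.map Prod.snd

/-- Put two pieces together; equal labels denote the same edge. -/
def join (S T : Code) : Code := ⟨S.crossings + T.crossings, S.marks + T.marks⟩

/-- Change the labels of the edges. -/
def relabel (σ : ℕ → ℕ) (T : Code) : Code :=
  ⟨T.crossings.map fun c => ⟨c.kind, σ c.sw, σ c.se, σ c.nw, σ c.ne⟩,
   T.marks.map fun m => (σ m.1, σ m.2)⟩

end Code

/-- An oriented virtual link diagram: a code in which every edge begins exactly once and ends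
exactly once. -/
structure Diagram extends Code where
  nodup_incoming : toCode.incoming.Nodup
  nodup_outgoing : toCode.outgoing.Nodup
  mem_incoming_iff : ∀ e, e ∈ toCode.incoming ↔ e ∈ toCode.outgoing

/-- The local oriented virtual Reidemeister moves. The kind `k` ranges over positive, negative and
virtual crossings. This is a generating set: all oriented versions of moves I, II, vI and vII are
listed, and in their presence the remaining oriented versions of moves III, vIII and v follow from
the ones given here. -/
inductive LocalMove : Code → Code → Prop
  /-- Moves I and vI: a kink with its loop on the right. -/
  | kink_right (k : Kind) (a b m : ℕ) :
      LocalMove ⟨{⟨k, a, m, b, m⟩}, 0⟩ ⟨0, {(a, b)}⟩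
  /-- Moves I and vI: a kink with its loop on the left. -/
  | kink_left (k : Kind) (a b m : ℕ) :
      LocalMove ⟨{⟨k, m, a, m, b⟩}, 0⟩ ⟨0, {(a, b)}⟩
  /-- Moves II and vII, the two strands being parallel. -/
  | direct (k : Kind) (a b c d e f : ℕ) :
      LocalMove ⟨{⟨k, a, b, c, d⟩, ⟨k.flip, c, d, e, f⟩}, 0⟩ ⟨0, {(a, e), (b, f)}⟩
  /-- Moves II and vII, the two strands being antiparallel and the bigon lying to the right of both
  crossings. -/
  | reverse_right (k : Kind) (a b c d e f : ℕ) :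
      LocalMove ⟨{⟨k, a, b, c, d⟩, ⟨k.flip, e, d, f, b⟩}, 0⟩ ⟨0, {(a, f), (e, c)}⟩
  /-- Moves II and vII, the two strands being antiparallel and the bigon lying to the left of both
  crossings. -/
  | reverse_left (k : Kind) (a b c d e f : ℕ) :
      LocalMove ⟨{⟨k, a, b, c, d⟩, ⟨k.flip, c, e, a, f⟩}, 0⟩ ⟨0, {(b, f), (e, d)}⟩
  /-- Move III: three parallel strands that enter at `a₁`, `a₂`, `a₃` and leave at `b₃`, `b₂`,
  `b₁`, all crossings being positive. -/
  | triangle (a₁ a₂ a₃ b₁ b₂ b₃ p q r : ℕ) :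
      LocalMove
        ⟨{⟨.pos, a₁, a₂, p, q⟩, ⟨.pos, q, a₃, r, b₃⟩, ⟨.pos, p, r, b₁, b₂⟩}, 0⟩
        ⟨{⟨.pos, a₂, a₃, p, q⟩, ⟨.pos, a₁, p, b₁, r⟩, ⟨.pos, r, q, b₂, b₃⟩}, 0⟩
  /-- Moves vIII (`k` virtual) and v (`k` classical): a strand with two virtual crossings is moved
  across a crossing. -/
  | virtual_triangle (k : Kind) (a₁ a₂ a₃ b₁ b₂ b₃ p q r : ℕ) :
      LocalMove
        ⟨{⟨.virt, a₁, a₂, p, q⟩, ⟨.virt, q, a₃, r, b₃⟩, ⟨k, p, r, b₁, b₂⟩}, 0⟩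
        ⟨{⟨k, a₂, a₃, p, q⟩, ⟨.virt, a₁, p, b₁, r⟩, ⟨.virt, r, q, b₂, b₃⟩}, 0⟩

namespace Diagram

/-- One step in the equivalence of diagrams: a change of labels, the removal of a marked point that
separates two different edges, or a local move applied to a piece of the diagram. -/
inductive Move : Diagram → Diagram → Prop
  | relabel (D D' : Diagram) (σ : Equiv.Perm ℕ) (h : D'.toCode = D.toCode.relabel σ) : Move D D'
  | unmark (D D' : Diagram) (a b : ℕ) (S : Code) (hab : a ≠ b)
      (h : D.toCode = S.join ⟨0, {(a, b)}⟩)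
      (h' : D'.toCode = S.relabel (Function.update id b a)) : Move D D'
  | replace (D D' : Diagram) (S T T' : Code) (hT : LocalMove T T')
      (h : D.toCode = S.join T) (h' : D'.toCode = S.join T') : Move D D'

/-- Two diagrams represent the same oriented virtual link. -/
def Equivalent : Diagram → Diagram → Prop := Relation.EqvGen Move

variable (D : Diagram)

/-- The edges (semiarcs) of a diagram. -/
abbrev Edge : Type := {e : ℕ // e ∈ D.incoming}

/-- The classical crossings of a diagram. -/
abbrev ClassicalCrossing : Type := {c : Crossing // c ∈ D.crossings ∧ c.kind ≠ .virt}

instance : Finite D.Edge :=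
  Finite.of_injective (β := {e // e ∈ D.incoming.toFinset})
    (fun e => ⟨e.1, Multiset.mem_toFinset.2 e.2⟩)
    fun _ _ h => Subtype.ext (congrArg (fun z => z.1) h)

noncomputable instance : Fintype D.ClassicalCrossing :=
  Fintype.subtype (D.crossings.toFinset.filter fun c => c.kind ≠ .virt) fun c => by simp

variable {D}

theorem sw_mem {c : Crossing} (h : c ∈ D.crossings) : c.sw ∈ D.incoming := by
  simp only [Code.incoming, Multiset.mem_add]
  exact Or.inl (Or.inl (Multiset.mem_map_of_mem _ h))

theorem se_mem {c : Crossing} (h : c ∈ D.crossings) : c.se ∈ D.incoming := by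
  simp only [Code.incoming, Multiset.mem_add]
  exact Or.inl (Or.inr (Multiset.mem_map_of_mem _ h))

theorem nw_mem {c : Crossing} (h : c ∈ D.crossings) : c.nw ∈ D.incoming := by
  rw [D.mem_incoming_iff]
  simp only [Code.outgoing, Multiset.mem_add]
  exact Or.inl (Or.inl (Multiset.mem_map_of_mem _ h))

theorem ne_mem {c : Crossing} (h : c ∈ D.crossings) : c.ne ∈ D.incoming := by
  rw [D.mem_incoming_iff]
  simp only [Code.outgoing, Multiset.mem_add]
  exact Or.inl (Or.inr (Multiset.mem_map_of_mem _ h))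

def underLeft (c : D.ClassicalCrossing) : D.Edge :=
  ⟨c.1.underLeft, by unfold Crossing.underLeft; split; exacts [sw_mem c.2.1, nw_mem c.2.1]⟩

def overLeft (c : D.ClassicalCrossing) : D.Edge :=
  ⟨c.1.overLeft, by unfold Crossing.overLeft; split; exacts [nw_mem c.2.1, sw_mem c.2.1]⟩

def underRight (c : D.ClassicalCrossing) : D.Edge :=
  ⟨c.1.underRight, by unfold Crossing.underRight; split; exacts [ne_mem c.2.1, se_mem c.2.1]⟩

def overRight (c : D.ClassicalCrossing) : D.Edge :=
  ⟨c.1.overRight, by unfold Crossing.overRight; split; exacts [se_mem c.2.1, ne_mem c.2.1]⟩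

variable (D)

/-- Two consecutive edges separated only by a marked point or by a virtual crossing, so that they
are parts of the same semiarc between classical crossings. -/
inductive Through : D.Edge → D.Edge → Prop
  | mark (e e' : D.Edge) (h : (e.1, e'.1) ∈ D.marks) : Through e e'
  | rising (c : Crossing) (hc : c ∈ D.crossings) (hv : c.kind = .virt) :
      Through ⟨c.sw, sw_mem hc⟩ ⟨c.ne, ne_mem hc⟩
  | falling (c : Crossing) (hc : c ∈ D.crossings) (hv : c.kind = .virt) :
      Through ⟨c.se, se_mem hc⟩ ⟨c.nw, nw_mem hc⟩

/-! ## Colorings, the counting invariant and the fundamental biquandle -/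

/-- The coloring rule for maps from edges to a biquandle. -/
structure IsColoring {X : Type u} [Biquandle X] (f : D.Edge → X) : Prop where
  through : ∀ e e', D.Through e e' → f e = f e'
  underBy : ∀ c, f (underRight c) = Biquandle.underBy (f (underLeft c)) (f (overLeft c))
  overBy : ∀ c, f (overRight c) = Biquandle.overBy (f (overLeft c)) (f (underLeft c))

/-- The biquandle counting invariant: the number of `X`-colorings (a cardinal, since `X` may be
infinite). -/
noncomputable def countingInvariant (X : Type u) [Biquandle X] : Cardinal.{u} :=
  Cardinal.mk {f : D.Edge → X // D.IsColoring f}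

/-- Biquandle words in the edges. The last four operations stand for the inverses of the maps
`y ↦ underBy y x`, `y ↦ overBy y x` and for the two components of the inverse of
`(x, y) ↦ (overBy y x, underBy x y)`. -/
inductive Word : Type
  | gen : D.Edge → Word
  | underBy : Word → Word → Word
  | overBy : Word → Word → Word
  | underInv : Word → Word → Word
  | overInv : Word → Word → Word
  | sideFst : Word → Word → Word
  | sideSnd : Word → Word → Word

/-- The congruence on words generated by the biquandle axioms and the relations of the diagram. -/
inductive WordRel : D.Word → D.Word → Prop
  | refl (a) : WordRel a a
  | symm {a b} : WordRel a b → WordRel b a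
  | trans {a b c} : WordRel a b → WordRel b c → WordRel a c
  | congr_under {a a' b b'} : WordRel a a' → WordRel b b' → WordRel (.underBy a b) (.underBy a' b')
  | congr_over {a a' b b'} : WordRel a a' → WordRel b b' → WordRel (.overBy a b) (.overBy a' b')
  | congr_underInv {a a' b b'} :
      WordRel a a' → WordRel b b' → WordRel (.underInv a b) (.underInv a' b')
  | congr_overInv {a a' b b'} :
      WordRel a a' → WordRel b b' → WordRel (.overInv a b) (.overInv a' b')
  | congr_sideFst {a a' b b'} :
      WordRel a a' → WordRel b b' → WordRel (.sideFst a b) (.sideFst a' b')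
  | congr_sideSnd {a a' b b'} :
      WordRel a a' → WordRel b b' → WordRel (.sideSnd a b) (.sideSnd a' b')
  | under_self (a) : WordRel (.underBy a a) (.overBy a a)
  | under_underInv (a b) : WordRel (.underBy (.underInv a b) b) a
  | underInv_under (a b) : WordRel (.underInv (.underBy a b) b) a
  | over_overInv (a b) : WordRel (.overBy (.overInv a b) b) a
  | overInv_over (a b) : WordRel (.overInv (.overBy a b) b) a
  | over_side (a b) : WordRel (.overBy (.sideSnd a b) (.sideFst a b)) a
  | under_side (a b) : WordRel (.underBy (.sideFst a b) (.sideSnd a b)) b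
  | sideFst_side (a b) : WordRel (.sideFst (.overBy b a) (.underBy a b)) a
  | sideSnd_side (a b) : WordRel (.sideSnd (.overBy b a) (.underBy a b)) b
  | under_under (x y z) :
      WordRel (.underBy (.underBy x y) (.underBy z y)) (.underBy (.underBy x z) (.overBy y z))
  | under_over (x y z) :
      WordRel (.overBy (.underBy x y) (.underBy z y)) (.underBy (.overBy x z) (.overBy y z))
  | over_over (x y z) :
      WordRel (.overBy (.overBy x y) (.overBy z y)) (.overBy (.overBy x z) (.underBy y z))
  | through (e e') : D.Through e e' → WordRel (.gen e) (.gen e')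
  | crossing_under (c) :
      WordRel (.gen (underRight c)) (.underBy (.gen (underLeft c)) (.gen (overLeft c)))
  | crossing_over (c) :
      WordRel (.gen (overRight c)) (.overBy (.gen (overLeft c)) (.gen (underLeft c)))

def wordSetoid : Setoid D.Word := ⟨D.WordRel, .refl, .symm, .trans⟩

/-- The fundamental biquandle of a diagram. -/
def FundamentalBiquandle : Type := Quotient D.wordSetoid

/-- The generator given by an edge. -/
def generator (e : D.Edge) : D.FundamentalBiquandle := Quotient.mk D.wordSetoid (.gen e)

instance : Biquandle D.FundamentalBiquandle where
  underBy := Quotient.map₂ .underBy fun _ _ h _ _ h' => .congr_under h h'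
  overBy := Quotient.map₂ .overBy fun _ _ h _ _ h' => .congr_over h h'
  under_self := by
    rintro ⟨a⟩; exact Quotient.sound (.under_self a)
  over_bijective := by
    rintro ⟨b⟩
    refine Function.bijective_iff_has_inverse.2
      ⟨Quotient.map (Word.overInv · b) fun _ _ h => .congr_overInv h (.refl b), ?_, ?_⟩
    · rintro ⟨a⟩; exact Quotient.sound (.overInv_over a b)
    · rintro ⟨a⟩; exact Quotient.sound (.over_overInv a b)
  under_bijective := by
    rintro ⟨b⟩
    refine Function.bijective_iff_has_inverse.2
      ⟨Quotient.map (Word.underInv · b) fun _ _ h => .congr_underInv h (.refl b), ?_, ?_⟩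
    · rintro ⟨a⟩; exact Quotient.sound (.underInv_under a b)
    · rintro ⟨a⟩; exact Quotient.sound (.under_underInv a b)
  sideways_bijective := by
    refine Function.bijective_iff_has_inverse.2
      ⟨fun p => (Quotient.map₂ Word.sideFst (fun _ _ h _ _ h' => .congr_sideFst h h') p.1 p.2,
        Quotient.map₂ Word.sideSnd (fun _ _ h _ _ h' => .congr_sideSnd h h') p.1 p.2), ?_, ?_⟩
    · rintro ⟨⟨a⟩, ⟨b⟩⟩
      exact Prod.ext (Quotient.sound (.sideFst_side a b)) (Quotient.sound (.sideSnd_side a b))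
    · rintro ⟨⟨a⟩, ⟨b⟩⟩
      exact Prod.ext (Quotient.sound (.over_side a b)) (Quotient.sound (.under_side a b))
  under_under := by
    rintro ⟨x⟩ ⟨y⟩ ⟨z⟩; exact Quotient.sound (.under_under x y z)
  under_over := by
    rintro ⟨x⟩ ⟨y⟩ ⟨z⟩; exact Quotient.sound (.under_over x y z)
  over_over := by
    rintro ⟨x⟩ ⟨y⟩ ⟨z⟩; exact Quotient.sound (.over_over x y z)

/-- $\mathrm{Hom}(\mathcal{B}(D), X)$. -/
abbrev ColoringHom (X : Type u) [Biquandle X] : Type u :=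
  Biquandle.Hom D.FundamentalBiquandle X

theorem coloringHom_injective (X : Type u) [Biquandle X] :
    Function.Injective fun (f : D.ColoringHom X) (e : D.Edge) => f.toFun (D.generator e) := by
  intro f g h
  have key : ∀ a : D.Word, f.toFun (Quotient.mk D.wordSetoid a) =
      g.toFun (Quotient.mk D.wordSetoid a) := by
    have fu : ∀ (k : D.ColoringHom X) (a b : D.Word), k.toFun (Quotient.mk D.wordSetoid (.underBy a b))
        = Biquandle.underBy (k.toFun (Quotient.mk _ a)) (k.toFun (Quotient.mk _ b)) :=
      fun k a b => k.map_under (Quotient.mk _ a) (Quotient.mk _ b)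
    have fo : ∀ (k : D.ColoringHom X) (a b : D.Word), k.toFun (Quotient.mk D.wordSetoid (.overBy a b))
        = Biquandle.overBy (k.toFun (Quotient.mk _ a)) (k.toFun (Quotient.mk _ b)) :=
      fun k a b => k.map_over (Quotient.mk _ a) (Quotient.mk _ b)
    have side : ∀ a b : D.Word,
        f.toFun (Quotient.mk _ a) = g.toFun (Quotient.mk _ a) →
        f.toFun (Quotient.mk _ b) = g.toFun (Quotient.mk _ b) →
        f.toFun (Quotient.mk D.wordSetoid (.sideFst a b)) =
            g.toFun (Quotient.mk D.wordSetoid (.sideFst a b)) ∧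
          f.toFun (Quotient.mk D.wordSetoid (.sideSnd a b)) =
            g.toFun (Quotient.mk D.wordSetoid (.sideSnd a b)) := by
      intro a b ha hb
      have h1 := Quotient.sound (s := D.wordSetoid) (WordRel.over_side a b)
      have h2 := Quotient.sound (s := D.wordSetoid) (WordRel.under_side a b)
      have := @(Biquandle.sideways_bijective (X := X)).1
        (f.toFun (Quotient.mk D.wordSetoid (.sideFst a b)),
          f.toFun (Quotient.mk D.wordSetoid (.sideSnd a b)))
        (g.toFun (Quotient.mk D.wordSetoid (.sideFst a b)),
          g.toFun (Quotient.mk D.wordSetoid (.sideSnd a b)))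
        (by simp only [← fu, ← fo, h1, h2, ha, hb])
      exact Prod.ext_iff.1 this
    intro a
    induction a with
    | gen e => exact congrFun h e
    | underBy a b ha hb => rw [fu, fu, ha, hb]
    | overBy a b ha hb => rw [fo, fo, ha, hb]
    | underInv a b ha hb =>
      have h1 := Quotient.sound (s := D.wordSetoid) (WordRel.under_underInv a b)
      refine (Biquandle.under_bijective (f.toFun (Quotient.mk _ b))).1 ?_
      simp only
      conv_rhs => rw [hb]
      rw [← fu, ← fu, h1, ha]
    | overInv a b ha hb =>
      have h1 := Quotient.sound (s := D.wordSetoid) (WordRel.over_overInv a b)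
      refine (Biquandle.over_bijective (f.toFun (Quotient.mk _ b))).1 ?_
      simp only
      conv_rhs => rw [hb]
      rw [← fo, ← fo, h1, ha]
    | sideFst a b ha hb => exact (side a b ha hb).1
    | sideSnd a b ha hb => exact (side a b ha hb).2
  refine Biquandle.Hom.ext (funext ?_)
  rintro ⟨a⟩
  exact key a

instance (X : Type u) [Biquandle X] [Finite X] : Finite (D.ColoringHom X) :=
  Finite.of_injective _ (D.coloringHom_injective X)

/-! ## States and the state sum -/

/-- The three ways to smooth a classical crossing: with the orientation, against the orientation,
or by making it virtual. -/
inductive Smoothing where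
  | along
  | against
  | virt
  deriving DecidableEq

instance : Fintype Smoothing :=
  ⟨{.along, .against, .virt}, fun t => by cases t <;> simp⟩

/-- A state: a choice of smoothing at every classical crossing. -/
abbrev State : Type := D.ClassicalCrossing → Smoothing

/-- The connections between edges in the diagram obtained from a state. -/
inductive StateAdj (s : D.State) : D.Edge → D.Edge → Prop
  | through (e e' : D.Edge) (h : D.Through e e') : StateAdj s e e'
  | along_left (c : D.ClassicalCrossing) (h : s c = .along) :
      StateAdj s ⟨c.1.sw, sw_mem c.2.1⟩ ⟨c.1.nw, nw_mem c.2.1⟩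
  | along_right (c : D.ClassicalCrossing) (h : s c = .along) :
      StateAdj s ⟨c.1.se, se_mem c.2.1⟩ ⟨c.1.ne, ne_mem c.2.1⟩
  | against_bottom (c : D.ClassicalCrossing) (h : s c = .against) :
      StateAdj s ⟨c.1.sw, sw_mem c.2.1⟩ ⟨c.1.se, se_mem c.2.1⟩
  | against_top (c : D.ClassicalCrossing) (h : s c = .against) :
      StateAdj s ⟨c.1.nw, nw_mem c.2.1⟩ ⟨c.1.ne, ne_mem c.2.1⟩
  | virt_rising (c : D.ClassicalCrossing) (h : s c = .virt) :
      StateAdj s ⟨c.1.sw, sw_mem c.2.1⟩ ⟨c.1.ne, ne_mem c.2.1⟩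
  | virt_falling (c : D.ClassicalCrossing) (h : s c = .virt) :
      StateAdj s ⟨c.1.se, se_mem c.2.1⟩ ⟨c.1.nw, nw_mem c.2.1⟩

/-- The number of closed curves of a state: the number of classes of edges under the equivalence
relation generated by the connections. -/
noncomputable def curves (s : D.State) : ℕ := Nat.card (Quot (D.StateAdj s))

/-- The number of negative minus the number of positive classical crossings. -/
def negSubPos : ℤ :=
  (D.crossings.countP (fun c => c.kind = .neg) : ℤ) - D.crossings.countP (fun c => c.kind = .pos)

section StateSum

variable {X : Type u} [Biquandle X] {R : Type v} [CommRing R]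
  (β : Biquandle.VirtualBracket X R)

/-- The skein coefficient of a smoothing of a crossing whose left-hand edges have colors `x`
(under-strand) and `y` (over-strand). -/
def coefficient (k : Kind) (t : Smoothing) (x y : X) : R :=
  match k, t with
  | .neg, .along => β.C x y
  | .neg, .against => β.D x y
  | .neg, .virt => β.U x y
  | _, .along => β.A x y
  | _, .against => β.B x y
  | _, .virt => β.V x y

/-- The value of a state of a colored diagram. -/
noncomputable def stateValue (f : D.Edge → X) (s : D.State) : R :=
  (∏ c, coefficient β c.1.kind (s c) (f (underLeft c)) (f (overLeft c))) * β.δ ^ D.curves s *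
    ((β.w ^ D.negSubPos : Rˣ) : R)

/-- The state sum $\beta_f$ of the coloring given by a homomorphism from the fundamental
biquandle. -/
noncomputable def stateSum (f : D.ColoringHom X) : R :=
  ∑ s : D.State, D.stateValue β (fun e => f.toFun (D.generator e)) s

/-- The biquandle virtual bracket multiset, recorded by its multiplicities: the multiplicity of `r`
is the number of `f` with $\beta_f = r$. Infinite multiplicities are possible if `X` is infinite. -/
noncomputable def bracketMultiplicity (r : R) : Cardinal.{u} :=
  Cardinal.mk {f : D.ColoringHom X // D.stateSum β f = r}

/-- The biquandle virtual bracket multiset for a finite biquandle. -/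
noncomputable def bracketMultiset [Finite X] : Multiset R :=
  letI := Fintype.ofFinite (D.ColoringHom X)
  (Finset.univ : Finset (D.ColoringHom X)).val.map (D.stateSum β)

end StateSum

end Diagram

end VirtualLink

/-!
The state sum of a colored diagram is a sum over the smoothings of all its crossings, and the
number of closed curves of a state depends only on the system of arcs that the smoothings leave
behind. A state is therefore recorded as a multiset of arcs, an arc being an unordered pair of edge
labels. In the algebra of formal sums of such multisets, with union as multiplication, each crossing
becomes the sum of its three smoothings (`Crossing.skein`), a diagram becomes the product of its
crossings (`Diagram.skein_eq_sum`), and the state sum is its image under the additive map that sends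
a system of arcs with `n` closed curves to `δ ^ n` (`Diagram.stateSum_eq_evaluate`). The factor
`w ^ (n - p)` is distributed over the crossings, and a virtual crossing is a crossing whose only
smoothing with a nonzero coefficient is the virtual one. As the diagram is a product, a local move
needs to be checked only next to an arbitrary system of arcs outside (`evaluate_context`).

The edges inside a move can then be eliminated one by one: shrinking an arc does not change the
number of closed curves (`circles_cons_eq_contract`), and a closed arc counts for one
(`circles_cons_loop`). Every state of the two sides of a move becomes a power of `δ` times a pairing
of the boundary edges. For a kink there is one pairing, for two strands there are three and for
three strands fifteen; collecting the states with equal pairings gives exactly the defining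
relations of the bracket (`TriangleRelations`, `weight_triangle` for the move III).

Colorings are carried along a move because the biquandle axioms let the colors of the boundary edges
determine those of the inner edges on both sides, under the same conditions on the boundary colors
(`Replacement`, `LocalMove.nonempty_replacement`). For kinks this uses that
`underBy x y = overBy y x` holds only for `x = y` (`Biquandle.underBy_eq_overBy_iff`). So the colorings of equivalent
diagrams, which are the homomorphisms from the fundamental biquandle (`Diagram.coloringHomEquiv`),
are in a bijection that preserves state sums (`Diagram.sameStateSums_of_equivalent`).
-/

/-! ### Kinks in a biquandle -/

namespace Biquandle

variable {X : Type u} [Biquandle X]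

/-- The exchange law for `x, y, x` turns `underBy x y = overBy y x` into
`underBy m m = underBy (underBy x x) m`, where `m` is the common value. -/
theorem underBy_eq_overBy_iff {x y : X} : underBy x y = overBy y x ↔ x = y := by
  refine ⟨fun h => ?_, fun h => by rw [h, under_self]⟩
  have h1 := under_under x y x
  rw [← h] at h1
  have h2 : underBy x y = underBy x x := (under_bijective _).1 h1
  rw [h, under_self] at h2
  exact ((over_bijective x).1 h2).symm

/-- Surjectivity holds because the preimage of `(m, m)` under the sideways map lies on the
diagonal. -/
theorem square_bijective : Function.Bijective fun x : X => underBy x x := by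
  refine ⟨fun x y h => ?_, fun m => ?_⟩
  · have : ((x, x) : X × X) = (y, y) := sideways_bijective.1 <| by
      simp only [← under_self] at h ⊢
      rw [h]
    exact congrArg Prod.fst this
  · obtain ⟨⟨x, y⟩, hxy⟩ := sideways_bijective.2 ((m, m) : X × X)
    obtain ⟨h1, h2⟩ := Prod.ext_iff.1 hxy
    dsimp only at h1 h2
    obtain rfl := underBy_eq_overBy_iff.1 (h2.trans h1.symm)
    exact ⟨x, h2⟩

end Biquandle

namespace VirtualLink

open Diagram (Smoothing coefficient)
open Biquandle (underBy overBy under_bijective over_bijective underBy_eq_overBy_iff)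

/-! ### Counting the closed curves of a system of arcs -/

/-- The edges met by a system of arcs. An arc joining two edges is an unordered pair of labels. -/
def vertices (P : Multiset (Sym2 ℕ)) : Set ℕ := {v | ∃ e ∈ P, v ∈ e}

/-- Two edges are adjacent in a system of arcs if an arc joins them. -/
def ArcAdj (P : Multiset (Sym2 ℕ)) (u v : ℕ) : Prop := s(u, v) ∈ P

/-- The number of connected components of a system of arcs. Labels that meet no arc do not count,
so the components are taken among all labels and only those containing a vertex are counted. -/
noncomputable def circles (P : Multiset (Sym2 ℕ)) : ℕ :=
  (Quot.mk (ArcAdj P) '' vertices P).ncard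

theorem vertices_cons (e : Sym2 ℕ) (P : Multiset (Sym2 ℕ)) :
    vertices (e ::ₘ P) = {v | v ∈ e} ∪ vertices P := by
  ext v; simp [vertices]

theorem vertices_add (P Q : Multiset (Sym2 ℕ)) :
    vertices (P + Q) = vertices P ∪ vertices Q := by
  ext v; simp [vertices, or_and_right, exists_or]

theorem vertices_finite (P : Multiset (Sym2 ℕ)) : (vertices P).Finite := by
  induction P using Multiset.induction with
  | empty => simp [vertices]
  | cons e P ih =>
    rw [vertices_cons]
    refine Set.Finite.union ?_ ih
    induction e with
    | h a b => exact (Set.toFinite {a, b}).subset fun v hv => by simpa using hv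

theorem vertices_map (σ : ℕ → ℕ) (P : Multiset (Sym2 ℕ)) :
    vertices (P.map (Sym2.map σ)) = σ '' vertices P := by
  ext v
  simp only [vertices, Multiset.mem_map, Set.mem_ofPred_eq, Set.mem_image]
  constructor
  · rintro ⟨_, ⟨e, he, rfl⟩, hv⟩
    obtain ⟨x, hx, rfl⟩ := Sym2.mem_map.1 hv
    exact ⟨x, ⟨e, he, hx⟩, rfl⟩
  · rintro ⟨x, ⟨e, he, hx⟩, rfl⟩
    exact ⟨_, ⟨e, he, rfl⟩, Sym2.mem_map.2 ⟨x, hx, rfl⟩⟩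

theorem ArcAdj.map (σ : ℕ → ℕ) {P : Multiset (Sym2 ℕ)} {u v : ℕ} (h : ArcAdj P u v) :
    ArcAdj (P.map (Sym2.map σ)) (σ u) (σ v) :=
  Multiset.mem_map.2 ⟨_, h, rfl⟩

theorem ArcAdj.exists_of_map {σ : ℕ → ℕ} {P : Multiset (Sym2 ℕ)} {u v : ℕ}
    (h : ArcAdj (P.map (Sym2.map σ)) u v) : ∃ x y, ArcAdj P x y ∧ σ x = u ∧ σ y = v := by
  obtain ⟨e, he, heq⟩ := Multiset.mem_map.1 h
  induction e with
  | h x y =>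
    rw [Sym2.map_mk, Sym2.eq_iff] at heq
    rcases heq with ⟨h1, h2⟩ | ⟨h1, h2⟩
    · exact ⟨x, y, he, h1, h2⟩
    · exact ⟨y, x, by rwa [ArcAdj, Sym2.eq_swap], h2, h1⟩

/-- An injective change of labels does not change the number of closed curves. -/
theorem circles_map_of_injective {σ : ℕ → ℕ} (hσ : σ.Injective) (P : Multiset (Sym2 ℕ)) :
    circles (P.map (Sym2.map σ)) = circles P := by
  have hφ : ∀ u v, ArcAdj P u v → (Quot.mk (ArcAdj (P.map (Sym2.map σ))) (σ u)) =
      Quot.mk _ (σ v) := fun u v h => Quot.sound (h.map σ)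
  set φ : Quot (ArcAdj P) → Quot (ArcAdj (P.map (Sym2.map σ))) := Quot.lift _ hφ with hφdef
  have hψ : ∀ u v, ArcAdj (P.map (Sym2.map σ)) u v →
      Quot.mk (ArcAdj P) (Function.invFun σ u) = Quot.mk _ (Function.invFun σ v) := by
    intro u v h
    obtain ⟨x, y, hxy, rfl, rfl⟩ := h.exists_of_map
    simp only [Function.leftInverse_invFun hσ _]
    exact Quot.sound hxy
  have hinj : φ.Injective := by
    refine Function.LeftInverse.injective (g := Quot.lift _ hψ) ?_
    rintro ⟨u⟩
    simp [φ, Function.leftInverse_invFun hσ u]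
  rw [circles, circles, vertices_map, ← Set.ncard_image_of_injective _ hinj, Set.image_image,
    Set.image_image]

/-- Shrinking an arc does not change the number of closed curves, unless the arc is all there is of
its curve. -/
theorem circles_cons_eq_contract {P : Multiset (Sym2 ℕ)} {a b : ℕ}
    (h : a ∈ vertices P ∨ b ∈ vertices P) :
    circles (s(a, b) ::ₘ P) = circles (P.map (Sym2.map (Function.update id b a))) := by
  set σ : ℕ → ℕ := Function.update id b a with hσ
  set P' := P.map (Sym2.map σ) with hP'
  have hvert : vertices P' = σ '' vertices P := vertices_map σ P
  have hσb : σ b = a := by simp [σ]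
  have hσne : ∀ x, x ≠ b → σ x = x := fun x hx => by simp [σ, hx]
  have hσσ : ∀ x, σ (σ x) = σ x := by
    intro x
    by_cases hx : x = b
    · subst hx
      rw [hσb]
      by_cases hab : a = x
      · rw [hab]; rw [hab] at hσb; exact hσb
      · exact hσne _ hab
    · rw [hσne x hx, hσne x hx]
  have hback : ∀ x, Quot.mk (ArcAdj (s(a, b) ::ₘ P)) (σ x) = Quot.mk _ x := by
    intro x
    by_cases hx : x = b
    · subst hx
      rw [hσb]
      exact Quot.sound (Multiset.mem_cons_self _ _)
    · rw [hσne x hx]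
  have hψ : ∀ u v, ArcAdj P' u v → Quot.mk (ArcAdj (s(a, b) ::ₘ P)) u = Quot.mk _ v := by
    intro u v huv
    obtain ⟨x, y, hxy, rfl, rfl⟩ := huv.exists_of_map
    rw [hback, hback]
    exact Quot.sound (Multiset.mem_cons_of_mem hxy)
  have hφ : ∀ u v, ArcAdj (s(a, b) ::ₘ P) u v → Quot.mk (ArcAdj P') (σ u) = Quot.mk _ (σ v) := by
    intro u v huv
    rcases Multiset.mem_cons.1 huv with huv | huv
    · have hσa : σ a = σ b := by rw [← hσb, hσσ]
      rcases Sym2.eq_iff.1 huv with ⟨rfl, rfl⟩ | ⟨rfl, rfl⟩ <;> rw [hσa]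
    · exact Quot.sound (ArcAdj.map σ huv)
  have himg : Quot.mk (ArcAdj (s(a, b) ::ₘ P)) '' vertices (s(a, b) ::ₘ P) =
      Quot.lift _ hψ '' (Quot.mk (ArcAdj P') '' vertices P') := by
    have ha : Quot.mk (ArcAdj (s(a, b) ::ₘ P)) a = Quot.mk _ b := by
      rw [← hback b, hσb]
    rw [Set.image_image, hvert, Set.image_image]
    simp only [hback]
    rw [vertices_cons, Set.image_union, Set.union_eq_right]
    rintro _ ⟨v, hv, rfl⟩
    have hv' : Quot.mk (ArcAdj (s(a, b) ::ₘ P)) v = Quot.mk _ a := by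
      rcases Sym2.mem_iff.1 hv with rfl | rfl
      · rfl
      · exact ha.symm
    rw [hv']
    rcases h with h | h
    · exact ⟨a, h, rfl⟩
    · exact ⟨b, h, ha.symm⟩
  rw [circles, circles, himg]
  refine Set.InjOn.ncard_image ?_
  rintro _ ⟨u, hu, rfl⟩ _ ⟨v, hv, rfl⟩ huv
  have := congrArg (Quot.lift _ hφ) huv
  rw [hvert] at hu hv
  obtain ⟨x, -, rfl⟩ := hu
  obtain ⟨y, -, rfl⟩ := hv
  simpa only [hσσ] using this

/-- An arc that closes up to a curve of its own contributes one curve. -/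
theorem circles_cons_loop {P : Multiset (Sym2 ℕ)} {m : ℕ} (h : m ∉ vertices P) :
    circles (s(m, m) ::ₘ P) = circles P + 1 := by
  have hm : ∀ {u v}, ArcAdj P u v → u ≠ m ∧ v ≠ m := fun {u v} huv =>
    ⟨fun e => h ⟨_, huv, by simp [e]⟩, fun e => h ⟨_, huv, by simp [e]⟩⟩
  have hψ : ∀ u v, ArcAdj P u v → Quot.mk (ArcAdj (s(m, m) ::ₘ P)) u = Quot.mk _ v :=
    fun u v huv => Quot.sound (Multiset.mem_cons_of_mem huv)
  have hφ : ∀ u v, ArcAdj (s(m, m) ::ₘ P) u v →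
      (if u = m then none else some (Quot.mk (ArcAdj P) u)) =
        (if v = m then none else some (Quot.mk (ArcAdj P) v)) := by
    intro u v huv
    rcases Multiset.mem_cons.1 huv with huv | huv
    · rcases Sym2.eq_iff.1 huv with ⟨rfl, rfl⟩ | ⟨rfl, rfl⟩ <;> rfl
    · rw [if_neg (hm huv).1, if_neg (hm huv).2, Quot.sound huv]
  set φ : Quot (ArcAdj (s(m, m) ::ₘ P)) → Option (Quot (ArcAdj P)) := Quot.lift _ hφ with hφ'
  have hφm : ∀ u, u ≠ m → φ (Quot.mk _ u) = some (Quot.mk _ u) := fun u hu => if_neg hu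
  have hne : ∀ u ∈ vertices P, u ≠ m := fun u hu e => h (e ▸ hu)
  have himg : Quot.mk (ArcAdj (s(m, m) ::ₘ P)) '' vertices (s(m, m) ::ₘ P) =
      insert (Quot.mk _ m) (Quot.lift _ hψ '' (Quot.mk (ArcAdj P) '' vertices P)) := by
    rw [vertices_cons, Set.image_union, Set.image_image, Set.insert_eq]
    congr 1
    simp
  rw [circles, circles, himg, Set.ncard_insert_of_notMem ?_ (((vertices_finite P).image _).image _),
    Set.InjOn.ncard_image]
  · rintro _ ⟨u, hu, rfl⟩ _ ⟨v, hv, rfl⟩ huv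
    have := congrArg φ huv
    simpa only [hφm u (hne u hu), hφm v (hne v hv), Option.some_inj] using this
  · rintro ⟨_, ⟨u, hu, rfl⟩, huv⟩
    have := congrArg φ huv
    simp only [hφm u (hne u hu)] at this
    simp [φ] at this

/-- The arcs named by a list of pairs of names; `l` gives the label that each name stands for. -/
def arcs {ι : Type*} (l : ι → ℕ) (M : List (ι × ι)) : Multiset (Sym2 ℕ) :=
  ((M.map fun p => s(l p.1, l p.2) : List (Sym2 ℕ)) : Multiset (Sym2 ℕ))

/-- The name `b` occurs in one of the pairs. -/
def Occurs {ι : Type*} (b : ι) (M : List (ι × ι)) : Prop := ∃ p ∈ M, p.1 = b ∨ p.2 = b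

theorem mem_vertices_arcs {ι : Type*} {l : ι → ℕ} {b : ι} {M : List (ι × ι)}
    (hl : ∀ x, l x = l b → x = b) : l b ∈ vertices (arcs l M) ↔ Occurs b M := by
  constructor
  · rintro ⟨e, he, hb⟩
    obtain ⟨p, hp, rfl⟩ := List.mem_map.1 (Multiset.mem_coe.1 he)
    refine ⟨p, hp, ?_⟩
    rcases Sym2.mem_iff.1 hb with h | h
    · exact Or.inl (hl _ h.symm)
    · exact Or.inr (hl _ h.symm)
  · rintro ⟨p, hp, h⟩
    refine ⟨_, Multiset.mem_coe.2 (List.mem_map.2 ⟨p, hp, rfl⟩), ?_⟩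
    rcases h with rfl | rfl <;> simp

section Reduction

variable {ι : Type*} [DecidableEq ι]

/-- Remove the first pair that contains `b`, and return the partner of `b` in it as well as the
remaining pairs. -/
def extract (b : ι) : List (ι × ι) → Option (ι × List (ι × ι))
  | [] => none
  | p :: M =>
    if p.1 = b then some (p.2, M)
    else if p.2 = b then some (p.1, M)
    else (extract b M).map fun q => (q.1, p :: q.2)

instance (b : ι) (M : List (ι × ι)) : Decidable (Occurs b M) :=
  inferInstanceAs (Decidable (∃ p ∈ M, p.1 = b ∨ p.2 = b))

/-- Eliminate the name `b`: shrink an arc that ends at `b`, or remove a closed arc at `b`. The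
number returned is the number of closed curves that have been removed. -/
def eliminate (b : ι) (M : List (ι × ι)) : Option (List (ι × ι) × ℕ) :=
  match extract b M with
  | none => none
  | some (a, M') =>
    if a = b then if Occurs b M' then none else some (M', 1)
    else if Occurs b M' then
      some (M'.map fun p => (Function.update id b a p.1, Function.update id b a p.2), 0)
    else none

/-- Eliminate several names one after the other. -/
def reduce : List ι → List (ι × ι) → Option (List (ι × ι) × ℕ)
  | [], M => some (M, 0)
  | b :: I, M =>
    match eliminate b M with
    | none => none
    | some (M', k) => (reduce I M').map fun q => (q.1, q.2 + k)

theorem arcs_of_extract {b a : ι} {M M' : List (ι × ι)} (l : ι → ℕ)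
    (h : extract b M = some (a, M')) : arcs l M = s(l a, l b) ::ₘ arcs l M' := by
  induction M generalizing M' with
  | nil => simp [extract] at h
  | cons p M ih =>
    rw [extract] at h
    split_ifs at h with h1 h2
    · obtain ⟨rfl, rfl⟩ : p.2 = a ∧ M = M' := by simpa using h
      subst h1
      simp [arcs, Sym2.eq_swap]
    · obtain ⟨rfl, rfl⟩ : p.1 = a ∧ M = M' := by simpa using h
      subst h2
      simp [arcs]
    · rw [Option.map_eq_some_iff] at h
      obtain ⟨⟨a', N⟩, hN, heq⟩ := h
      obtain ⟨rfl, rfl⟩ : a' = a ∧ p :: N = M' := by simpa using heq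
      have := ih hN
      simp only [arcs, List.map_cons, ← Multiset.cons_coe] at this ⊢
      rw [this, Multiset.cons_swap]

theorem circles_eliminate {l : ι → ℕ} {b : ι} {M M' : List (ι × ι)} {k : ℕ}
    {P : Multiset (Sym2 ℕ)} (hl : ∀ x, l x = l b → x = b) (hP : l b ∉ vertices P)
    (h : eliminate b M = some (M', k)) :
    circles (P + arcs l M) = circles (P + arcs l M') + k := by
  rw [eliminate] at h
  split at h
  · simp at h
  rename_i a N hN
  rw [arcs_of_extract l hN, Multiset.add_cons]
  split_ifs at h with h1 h2 h3
  · obtain ⟨rfl, rfl⟩ : N = M' ∧ 1 = k := by simpa using h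
    subst h1
    refine circles_cons_loop ?_
    rw [vertices_add, Set.mem_union, mem_vertices_arcs hl]
    tauto
  · obtain ⟨rfl, rfl⟩ : _ = M' ∧ 0 = k := by simpa using h
    rw [circles_cons_eq_contract, add_zero, Multiset.map_add]
    · congr 2
      · conv_rhs => rw [← Multiset.map_id P]
        refine Multiset.map_congr rfl fun e he => ?_
        induction e with
        | h x y =>
          have hx : x ≠ l b := fun e => hP ⟨_, he, by simp [e]⟩
          have hy : y ≠ l b := fun e => hP ⟨_, he, by simp [e]⟩
          simp [hx, hy]
      · have key : ∀ x, Function.update id (l b) (l a) (l x) = l (Function.update id b a x) := by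
          intro x
          by_cases hx : x = b
          · subst hx; simp
          · have hx' : l x ≠ l b := fun e => hx (hl x e)
            simp [hx, hx']
        simp only [arcs, Multiset.map_coe, List.map_map]
        congr 1
        refine List.map_congr_left fun p _ => ?_
        simp only [Function.comp, Sym2.map_mk, key]
    · right
      rw [vertices_add, Set.mem_union, mem_vertices_arcs hl]
      exact Or.inr h3

/-- The elimination of names that only occur in the list keeps track of the number of closed
curves, whatever arcs are added outside. -/
theorem circles_reduce {l : ι → ℕ} {I : List ι} {M M' : List (ι × ι)} {k : ℕ}
    {P : Multiset (Sym2 ℕ)} (hl : ∀ b ∈ I, ∀ x, l x = l b → x = b)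
    (hP : ∀ b ∈ I, l b ∉ vertices P) (h : reduce I M = some (M', k)) :
    circles (P + arcs l M) = circles (P + arcs l M') + k := by
  induction I generalizing M k with
  | nil =>
    obtain ⟨rfl, rfl⟩ : M = M' ∧ 0 = k := by simpa [reduce] using h
    rfl
  | cons b I ih =>
    rw [reduce] at h
    split at h
    · simp at h
    rename_i N j hN
    rw [Option.map_eq_some_iff] at h
    obtain ⟨⟨N', i⟩, hN', heq⟩ := h
    obtain ⟨rfl, rfl⟩ : N' = M' ∧ i + j = k := by simpa using heq
    rw [circles_eliminate (hl b (by simp)) (hP b (by simp)) hN,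
      ih (fun c hc => hl c (by simp [hc])) (fun c hc => hP c (by simp [hc])) hN', add_assoc]

end Reduction

/-! ### Local identities for resolved crossings -/

/-- The two arcs, given by the names of their ends, by which a smoothing replaces a crossing. -/
def resolve {ι : Type*} (t : Smoothing) (sw se nw ne : ι) : List (ι × ι) :=
  match t with
  | .along => [(sw, nw), (se, ne)]
  | .against => [(sw, se), (nw, ne)]
  | .virt => [(sw, ne), (se, nw)]

theorem arcs_append {ι : Type*} (l : ι → ℕ) (M N : List (ι × ι)) :
    arcs l (M ++ N) = arcs l M + arcs l N := by
  simp [arcs]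

/-- After elimination of the names in `I`, the list `M` has the same arcs as the list `N` up to
order and orientation, and `k` closed curves have been removed. -/
def ReducesTo {ι : Type*} [DecidableEq ι] (I : List ι) (M N : List (ι × ι)) (k : ℕ) : Prop :=
  (reduce I M).map (fun q => ((q.1.map fun p => s(p.1, p.2) : Multiset (Sym2 ι)), q.2)) =
    some ((N.map fun p => s(p.1, p.2) : Multiset (Sym2 ι)), k)

instance {ι : Type*} [DecidableEq ι] (I : List ι) (M N : List (ι × ι)) (k : ℕ) :
    Decidable (ReducesTo I M N k) :=
  inferInstanceAs (Decidable (_ = _))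

theorem arcs_eq_map {ι : Type*} (l : ι → ℕ) (M : List (ι × ι)) :
    arcs l M = (M.map fun p => s(p.1, p.2) : Multiset (Sym2 ι)).map (Sym2.map l) := by
  simp [arcs, Function.comp_def]

/-- The labels `l` are admissible for the elimination of the names in `I` in the presence of the
arcs `P`: the label of such a name belongs to no other name and to no arc of `P`. -/
structure Separated {ι : Type*} (l : ι → ℕ) (I : List ι) (P : Multiset (Sym2 ℕ)) : Prop where
  injective : ∀ b ∈ I, ∀ x, l x = l b → x = b
  notMem : ∀ b ∈ I, l b ∉ vertices P

theorem ReducesTo.pow_circles {ι : Type*} [DecidableEq ι] {I : List ι} {M N : List (ι × ι)} {k : ℕ}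
    (h : ReducesTo I M N k) {l : ι → ℕ} {P : Multiset (Sym2 ℕ)} (hl : Separated l I P)
    {R : Type v} [CommRing R] (δ : R) :
    δ ^ circles (P + arcs l M) = δ ^ k * δ ^ circles (P + arcs l N) := by
  obtain ⟨⟨M', k'⟩, hM', heq⟩ := Option.map_eq_some_iff.1 h
  obtain ⟨h1, h2⟩ := Prod.ext_iff.1 heq
  dsimp only at h1 h2
  subst h2
  rw [circles_reduce hl.1 hl.2 hM', arcs_eq_map l M', h1, ← arcs_eq_map, pow_add, mul_comm]

theorem sum_smoothing {R : Type v} [AddCommMonoid R] (f : Smoothing → R) :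
    ∑ t, f t = f .along + f .against + f .virt := by
  have : (Finset.univ : Finset Smoothing) = {.along, .against, .virt} := rfl
  rw [this]
  simp [add_assoc]

section Identities

variable {R : Type v} [CommRing R] (δ : R)

/-- The sum over the smoothings of a kink, computed by elimination of the name `2` of its loop. -/
theorem kink_right_identity {l : Fin 3 → ℕ} {P : Multiset (Sym2 ℕ)} (hl : Separated l [2] P)
    {c : Smoothing → R} (hc : δ * c .along + c .against + c .virt = 1) :
    ∑ t, c t * δ ^ circles (P + arcs l (resolve t 0 2 1 2)) =
      δ ^ circles (P + arcs l [(0, 1)]) := by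
  have h : ∀ t, ReducesTo [2] (resolve t (0 : Fin 3) 2 1 2) [(0, 1)]
      (if t = .along then 1 else 0) := by decide
  simp only [(h _).pow_circles hl, sum_smoothing]
  simp only [reduceCtorEq, if_true, if_false]
  linear_combination δ ^ circles (P + arcs l [(0, 1)]) * hc

theorem kink_left_identity {l : Fin 3 → ℕ} {P : Multiset (Sym2 ℕ)} (hl : Separated l [2] P)
    {c : Smoothing → R} (hc : δ * c .along + c .against + c .virt = 1) :
    ∑ t, c t * δ ^ circles (P + arcs l (resolve t 2 0 2 1)) =
      δ ^ circles (P + arcs l [(0, 1)]) := by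
  have h : ∀ t, ReducesTo [2] (resolve t 2 (0 : Fin 3) 2 1) [(0, 1)]
      (if t = .along then 1 else 0) := by decide
  simp only [(h _).pow_circles hl, sum_smoothing]
  simp only [reduceCtorEq, if_true, if_false]
  linear_combination δ ^ circles (P + arcs l [(0, 1)]) * hc

/-- The relations between the weights `c` and `d` of two crossings under which they cancel in each
of the moves of type II. -/
structure BigonRelations (c d : Smoothing → R) : Prop where
  along_along : c .along * d .along + c .virt * d .virt = 1
  against_against : c .against * d .against + c .virt * d .virt = 1
  along_virt : c .along * d .virt + c .virt * d .along = 0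
  against_virt : c .against * d .virt + c .virt * d .against = 0
  loop_against : δ * (c .against * d .against) + c .along * d .against + c .against * d .along = 0
  loop_along : δ * (c .along * d .along) + c .along * d .against + c .against * d .along = 0

variable {δ}

theorem BigonRelations.symm {c d : Smoothing → R} (h : BigonRelations δ c d) :
    BigonRelations δ d c where
  along_along := by linear_combination h.along_along
  against_against := by linear_combination h.against_against
  along_virt := by linear_combination h.along_virt
  against_virt := by linear_combination h.against_virt
  loop_against := by linear_combination h.loop_against
  loop_along := by linear_combination h.loop_along

/-- The three ways to join four points in pairs. The names `4` and `5` stand for the edges of the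
bigon. -/
def pairings₄ : Fin 3 → List (Fin 6 × Fin 6)
  | 0 => [(0, 2), (1, 3)]
  | 1 => [(0, 3), (1, 2)]
  | 2 => [(0, 1), (2, 3)]

/-- The pairing of the ends `0`, `1` (entering) and `2`, `3` (leaving) of two successive parallel
strands after the two crossings between them have been smoothed. -/
def directIndex : Smoothing → Smoothing → Fin 3
  | .along, .along | .virt, .virt => 0
  | .along, .virt | .virt, .along => 1
  | _, _ => 2

theorem direct_identity {l : Fin 6 → ℕ} {P : Multiset (Sym2 ℕ)} (hl : Separated l [4, 5] P)
    {c d : Smoothing → R} (h : BigonRelations δ c d) :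
    ∑ s, c s * ∑ t, d t * δ ^ circles (P + arcs l (resolve s 0 1 4 5 ++ resolve t 4 5 2 3)) =
      δ ^ circles (P + arcs l [(0, 2), (1, 3)]) := by
  have hred : ∀ s t, ReducesTo [4, 5] (resolve s (0 : Fin 6) 1 4 5 ++ resolve t 4 5 2 3)
      (pairings₄ (directIndex s t)) (if s = .against ∧ t = .against then 1 else 0) := by decide
  change _ = δ ^ circles (P + arcs l (pairings₄ 0))
  simp only [(hred _ _).pow_circles hl, sum_smoothing, directIndex]
  simp only [reduceCtorEq, and_true, and_false, if_true, if_false]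
  linear_combination δ ^ circles (P + arcs l (pairings₄ 0)) * h.along_along +
    δ ^ circles (P + arcs l (pairings₄ 1)) * h.along_virt +
    δ ^ circles (P + arcs l (pairings₄ 2)) * (h.loop_against + h.against_virt)

/-- The pairing of the ends `0`, `1` (entering) and `2`, `3` (leaving) of two antiparallel strands
after the two crossings between them have been smoothed. -/
def reverseIndex : Smoothing → Smoothing → Fin 3
  | .against, .against | .virt, .virt => 0
  | .against, .virt | .virt, .against => 2
  | _, _ => 1

theorem reverse_right_identity {l : Fin 6 → ℕ} {P : Multiset (Sym2 ℕ)} (hl : Separated l [4, 5] P)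
    {c d : Smoothing → R} (h : BigonRelations δ c d) :
    ∑ s, c s * ∑ t, d t * δ ^ circles (P + arcs l (resolve s 0 4 3 5 ++ resolve t 1 5 2 4)) =
      δ ^ circles (P + arcs l [(0, 2), (1, 3)]) := by
  have hred : ∀ s t, ReducesTo [4, 5] (resolve s (0 : Fin 6) 4 3 5 ++ resolve t 1 5 2 4)
      (pairings₄ (reverseIndex s t)) (if s = .along ∧ t = .along then 1 else 0) := by decide
  change _ = δ ^ circles (P + arcs l (pairings₄ 0))
  simp only [(hred _ _).pow_circles hl, sum_smoothing, reverseIndex]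
  simp only [reduceCtorEq, and_true, and_false, if_true, if_false]
  linear_combination δ ^ circles (P + arcs l (pairings₄ 0)) * h.against_against +
    δ ^ circles (P + arcs l (pairings₄ 2)) * h.against_virt +
    δ ^ circles (P + arcs l (pairings₄ 1)) * (h.loop_along + h.along_virt)

theorem reverse_left_identity {l : Fin 6 → ℕ} {P : Multiset (Sym2 ℕ)} (hl : Separated l [4, 5] P)
    {c d : Smoothing → R} (h : BigonRelations δ c d) :
    ∑ s, c s * ∑ t, d t * δ ^ circles (P + arcs l (resolve s 4 0 5 3 ++ resolve t 5 1 4 2)) =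
      δ ^ circles (P + arcs l [(0, 2), (1, 3)]) := by
  have hred : ∀ s t, ReducesTo [4, 5] (resolve s 4 (0 : Fin 6) 5 3 ++ resolve t 5 1 4 2)
      (pairings₄ (reverseIndex s t)) (if s = .along ∧ t = .along then 1 else 0) := by decide
  change _ = δ ^ circles (P + arcs l (pairings₄ 0))
  simp only [(hred _ _).pow_circles hl, sum_smoothing, reverseIndex]
  simp only [reduceCtorEq, and_true, and_false, if_true, if_false]
  linear_combination δ ^ circles (P + arcs l (pairings₄ 0)) * h.against_against +
    δ ^ circles (P + arcs l (pairings₄ 2)) * h.against_virt +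
    δ ^ circles (P + arcs l (pairings₄ 1)) * (h.loop_along + h.along_virt)

/-- The fifteen ways to join six points in pairs. The names `0`, `1`, `2` stand for the edges entering
a triangle, `3`, `4`, `5` for those leaving it, and `6`, `7`, `8` for the edges inside. -/
def pairings₆ : Fin 15 → List (Fin 9 × Fin 9)
  | 0 => [(0, 3), (1, 4), (2, 5)]
  | 1 => [(0, 1), (2, 5), (3, 4)]
  | 2 => [(0, 3), (1, 2), (4, 5)]
  | 3 => [(0, 3), (1, 5), (2, 4)]
  | 4 => [(0, 4), (1, 3), (2, 5)]
  | 5 => [(0, 5), (1, 2), (3, 4)]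
  | 6 => [(0, 1), (2, 3), (4, 5)]
  | 7 => [(0, 2), (1, 5), (3, 4)]
  | 8 => [(0, 2), (1, 3), (4, 5)]
  | 9 => [(0, 4), (1, 2), (3, 5)]
  | 10 => [(0, 1), (2, 4), (3, 5)]
  | 11 => [(0, 4), (1, 5), (2, 3)]
  | 12 => [(0, 5), (1, 3), (2, 4)]
  | 13 => [(0, 2), (1, 4), (3, 5)]
  | 14 => [(0, 5), (1, 4), (2, 3)]

/-- The pairing of the six ends of the triangle on the left-hand side of move III, for given
smoothings of the crossings of the first and second, the first and third, and the second and third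
of the strands leaving at `3`, `4`, `5`. -/
def triangleIndex : Smoothing → Smoothing → Smoothing → Fin 15
  | .along, .along, .along | .virt, .along, .virt => 0
  | .against, .along, .along | .along, .along, .against | .against, .along, .against | .virt,
    .along, .against | .against, .against, .against | .against, .virt, .against | .against,
    .along, .virt => 1
  | .along, .against, .along => 2
  | .along, .virt, .along => 3
  | .virt, .along, .along | .along, .along, .virt => 4
  | .against, .against, .along | .against, .virt, .virt => 5
  | .along, .against, .against | .virt, .virt, .against => 6
  | .against, .virt, .along | .against, .against, .virt => 7
  | .along, .against, .virt => 8
  | .virt, .against, .along => 9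
  | .virt, .against, .against | .along, .virt, .against => 10
  | .virt, .virt, .along => 11
  | .along, .virt, .virt => 12
  | .virt, .against, .virt => 13
  | .virt, .virt, .virt => 14

/-- The pairing of the six ends of the triangle on the right-hand side of move III, for given
smoothings of the crossings of the second and third, the first and third, and the first and second
of the strands leaving at `3`, `4`, `5`. -/
def triangleIndex' : Smoothing → Smoothing → Smoothing → Fin 15
  | .along, .along, .along | .virt, .along, .virt => 0
  | .along, .against, .along => 1
  | .against, .along, .along | .along, .along, .against | .against, .along, .against | .virt,
    .along, .against | .against, .against, .against | .against, .virt, .against | .against,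
    .along, .virt => 2
  | .virt, .along, .along | .along, .along, .virt => 3
  | .along, .virt, .along => 4
  | .along, .against, .against | .virt, .virt, .against => 5
  | .against, .against, .along | .against, .virt, .virt => 6
  | .along, .against, .virt => 7
  | .against, .virt, .along | .against, .against, .virt => 8
  | .virt, .against, .against | .along, .virt, .against => 9
  | .virt, .against, .along => 10
  | .along, .virt, .virt => 11
  | .virt, .virt, .along => 12
  | .virt, .against, .virt => 13
  | .virt, .virt, .virt => 14

variable (δ) in
/-- The relations between the weights of the six crossings of move III, one for each pairing of the
six ends. The letters in the names stand for smoothing along the orientation (`A`), against the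
orientation (`B`) and making the crossing virtual (`V`). -/
structure TriangleRelations (a b c a' b' c' : Smoothing → R) : Prop where
  AAA : a .along * b .along * c .along + a .virt * b .along * c .virt =
      a' .along * b' .along * c' .along + a' .virt * b' .along * c' .virt
  BAB : a .against * b .along * c .along + a .along * b .along * c .against + δ * (a .against * b
    .along * c .against) + a .virt * b .along * c .against + a .against * b .against * c .against
    + a .against * b .virt * c .against + a .against * b .along * c .virt =
      a' .along * b' .against * c' .along
  ABA : a .along * b .against * c .along =
      a' .against * b' .along * c' .along + a' .along * b' .along * c' .against + δ * (a' .against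
        * b' .along * c' .against) + a' .virt * b' .along * c' .against + a' .against * b'
        .against * c' .against + a' .against * b' .virt * c' .against + a' .against * b' .along *
        c' .virt
  AVA : a .along * b .virt * c .along =
      a' .virt * b' .along * c' .along + a' .along * b' .along * c' .virt
  AAV : a .virt * b .along * c .along + a .along * b .along * c .virt =
      a' .along * b' .virt * c' .along
  BBA : a .against * b .against * c .along + a .against * b .virt * c .virt =
      a' .along * b' .against * c' .against + a' .virt * b' .virt * c' .against
  ABB : a .along * b .against * c .against + a .virt * b .virt * c .against =
      a' .against * b' .against * c' .along + a' .against * b' .virt * c' .virt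
  BBV : a .against * b .virt * c .along + a .against * b .against * c .virt =
      a' .along * b' .against * c' .virt
  ABV : a .along * b .against * c .virt =
      a' .against * b' .virt * c' .along + a' .against * b' .against * c' .virt
  VBA : a .virt * b .against * c .along =
      a' .virt * b' .against * c' .against + a' .along * b' .virt * c' .against
  AVB : a .virt * b .against * c .against + a .along * b .virt * c .against =
      a' .virt * b' .against * c' .along
  VVA : a .virt * b .virt * c .along =
      a' .along * b' .virt * c' .virt
  AVV : a .along * b .virt * c .virt =
      a' .virt * b' .virt * c' .along
  VBV : a .virt * b .against * c .virt =
      a' .virt * b' .against * c' .virt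
  VVV : a .virt * b .virt * c .virt =
      a' .virt * b' .virt * c' .virt

/-- The states of the two sides of move III, collected by the pairings of the six ends that they
leave. On each side exactly one state contains a closed curve: the crossing of the first and third
strands is smoothed along the orientation and the other two against it. -/
theorem triangle_identity {l : Fin 9 → ℕ} {P : Multiset (Sym2 ℕ)} (hl : Separated l [6, 7, 8] P)
    {a b c a' b' c' : Smoothing → R} (h : TriangleRelations δ a b c a' b' c') :
    ∑ t, c t * ∑ s, b s * ∑ r, a r * δ ^ circles
        (P + arcs l (resolve t 0 1 6 7 ++ resolve s 7 2 8 5 ++ resolve r 6 8 3 4)) =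
      ∑ t, c' t * ∑ s, b' s * ∑ r, a' r * δ ^ circles
        (P + arcs l (resolve t 1 2 6 7 ++ resolve s 0 6 3 8 ++ resolve r 8 7 4 5)) := by
  have hred : ∀ r s t, ReducesTo [6, 7, 8]
      (resolve t (0 : Fin 9) 1 6 7 ++ resolve s 7 2 8 5 ++ resolve r 6 8 3 4)
      (pairings₆ (triangleIndex r s t))
      (if r = .against ∧ s = .along ∧ t = .against then 1 else 0) := by decide
  have hred' : ∀ r s t, ReducesTo [6, 7, 8]
      (resolve t (1 : Fin 9) 2 6 7 ++ resolve s 0 6 3 8 ++ resolve r 8 7 4 5)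
      (pairings₆ (triangleIndex' r s t))
      (if r = .against ∧ s = .along ∧ t = .against then 1 else 0) := by decide
  simp only [(hred _ _ _).pow_circles hl, (hred' _ _ _).pow_circles hl, sum_smoothing,
    triangleIndex, triangleIndex']
  simp only [reduceCtorEq, and_true, and_false, if_true, if_false]
  linear_combination
    δ ^ circles (P + arcs l (pairings₆ 0)) * h.AAA +
    δ ^ circles (P + arcs l (pairings₆ 1)) * h.BAB +
    δ ^ circles (P + arcs l (pairings₆ 2)) * h.ABA +
    δ ^ circles (P + arcs l (pairings₆ 3)) * h.AVA +
    δ ^ circles (P + arcs l (pairings₆ 4)) * h.AAV +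
    δ ^ circles (P + arcs l (pairings₆ 5)) * h.BBA +
    δ ^ circles (P + arcs l (pairings₆ 6)) * h.ABB +
    δ ^ circles (P + arcs l (pairings₆ 7)) * h.BBV +
    δ ^ circles (P + arcs l (pairings₆ 8)) * h.ABV +
    δ ^ circles (P + arcs l (pairings₆ 9)) * h.VBA +
    δ ^ circles (P + arcs l (pairings₆ 10)) * h.AVB +
    δ ^ circles (P + arcs l (pairings₆ 11)) * h.VVA +
    δ ^ circles (P + arcs l (pairings₆ 12)) * h.AVV +
    δ ^ circles (P + arcs l (pairings₆ 13)) * h.VBV +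
    δ ^ circles (P + arcs l (pairings₆ 14)) * h.VVV

end Identities

/-! ### The skein element of a colored piece of a diagram -/

section Skein

variable {X : Type u} [Biquandle X] {R : Type v} [CommRing R] (β : Biquandle.VirtualBracket X R)

/-- The coefficients of the smoothings of a crossing, with the writhe correction included. A virtual
crossing is treated as a crossing that can only be smoothed by keeping it. -/
def weight (k : Kind) (x y : X) (t : Smoothing) : R :=
  match k with
  | .pos => (β.w⁻¹ : Rˣ) * coefficient β .pos t x y
  | .neg => (β.w : R) * coefficient β .neg t x y
  | .virt => if t = .virt then 1 else 0

/-- The arcs by which a smoothing replaces a crossing. -/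
def Crossing.arcs (c : Crossing) (t : Smoothing) : Multiset (Sym2 ℕ) :=
  VirtualLink.arcs id (resolve t c.sw c.se c.nw c.ne)

theorem Crossing.arcs_mk {ι : Type*} (l : ι → ℕ) (k : Kind) (a b c d : ι) (t : Smoothing) :
    (⟨k, l a, l b, l c, l d⟩ : Crossing).arcs t = VirtualLink.arcs l (resolve t a b c d) := by
  cases t <;> rfl

/-- The formal sum of the smoothings of a crossing, colored by `g`, with their coefficients. -/
noncomputable def Crossing.skein (g : ℕ → X) (c : Crossing) :
    AddMonoidAlgebra R (Multiset (Sym2 ℕ)) :=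
  ∑ t, AddMonoidAlgebra.single (c.arcs t) (weight β c.kind (g c.underLeft) (g c.overLeft) t)

/-- The marked points of a piece of a diagram, as arcs. -/
def Code.markArcs (T : Code) : Multiset (Sym2 ℕ) := T.marks.map fun m => s(m.1, m.2)

/-- The formal sum of the states of a piece of a diagram colored by `g`: each state is the system
of its arcs, and systems of arcs are multiplied by uniting them. -/
noncomputable def Code.skein (g : ℕ → X) (T : Code) : AddMonoidAlgebra R (Multiset (Sym2 ℕ)) :=
  (T.crossings.map (Crossing.skein β g)).prod * AddMonoidAlgebra.single T.markArcs 1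

theorem Code.skein_join (g : ℕ → X) (S T : Code) :
    (S.join T).skein β g = S.skein β g * T.skein β g := by
  have : AddMonoidAlgebra.single (S.join T).markArcs (1 : R) =
      AddMonoidAlgebra.single S.markArcs 1 * AddMonoidAlgebra.single T.markArcs 1 := by
    simp [AddMonoidAlgebra.single_mul_single, markArcs, join]
  rw [skein, this]
  simp only [skein, join, Multiset.map_add, Multiset.prod_add]
  ring

end Skein

section Evaluation

variable {R : Type v} [CommRing R] (δ : R)

/-- The additive map that sends a system of arcs with `n` closed curves to `δ ^ n`. -/
noncomputable def evaluate : AddMonoidAlgebra R (Multiset (Sym2 ℕ)) →+ R :=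
  AddMonoidAlgebra.liftNC (AddMonoidHom.id R) fun P => δ ^ circles P.toAdd

@[simp]
theorem evaluate_single (P : Multiset (Sym2 ℕ)) (r : R) :
    evaluate δ (AddMonoidAlgebra.single P r) = r * δ ^ circles P := by
  simp [evaluate]

theorem evaluate_single_mul (P : Multiset (Sym2 ℕ)) (r : R)
    (z : AddMonoidAlgebra R (Multiset (Sym2 ℕ))) :
    evaluate δ (AddMonoidAlgebra.single P r * z) =
      r * evaluate δ (AddMonoidAlgebra.single P 1 * z) := by
  induction z using AddMonoidAlgebra.induction_linear with
  | zero => simp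
  | add x y hx hy => rw [mul_add, mul_add, map_add, map_add, hx, hy, mul_add]
  | single Q a => simp [AddMonoidAlgebra.single_mul_single, mul_assoc]

variable {X : Type u} [Biquandle X] (β : Biquandle.VirtualBracket X R)

/-- Expansion of a state sum at one crossing. -/
theorem evaluate_skein_mul (g : ℕ → X) (c : Crossing) (P : Multiset (Sym2 ℕ))
    (z : AddMonoidAlgebra R (Multiset (Sym2 ℕ))) :
    evaluate δ (AddMonoidAlgebra.single P 1 * (c.skein β g * z)) =
      ∑ t, weight β c.kind (g c.underLeft) (g c.overLeft) t *
        evaluate δ (AddMonoidAlgebra.single (P + c.arcs t) 1 * z) := by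
  rw [← mul_assoc, Crossing.skein, Finset.mul_sum, Finset.sum_mul, map_sum]
  refine Finset.sum_congr rfl fun t _ => ?_
  rw [AddMonoidAlgebra.single_mul_single, one_mul, evaluate_single_mul]

theorem evaluate_skein_marks (g : ℕ → X) (M : Multiset (ℕ × ℕ)) (P : Multiset (Sym2 ℕ)) :
    evaluate δ (AddMonoidAlgebra.single P 1 * (⟨0, M⟩ : Code).skein β g) =
      δ ^ circles (P + M.map fun m => s(m.1, m.2)) := by
  simp [Code.skein, Code.markArcs, AddMonoidAlgebra.single_mul_single]

theorem evaluate_skein_one (g : ℕ → X) (c : Crossing) (P : Multiset (Sym2 ℕ)) :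
    evaluate δ (AddMonoidAlgebra.single P 1 * (⟨{c}, 0⟩ : Code).skein β g) =
      ∑ t, weight β c.kind (g c.underLeft) (g c.overLeft) t * δ ^ circles (P + c.arcs t) := by
  rw [Code.skein, Multiset.map_singleton, Multiset.prod_singleton, evaluate_skein_mul]
  simp [Code.markArcs, AddMonoidAlgebra.single_mul_single]

theorem evaluate_skein_cons (g : ℕ → X) (c : Crossing) (C : Multiset Crossing)
    (P : Multiset (Sym2 ℕ)) :
    evaluate δ (AddMonoidAlgebra.single P 1 * (⟨c ::ₘ C, 0⟩ : Code).skein β g) =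
      ∑ t, weight β c.kind (g c.underLeft) (g c.overLeft) t *
        evaluate δ (AddMonoidAlgebra.single (P + c.arcs t) 1 * (⟨C, 0⟩ : Code).skein β g) := by
  rw [Code.skein, Multiset.map_cons, Multiset.prod_cons, mul_assoc, evaluate_skein_mul]
  rfl

end Evaluation

/-! ### The weights satisfy the local identities -/

section Weights

variable {X : Type u} [Biquandle X] {R : Type v} [CommRing R] (β : Biquandle.VirtualBracket X R)

/-- The relations for `w` and its inverse, multiplied by the writhe correction. -/
theorem weight_kink (k : Kind) (x : X) :
    β.δ * weight β k x x .along + weight β k x x .against + weight β k x x .virt = 1 := by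
  have hw : (β.w : R) * (β.w⁻¹ : Rˣ) = 1 := β.w.mul_inv
  cases k with
  | pos => simp only [weight, coefficient]; linear_combination hw - (β.w⁻¹ : Rˣ) * β.i_1 x
  | neg => simp only [weight, coefficient]; linear_combination hw - (β.w : R) * β.i_2 x
  | virt => simp [weight]

/-- The two crossings of a bigon have opposite signs, so their writhe corrections cancel. -/
theorem weight_bigon (k : Kind) (x y : X) :
    BigonRelations β.δ (weight β k x y) (weight β k.flip x y) := by
  have hw : ((β.w⁻¹ : Rˣ) : R) * β.w = 1 := β.w.inv_mul
  have key : BigonRelations β.δ (weight β .pos x y) (weight β .neg x y) := by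
    constructor <;> simp only [weight, coefficient]
    · linear_combination hw * (β.A x y * β.C x y + β.V x y * β.U x y) - β.ii_1 x y
    · linear_combination hw * (β.B x y * β.D x y + β.V x y * β.U x y) - β.ii_2 x y
    · linear_combination hw * (β.A x y * β.U x y + β.V x y * β.C x y) - β.ii_3 x y
    · linear_combination hw * (β.B x y * β.U x y + β.V x y * β.D x y) - β.ii_4 x y
    · linear_combination hw * (β.δ * (β.B x y * β.D x y) + β.A x y * β.D x y +
        β.B x y * β.C x y) - β.ii_5 x y
    · linear_combination hw * (β.δ * (β.A x y * β.C x y) + β.A x y * β.D x y +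
        β.B x y * β.C x y) - β.ii_6 x y
  cases k with
  | pos => exact key
  | neg => exact key.symm
  | virt => constructor <;> simp [weight, Kind.flip]

/-- All six crossings of move III are positive, so that every term carries the same writhe correction
`w⁻¹ ^ 3`. -/
theorem weight_triangle (x y z : X) :
    TriangleRelations β.δ (weight β .pos x y) (weight β .pos (underBy x y) (overBy z y))
      (weight β .pos y z) (weight β .pos (overBy y x) (overBy z x)) (weight β .pos x z)
      (weight β .pos (underBy x z) (underBy y z)) := by
  constructor <;> simp only [weight, coefficient]
  · linear_combination ((β.w⁻¹ : Rˣ) : R) ^ 3 * β.iii_1 x y z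
  · linear_combination ((β.w⁻¹ : Rˣ) : R) ^ 3 * β.iii_2 x y z
  · linear_combination ((β.w⁻¹ : Rˣ) : R) ^ 3 * β.iii_3 x y z
  · linear_combination ((β.w⁻¹ : Rˣ) : R) ^ 3 * β.iii_4 x y z
  · linear_combination ((β.w⁻¹ : Rˣ) : R) ^ 3 * β.iii_5 x y z
  · linear_combination ((β.w⁻¹ : Rˣ) : R) ^ 3 * β.iii_6 x y z
  · linear_combination ((β.w⁻¹ : Rˣ) : R) ^ 3 * β.iii_7 x y z
  · linear_combination ((β.w⁻¹ : Rˣ) : R) ^ 3 * β.iii_8 x y z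
  · linear_combination ((β.w⁻¹ : Rˣ) : R) ^ 3 * β.iii_9 x y z
  · linear_combination ((β.w⁻¹ : Rˣ) : R) ^ 3 * β.iii_10 x y z
  · linear_combination ((β.w⁻¹ : Rˣ) : R) ^ 3 * β.iii_11 x y z
  · linear_combination ((β.w⁻¹ : Rˣ) : R) ^ 3 * β.iii_12 x y z
  · linear_combination ((β.w⁻¹ : Rˣ) : R) ^ 3 * β.iii_13 x y z
  · linear_combination ((β.w⁻¹ : Rˣ) : R) ^ 3 * β.iii_14 x y z
  · linear_combination ((β.w⁻¹ : Rˣ) : R) ^ 3 * β.iii_15 x y z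

/-- If two of the three crossings are virtual, each side has only three states, one for each smoothing
of the remaining crossing, and they agree one by one. -/
theorem weight_virtual_triangle (c : Smoothing → R) (x₁ y₁ x₂ y₂ x₃ y₃ x₄ y₄ : X) :
    TriangleRelations β.δ c (weight β .virt x₁ y₁) (weight β .virt x₂ y₂)
      (weight β .virt x₃ y₃) (weight β .virt x₄ y₄) c := by
  constructor <;> simp [weight]

end Weights

/-! ### Local moves and colorings -/

section Colorings

variable {X : Type u} [Biquandle X]

/-- The coloring condition at a crossing, for a coloring of all labels. -/
def Crossing.Colored (g : ℕ → X) (c : Crossing) : Prop :=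
  match c.kind with
  | .virt => g c.ne = g c.sw ∧ g c.nw = g c.se
  | _ => g c.underRight = underBy (g c.underLeft) (g c.overLeft) ∧
      g c.overRight = overBy (g c.overLeft) (g c.underLeft)

/-- The coloring condition for a piece of a diagram, for a coloring of all labels. -/
def Code.Colored (g : ℕ → X) (T : Code) : Prop :=
  (∀ c ∈ T.crossings, c.Colored g) ∧ ∀ m ∈ T.marks, g m.1 = g m.2

theorem Crossing.colored_pos (g : ℕ → X) (a b c d : ℕ) :
    (⟨.pos, a, b, c, d⟩ : Crossing).Colored g ↔
      g b = underBy (g c) (g a) ∧ g d = overBy (g a) (g c) := Iff.rfl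

theorem Crossing.colored_neg (g : ℕ → X) (a b c d : ℕ) :
    (⟨.neg, a, b, c, d⟩ : Crossing).Colored g ↔
      g d = underBy (g a) (g c) ∧ g b = overBy (g c) (g a) := Iff.rfl

theorem Crossing.colored_virt (g : ℕ → X) (a b c d : ℕ) :
    (⟨.virt, a, b, c, d⟩ : Crossing).Colored g ↔ g d = g a ∧ g c = g b := Iff.rfl

theorem Crossing.colored_congr {g h : ℕ → X} (k : Kind) {a b c d a' b' c' d' : ℕ}
    (ha : g a = h a') (hb : g b = h b') (hc : g c = h c') (hd : g d = h d') :
    (⟨k, a, b, c, d⟩ : Crossing).Colored g ↔ (⟨k, a', b', c', d'⟩ : Crossing).Colored h := by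
  cases k <;> simp only [colored_pos, colored_neg, colored_virt, ha, hb, hc, hd]

theorem Code.colored_congr {g h : ℕ → X} {T : Code} (hin : ∀ e ∈ T.incoming, g e = h e)
    (hout : ∀ e ∈ T.outgoing, g e = h e) : T.Colored g ↔ T.Colored h := by
  simp only [Code.incoming, Code.outgoing, Multiset.mem_add, Multiset.mem_map] at hin hout
  refine and_congr (forall₂_congr fun c hc => Crossing.colored_congr c.kind ?_ ?_ ?_ ?_)
    (forall₂_congr fun m hm => ?_)
  · exact hin _ (Or.inl (Or.inl ⟨c, hc, rfl⟩))
  · exact hin _ (Or.inl (Or.inr ⟨c, hc, rfl⟩))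
  · exact hout _ (Or.inl (Or.inl ⟨c, hc, rfl⟩))
  · exact hout _ (Or.inl (Or.inr ⟨c, hc, rfl⟩))
  · rw [hin _ (Or.inr ⟨m, hm, rfl⟩), hout _ (Or.inr ⟨m, hm, rfl⟩)]

theorem Code.colored_join (g : ℕ → X) (S T : Code) :
    (S.join T).Colored g ↔ S.Colored g ∧ T.Colored g := by
  simp only [Colored, join, Multiset.mem_add, or_imp, forall_and]
  tauto

/-- A coloring of a kink is determined by the color of the edge entering it, which it shares with
the edge leaving it. -/
theorem exists_colored_kink_right (k : Kind) :
    ∃ φ : X → X, ∀ (g : ℕ → X) (a b m : ℕ),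
      (⟨k, a, m, b, m⟩ : Crossing).Colored g ↔ g a = g b ∧ g m = φ (g a) := by
  cases k with
  | pos =>
    refine ⟨fun x => underBy x x, fun g a b m => ?_⟩
    rw [Crossing.colored_pos]
    constructor
    · rintro ⟨h1, h2⟩
      have := underBy_eq_overBy_iff.1 (h1.symm.trans h2)
      exact ⟨this.symm, by rw [h1, this]⟩
    · rintro ⟨h1, h2⟩
      rw [← h1, h2]
      exact ⟨rfl, Biquandle.under_self _⟩
  | neg =>
    refine ⟨fun x => underBy x x, fun g a b m => ?_⟩
    rw [Crossing.colored_neg]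
    constructor
    · rintro ⟨h1, h2⟩
      have := underBy_eq_overBy_iff.1 (h1.symm.trans h2)
      exact ⟨this, by rw [h1, this]⟩
    · rintro ⟨h1, h2⟩
      rw [← h1, h2]
      exact ⟨rfl, Biquandle.under_self _⟩
  | virt =>
    refine ⟨id, fun g a b m => ?_⟩
    rw [Crossing.colored_virt, id]
    constructor
    · rintro ⟨h1, h2⟩
      exact ⟨(h2.trans h1).symm, h1⟩
    · rintro ⟨h1, h2⟩
      exact ⟨h2, by rw [h2, h1]⟩

theorem exists_colored_kink_left (k : Kind) :
    ∃ φ : X → X, ∀ (g : ℕ → X) (a b m : ℕ),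
      (⟨k, m, a, m, b⟩ : Crossing).Colored g ↔ g a = g b ∧ g m = φ (g a) := by
  let sq := Equiv.ofBijective _ (Biquandle.square_bijective (X := X))
  have hsq : ∀ m a : X, m = sq.symm a ↔ a = underBy m m := fun m a => by
    rw [Equiv.eq_symm_apply, eq_comm]; rfl
  cases k with
  | pos =>
    refine ⟨sq.symm, fun g a b m => ?_⟩
    rw [Crossing.colored_pos, hsq, ← Biquandle.under_self]
    constructor
    · rintro ⟨h1, h2⟩
      exact ⟨h1.trans h2.symm, h1⟩
    · rintro ⟨h1, h2⟩
      exact ⟨h2, by rw [← h1, h2]⟩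
  | neg =>
    refine ⟨sq.symm, fun g a b m => ?_⟩
    rw [Crossing.colored_neg, hsq, ← Biquandle.under_self]
    constructor
    · rintro ⟨h1, h2⟩
      exact ⟨h2.trans h1.symm, h2⟩
    · rintro ⟨h1, h2⟩
      exact ⟨by rw [← h1, h2], h2⟩
  | virt =>
    refine ⟨id, fun g a b m => ?_⟩
    rw [Crossing.colored_virt, id]
    constructor
    · rintro ⟨h1, h2⟩
      exact ⟨(h1.trans h2).symm, h2⟩
    · rintro ⟨h1, h2⟩
      exact ⟨by rw [← h1, h2], h2⟩

/-- A coloring of two successive crossings of parallel strands is determined by the colors of the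
entering edges. -/
theorem exists_colored_direct (k : Kind) :
    ∃ φ ψ : X → X → X, ∀ (g : ℕ → X) (a b c d e f : ℕ),
      (⟨k, a, b, c, d⟩ : Crossing).Colored g ∧ (⟨k.flip, c, d, e, f⟩ : Crossing).Colored g ↔
        (g a = g e ∧ g b = g f) ∧ g c = φ (g a) (g b) ∧ g d = ψ (g a) (g b) := by
  cases k with
  | pos =>
    let i := fun y : X => Equiv.ofBijective _ (under_bijective y)
    have hi : ∀ x y z : X, x = (i y).symm z ↔ z = underBy x y := fun x y z => by
      rw [Equiv.eq_symm_apply, eq_comm]; rfl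
    refine ⟨fun a b => (i a).symm b, fun a b => overBy a ((i a).symm b), fun g a b c d e f => ?_⟩
    simp only [Kind.flip, Crossing.colored_pos, Crossing.colored_neg]
    constructor
    · rintro ⟨⟨h1, h2⟩, h3, h4⟩
      have hae : g a = g e := (over_bijective (g c)).1 (h2.symm.trans h4)
      have hc := (hi _ _ _).2 h1
      exact ⟨⟨hae, by rw [h1, h3, hae]⟩, hc, by rw [← hc, h2]⟩
    · rintro ⟨⟨hae, hbf⟩, hc, hd⟩
      rw [← hc] at hd
      have hb := (hi _ _ _).1 hc
      exact ⟨⟨hb, hd⟩, by rw [← hbf, ← hae, hb], by rw [← hae, hd]⟩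
  | neg =>
    let i := fun y : X => Equiv.ofBijective _ (over_bijective y)
    have hi : ∀ x y z : X, x = (i y).symm z ↔ z = overBy x y := fun x y z => by
      rw [Equiv.eq_symm_apply, eq_comm]; rfl
    refine ⟨fun a b => (i a).symm b, fun a b => underBy a ((i a).symm b), fun g a b c d e f => ?_⟩
    simp only [Kind.flip, Crossing.colored_pos, Crossing.colored_neg]
    constructor
    · rintro ⟨⟨h1, h2⟩, h3, h4⟩
      have hae : g a = g e := (under_bijective (g c)).1 (h1.symm.trans h3)
      have hc := (hi _ _ _).2 h2
      exact ⟨⟨hae, by rw [h2, h4, hae]⟩, hc, by rw [← hc, h1]⟩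
    · rintro ⟨⟨hae, hbf⟩, hc, hd⟩
      rw [← hc] at hd
      have hb := (hi _ _ _).1 hc
      exact ⟨⟨hd, hb⟩, by rw [← hae, hd], by rw [← hbf, ← hae, hb]⟩
  | virt =>
    refine ⟨fun _ b => b, fun a _ => a, fun g a b c d e f => ?_⟩
    simp only [Kind.flip, Crossing.colored_virt]
    constructor
    · rintro ⟨⟨h1, h2⟩, h3, h4⟩
      exact ⟨⟨by rw [h4, h1], by rw [h3, h2]⟩, h2, h1⟩
    · rintro ⟨⟨hae, hbf⟩, hc, hd⟩
      exact ⟨⟨hd, hc⟩, by rw [← hbf, hc], by rw [← hae, hd]⟩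

/-- A coloring of two crossings of antiparallel strands with the bigon on the right is determined by
the colors of the entering edges. -/
theorem exists_colored_reverse_right (k : Kind) :
    ∃ φ ψ : X → X → X, ∀ (g : ℕ → X) (a b c d e f : ℕ),
      (⟨k, a, b, c, d⟩ : Crossing).Colored g ∧ (⟨k.flip, e, d, f, b⟩ : Crossing).Colored g ↔
        (g a = g f ∧ g e = g c) ∧ g b = φ (g a) (g e) ∧ g d = ψ (g a) (g e) := by
  cases k with
  | pos =>
    refine ⟨fun a c => underBy c a, fun a c => overBy a c, fun g a b c d e f => ?_⟩
    simp only [Kind.flip, Crossing.colored_pos, Crossing.colored_neg]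
    constructor
    · rintro ⟨⟨h1, h2⟩, h3, h4⟩
      have : (g c, g a) = (g e, g f) := Biquandle.sideways_bijective.1 <|
        Prod.ext (h2.symm.trans h4) (h1.symm.trans h3)
      obtain ⟨hce, haf⟩ := Prod.ext_iff.1 this
      dsimp only at hce haf
      exact ⟨⟨haf, hce.symm⟩, by rw [h1, hce], by rw [h2, hce]⟩
    · rintro ⟨⟨haf, hec⟩, hb, hd⟩
      rw [← haf, ← hec]
      exact ⟨⟨hb, hd⟩, hb, hd⟩
  | neg =>
    refine ⟨fun a c => overBy c a, fun a c => underBy a c, fun g a b c d e f => ?_⟩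
    simp only [Kind.flip, Crossing.colored_pos, Crossing.colored_neg]
    constructor
    · rintro ⟨⟨h1, h2⟩, h3, h4⟩
      have : (g a, g c) = (g f, g e) := Biquandle.sideways_bijective.1 <|
        Prod.ext (h2.symm.trans h4) (h1.symm.trans h3)
      obtain ⟨haf, hce⟩ := Prod.ext_iff.1 this
      dsimp only at hce haf
      exact ⟨⟨haf, hce.symm⟩, by rw [h2, hce], by rw [h1, hce]⟩
    · rintro ⟨⟨haf, hec⟩, hb, hd⟩
      rw [← haf, ← hec]
      exact ⟨⟨hd, hb⟩, hd, hb⟩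
  | virt =>
    refine ⟨fun _ c => c, fun a _ => a, fun g a b c d e f => ?_⟩
    simp only [Kind.flip, Crossing.colored_virt]
    constructor
    · rintro ⟨⟨h1, h2⟩, h3, h4⟩
      exact ⟨⟨by rw [h4, h1], by rw [← h3, h2]⟩, h3, h1⟩
    · rintro ⟨⟨haf, hec⟩, hb, hd⟩
      rw [← haf, ← hec]
      exact ⟨⟨hd, hb.symm⟩, hb, hd.symm⟩

/-- A coloring of two crossings of antiparallel strands with the bigon on the left is determined by
the colors of the entering edges. -/
theorem exists_colored_reverse_left (k : Kind) :
    ∃ φ ψ : X → X → X, ∀ (g : ℕ → X) (a b c d e f : ℕ),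
      (⟨k, a, b, c, d⟩ : Crossing).Colored g ∧ (⟨k.flip, c, e, a, f⟩ : Crossing).Colored g ↔
        (g b = g f ∧ g e = g d) ∧ g a = φ (g b) (g e) ∧ g c = ψ (g b) (g e) := by
  let S := Equiv.ofBijective _ (Biquandle.sideways_bijective (X := X))
  have hS : ∀ x y u v : X, (x = (S.symm (u, v)).1 ∧ y = (S.symm (u, v)).2) ↔
      v = underBy x y ∧ u = overBy y x := fun x y u v => by
    rw [← Prod.ext_iff (x := (x, y)), Equiv.eq_symm_apply]
    simp only [S, Equiv.ofBijective_apply, Prod.mk.injEq]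
    tauto
  cases k with
  | pos =>
    refine ⟨fun b d => (S.symm (d, b)).2, fun b d => (S.symm (d, b)).1, fun g a b c d e f => ?_⟩
    simp only [Kind.flip, Crossing.colored_pos, Crossing.colored_neg]
    rw [and_comm (a := g a = _), hS]
    constructor
    · rintro ⟨⟨h1, h2⟩, h3, h4⟩
      exact ⟨⟨h1.trans h3.symm, h4.trans h2.symm⟩, h1, h4⟩
    · rintro ⟨⟨hbf, hed⟩, h1, h2⟩
      rw [← hbf, ← hed]
      exact ⟨⟨h1, h2⟩, h1, h2⟩
  | neg =>
    refine ⟨fun b d => (S.symm (b, d)).1, fun b d => (S.symm (b, d)).2, fun g a b c d e f => ?_⟩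
    simp only [Kind.flip, Crossing.colored_pos, Crossing.colored_neg]
    rw [hS]
    constructor
    · rintro ⟨⟨h1, h2⟩, h3, h4⟩
      exact ⟨⟨h2.trans h4.symm, h3.trans h1.symm⟩, h3, h2⟩
    · rintro ⟨⟨hbf, hed⟩, h1, h2⟩
      rw [← hbf, ← hed]
      exact ⟨⟨h1, h2⟩, h1, h2⟩
  | virt =>
    refine ⟨fun _ d => d, fun b _ => b, fun g a b c d e f => ?_⟩
    simp only [Kind.flip, Crossing.colored_virt]
    constructor
    · rintro ⟨⟨h1, h2⟩, h3, h4⟩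
      exact ⟨⟨by rw [h3, h2], by rw [← h4, h1]⟩, h4, h2⟩
    · rintro ⟨⟨hbf, hed⟩, ha, hc⟩
      rw [← hbf, ← hed]
      exact ⟨⟨ha.symm, hc⟩, hc.symm, ha⟩

end Colorings

/-! ### Invariance under the local moves -/

section Replacement

variable {X : Type u} [Biquandle X] {R : Type v} [CommRing R]

/-- What makes the state sums of two diagrams agree if the piece `T` of one is replaced by the piece
`T'` in the other. The two pieces have the same edges entering and leaving; the other edges of the
pieces, `inner` and `inner'`, lie inside. Colorings that agree outside determine each other, and
their state sums agree for all systems of arcs `P` outside. -/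
structure Replacement (β : Biquandle.VirtualBracket X R) (T T' : Code) where
  inner : Multiset ℕ
  inner' : Multiset ℕ
  enter : Multiset ℕ
  leave : Multiset ℕ
  incoming_eq : T.incoming = enter + inner
  outgoing_eq : T.outgoing = leave + inner
  incoming_eq' : T'.incoming = enter + inner'
  outgoing_eq' : T'.outgoing = leave + inner'
  lift : ∀ g : ℕ → X, T.Colored g → ∃ g', T'.Colored g' ∧ ∀ e ∉ inner', g' e = g e
  lift' : ∀ g : ℕ → X, T'.Colored g → ∃ g', T.Colored g' ∧ ∀ e ∉ inner, g' e = g e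
  unique : ∀ g h : ℕ → X, T.Colored g → T.Colored h → (∀ e ∉ inner, g e = h e) → g = h
  unique' : ∀ g h : ℕ → X, T'.Colored g → T'.Colored h → (∀ e ∉ inner', g e = h e) → g = h
  evaluate_eq : ∀ g g' : ℕ → X, T.Colored g → T'.Colored g' →
    (∀ e ∉ inner, e ∉ inner' → g e = g' e) → ∀ P : Multiset (Sym2 ℕ),
    (∀ e ∈ inner, e ∉ vertices P) → (∀ e ∈ inner', e ∉ vertices P) →
    evaluate β.δ (AddMonoidAlgebra.single P 1 * T.skein β g) =
      evaluate β.δ (AddMonoidAlgebra.single P 1 * T'.skein β g')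

/-- A replacement in which the colors `Φ g` and `Φ' g` of the inner edges are given in terms of the
colors of the outer edges, which only have to satisfy a common condition `B`. -/
def Replacement.ofFormula {β : Biquandle.VirtualBracket X R} {T T' : Code}
    (inner inner' enter leave : Multiset ℕ)
    (incoming_eq : T.incoming = enter + inner) (outgoing_eq : T.outgoing = leave + inner)
    (incoming_eq' : T'.incoming = enter + inner') (outgoing_eq' : T'.outgoing = leave + inner')
    (B : (ℕ → X) → Prop) (Φ Φ' : (ℕ → X) → ℕ → X)
    (hB : ∀ g h, (∀ e ∉ inner, e ∉ inner' → g e = h e) → B g → B h)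
    (hΦ : ∀ g h, (∀ e ∉ inner, g e = h e) → Φ g = Φ h)
    (hΦ' : ∀ g h, (∀ e ∉ inner', g e = h e) → Φ' g = Φ' h)
    (hT : ∀ g, T.Colored g ↔ B g ∧ ∀ e ∈ inner, g e = Φ g e)
    (hT' : ∀ g, T'.Colored g ↔ B g ∧ ∀ e ∈ inner', g e = Φ' g e)
    (evaluate_eq : ∀ g g' : ℕ → X, T.Colored g → T'.Colored g' →
      (∀ e ∉ inner, e ∉ inner' → g e = g' e) → ∀ P : Multiset (Sym2 ℕ),
      (∀ e ∈ inner, e ∉ vertices P) → (∀ e ∈ inner', e ∉ vertices P) →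
      evaluate β.δ (AddMonoidAlgebra.single P 1 * T.skein β g) =
        evaluate β.δ (AddMonoidAlgebra.single P 1 * T'.skein β g')) :
    Replacement β T T' where
  inner := inner
  inner' := inner'
  enter := enter
  leave := leave
  incoming_eq := incoming_eq
  outgoing_eq := outgoing_eq
  incoming_eq' := incoming_eq'
  outgoing_eq' := outgoing_eq'
  lift g hg := by
    have h : ∀ e ∉ inner', (fun e => if e ∈ inner' then Φ' g e else g e) e = g e :=
      fun e he => if_neg he
    refine ⟨_, (hT' _).2 ⟨hB g _ (fun e _ he => (h e he).symm) ((hT g).1 hg).1, fun e he => ?_⟩, h⟩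
    rw [hΦ' _ g h, if_pos he]
  lift' g hg := by
    have h : ∀ e ∉ inner, (fun e => if e ∈ inner then Φ g e else g e) e = g e :=
      fun e he => if_neg he
    refine ⟨_, (hT _).2 ⟨hB g _ (fun e he _ => (h e he).symm) ((hT' g).1 hg).1, fun e he => ?_⟩, h⟩
    rw [hΦ _ g h, if_pos he]
  unique g h hg hh heq := by
    funext e
    by_cases he : e ∈ inner
    · rw [((hT g).1 hg).2 e he, ((hT h).1 hh).2 e he, hΦ g h heq]
    · exact heq e he
  unique' g h hg hh heq := by
    funext e
    by_cases he : e ∈ inner'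
    · rw [((hT' g).1 hg).2 e he, ((hT' h).1 hh).2 e he, hΦ' g h heq]
    · exact heq e he
  evaluate_eq := evaluate_eq

/-- A replacement of crossings by marked points. -/
def Replacement.ofMarks {β : Biquandle.VirtualBracket X R} {C : Multiset Crossing}
    {M : Multiset (ℕ × ℕ)} (inner : Multiset ℕ)
    (nodup_incoming : (⟨C, 0⟩ : Code).incoming.Nodup)
    (nodup_outgoing : (⟨C, 0⟩ : Code).outgoing.Nodup)
    (incoming_eq : (⟨C, 0⟩ : Code).incoming = M.map Prod.fst + inner)
    (outgoing_eq : (⟨C, 0⟩ : Code).outgoing = M.map Prod.snd + inner)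
    (Φ : (ℕ → X) → ℕ → X)
    (hΦ : ∀ g h, (∀ e ∉ inner, g e = h e) → Φ g = Φ h)
    (hT : ∀ g, (⟨C, 0⟩ : Code).Colored g ↔
      (∀ m ∈ M, g m.1 = g m.2) ∧ ∀ e ∈ inner, g e = Φ g e)
    (evaluate_eq : ∀ g : ℕ → X, (⟨C, 0⟩ : Code).Colored g → ∀ P : Multiset (Sym2 ℕ),
      (∀ e ∈ inner, e ∉ vertices P) →
      evaluate β.δ (AddMonoidAlgebra.single P 1 * (⟨C, 0⟩ : Code).skein β g) =
        β.δ ^ circles (P + M.map fun m => s(m.1, m.2))) :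
    Replacement β ⟨C, 0⟩ ⟨0, M⟩ := by
  rw [incoming_eq, Multiset.nodup_add] at nodup_incoming
  rw [outgoing_eq, Multiset.nodup_add] at nodup_outgoing
  have hfst : ∀ m ∈ M, m.1 ∉ inner := fun m hm he =>
    Multiset.disjoint_left.1 nodup_incoming.2.2 (Multiset.mem_map_of_mem _ hm) he
  have hsnd : ∀ m ∈ M, m.2 ∉ inner := fun m hm he =>
    Multiset.disjoint_left.1 nodup_outgoing.2.2 (Multiset.mem_map_of_mem _ hm) he
  refine .ofFormula inner 0 (M.map Prod.fst) (M.map Prod.snd) incoming_eq outgoing_eq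
    (by simp [Code.incoming]) (by simp [Code.outgoing]) (fun g => ∀ m ∈ M, g m.1 = g m.2)
    Φ (fun g => g) (fun g h hgh hg m hm => ?_) hΦ (fun g h hgh => funext fun e => hgh e (by simp))
    hT (fun g => by simp [Code.Colored]) (fun g g' hg _ _ P hP _ => ?_)
  · rw [← hgh _ (hfst m hm) (by simp), ← hgh _ (hsnd m hm) (by simp), hg m hm]
  · rw [evaluate_eq g hg P hP, evaluate_skein_marks]

/-- The replacement of a crossing that is a kink with loop `m` by a marked point. -/
def Replacement.kink (β : Biquandle.VirtualBracket X R) {c : Crossing} {a b m : ℕ}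
    (nodup_incoming : (⟨{c}, 0⟩ : Code).incoming.Nodup)
    (nodup_outgoing : (⟨{c}, 0⟩ : Code).outgoing.Nodup)
    (incoming_eq : (⟨{c}, 0⟩ : Code).incoming = {a} + {m})
    (outgoing_eq : (⟨{c}, 0⟩ : Code).outgoing = {b} + {m})
    (φ : X → X) (hc : ∀ g : ℕ → X, c.Colored g ↔ g a = g b ∧ g m = φ (g a))
    (hkink : ∀ g : ℕ → X, g a = g b → ∀ P, Separated ![a, b, m] [2] P →
      ∑ t, weight β c.kind (g c.underLeft) (g c.overLeft) t * β.δ ^ circles (P + c.arcs t) =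
        β.δ ^ circles (P + arcs ![a, b, m] [(0, 1)])) :
    Replacement β ⟨{c}, 0⟩ ⟨0, {(a, b)}⟩ := by
  have ham : a ≠ m := by rw [incoming_eq] at nodup_incoming; simpa using nodup_incoming
  have hbm : b ≠ m := by rw [outgoing_eq] at nodup_outgoing; simpa using nodup_outgoing
  refine .ofMarks {m} nodup_incoming nodup_outgoing incoming_eq outgoing_eq
    (fun g _ => φ (g a)) (fun g h hgh => ?_) (fun g => ?_) (fun g hg P hP => ?_)
  · rw [hgh a (by simpa using ham)]
  · simp [Code.Colored, hc]
  · rw [evaluate_skein_one, hkink g]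
    · rfl
    · exact ((hc g).1 (hg.1 c (by simp))).1
    · refine ⟨?_, by simpa using hP⟩
      simp [Fin.forall_fin_succ, ham, hbm]

/-- The replacement of two crossings by two marked points; `c` and `d` are the inner edges. -/
def Replacement.bigon (β : Biquandle.VirtualBracket X R) {x y : Crossing} {p₀ p₁ q₀ q₁ c d : ℕ}
    (nodup_incoming : (⟨{x, y}, 0⟩ : Code).incoming.Nodup)
    (nodup_outgoing : (⟨{x, y}, 0⟩ : Code).outgoing.Nodup)
    (incoming_eq : (⟨{x, y}, 0⟩ : Code).incoming = {p₀, p₁} + {c, d})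
    (outgoing_eq : (⟨{x, y}, 0⟩ : Code).outgoing = {q₀, q₁} + {c, d})
    (φ ψ : X → X → X) (hxy : ∀ g : ℕ → X, x.Colored g ∧ y.Colored g ↔
      (g p₀ = g q₀ ∧ g p₁ = g q₁) ∧ g c = φ (g p₀) (g p₁) ∧ g d = ψ (g p₀) (g p₁))
    (hbigon : ∀ g : ℕ → X, g p₀ = g q₀ → g p₁ = g q₁ → ∀ P,
      Separated ![p₀, p₁, q₀, q₁, c, d] [4, 5] P →
      ∑ s, weight β x.kind (g x.underLeft) (g x.overLeft) s *
        ∑ t, weight β y.kind (g y.underLeft) (g y.overLeft) t *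
          β.δ ^ circles (P + x.arcs s + y.arcs t) =
        β.δ ^ circles (P + arcs ![p₀, p₁, q₀, q₁, c, d] [(0, 2), (1, 3)])) :
    Replacement β ⟨{x, y}, 0⟩ ⟨0, {(p₀, q₀), (p₁, q₁)}⟩ := by
  have hin := nodup_incoming
  have hout := nodup_outgoing
  rw [incoming_eq] at hin
  rw [outgoing_eq] at hout
  simp only [Multiset.insert_eq_cons, Multiset.cons_add, Multiset.singleton_add,
    Multiset.nodup_cons, Multiset.mem_cons, Multiset.mem_singleton, Multiset.nodup_singleton,
    not_or, and_true] at hin hout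
  obtain ⟨⟨-, hp₀c, hp₀d⟩, ⟨hp₁c, hp₁d⟩, hcd⟩ := hin
  obtain ⟨⟨-, hq₀c, hq₀d⟩, ⟨hq₁c, hq₁d⟩, -⟩ := hout
  refine .ofMarks {c, d} nodup_incoming nodup_outgoing incoming_eq outgoing_eq
    (fun g e => if e = c then φ (g p₀) (g p₁) else ψ (g p₀) (g p₁)) (fun g h hgh => ?_)
    (fun g => ?_) (fun g hg P hP => ?_)
  · rw [hgh p₀ (by simp [hp₀c, hp₀d]), hgh p₁ (by simp [hp₁c, hp₁d])]
  · simpa [Code.Colored, Ne.symm hcd] using hxy g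
  · have := (hxy g).1 ⟨hg.1 x (by simp), hg.1 y (by simp)⟩
    rw [Multiset.insert_eq_cons, evaluate_skein_cons]
    simp only [evaluate_skein_one]
    rw [hbigon g this.1.1 this.1.2]
    · rfl
    · refine ⟨?_, by simpa using hP⟩
      simp [Fin.forall_fin_succ, hp₀c, hp₀d, hp₁c, hp₁d, hq₀c, hq₀d, hq₁c, hq₁d, hcd, Ne.symm hcd]

end Replacement

section LocalMoves

variable {X : Type u} [Biquandle X] {R : Type v} [CommRing R] (β : Biquandle.VirtualBracket X R)

theorem pair_eq_add (a b : ℕ) : ({a, b} : Multiset ℕ) = {a} + {b} := rfl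

theorem triple_eq_add (a b c : ℕ) : ({a, b, c} : Multiset ℕ) = {a} + {b} + {c} := rfl

theorem incoming_pair (x y : Crossing) :
    (⟨{x, y}, 0⟩ : Code).incoming = {x.sw} + {y.sw} + ({x.se} + {y.se}) := rfl

theorem outgoing_pair (x y : Crossing) :
    (⟨{x, y}, 0⟩ : Code).outgoing = {x.nw} + {y.nw} + ({x.ne} + {y.ne}) := rfl

theorem incoming_triple (x y z : Crossing) :
    (⟨{x, y, z}, 0⟩ : Code).incoming = {x.sw} + {y.sw} + {z.sw} + ({x.se} + {y.se} + {z.se}) := rfl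

theorem outgoing_triple (x y z : Crossing) :
    (⟨{x, y, z}, 0⟩ : Code).outgoing = {x.nw} + {y.nw} + {z.nw} + ({x.ne} + {y.ne} + {z.ne}) := rfl

theorem nonempty_replacement_kink_right (k : Kind) (a b m : ℕ)
    (hin : (⟨{⟨k, a, m, b, m⟩}, 0⟩ : Code).incoming.Nodup)
    (hout : (⟨{⟨k, a, m, b, m⟩}, 0⟩ : Code).outgoing.Nodup) :
    Nonempty (Replacement β ⟨{⟨k, a, m, b, m⟩}, 0⟩ ⟨0, {(a, b)}⟩) := by
  obtain ⟨φ, hφ⟩ := exists_colored_kink_right (X := X) k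
  refine ⟨.kink β hin hout rfl rfl φ (fun g => hφ g a b m) fun g hab P hl => ?_⟩
  have harcs : ∀ t, (⟨k, a, m, b, m⟩ : Crossing).arcs t = arcs ![a, b, m] (resolve t 0 2 1 2) :=
    Crossing.arcs_mk ![a, b, m] k 0 2 1 2
  simp only [harcs]
  refine kink_right_identity β.δ hl ?_
  cases k with
  | pos => simpa only [Crossing.underLeft, Crossing.overLeft, hab] using weight_kink β .pos (g b)
  | neg => simpa only [Crossing.underLeft, Crossing.overLeft, hab] using weight_kink β .neg (g b)
  | virt => exact weight_kink β .virt (g b)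

theorem nonempty_replacement_kink_left (k : Kind) (a b m : ℕ)
    (hin : (⟨{⟨k, m, a, m, b⟩}, 0⟩ : Code).incoming.Nodup)
    (hout : (⟨{⟨k, m, a, m, b⟩}, 0⟩ : Code).outgoing.Nodup) :
    Nonempty (Replacement β ⟨{⟨k, m, a, m, b⟩}, 0⟩ ⟨0, {(a, b)}⟩) := by
  obtain ⟨φ, hφ⟩ := exists_colored_kink_left (X := X) k
  refine ⟨.kink β hin hout (add_comm ({m} : Multiset ℕ) {a}) (add_comm ({m} : Multiset ℕ) {b}) φ
    (fun g => hφ g a b m) fun g hab P hl => ?_⟩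
  have harcs : ∀ t, (⟨k, m, a, m, b⟩ : Crossing).arcs t = arcs ![a, b, m] (resolve t 2 0 2 1) :=
    Crossing.arcs_mk ![a, b, m] k 2 0 2 1
  simp only [harcs]
  refine kink_left_identity β.δ hl ?_
  cases k with
  | pos => exact weight_kink β .pos (g m)
  | neg => exact weight_kink β .neg (g m)
  | virt => exact weight_kink β .virt (g m)

theorem nonempty_replacement_direct (k : Kind) (a b c d e f : ℕ)
    (hin : (⟨{⟨k, a, b, c, d⟩, ⟨k.flip, c, d, e, f⟩}, 0⟩ : Code).incoming.Nodup)
    (hout : (⟨{⟨k, a, b, c, d⟩, ⟨k.flip, c, d, e, f⟩}, 0⟩ : Code).outgoing.Nodup) :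
    Nonempty (Replacement β ⟨{⟨k, a, b, c, d⟩, ⟨k.flip, c, d, e, f⟩}, 0⟩
      ⟨0, {(a, e), (b, f)}⟩) := by
  obtain ⟨φ, ψ, hφ⟩ := exists_colored_direct (X := X) k
  refine ⟨.bigon β (c := c) (d := d) hin hout ?_ ?_ φ ψ (fun g => hφ g a b c d e f)
    fun g hae hbf P hl => ?_⟩
  · rw [incoming_pair]
    simp only [pair_eq_add]
    abel
  · rw [outgoing_pair]
    simp only [pair_eq_add]
    abel
  have harcs : ∀ t, (⟨k, a, b, c, d⟩ : Crossing).arcs t =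
      arcs ![a, b, e, f, c, d] (resolve t 0 1 4 5) := Crossing.arcs_mk ![a, b, e, f, c, d] k 0 1 4 5
  have harcs' : ∀ t, (⟨k.flip, c, d, e, f⟩ : Crossing).arcs t =
      arcs ![a, b, e, f, c, d] (resolve t 4 5 2 3) :=
    Crossing.arcs_mk ![a, b, e, f, c, d] k.flip 4 5 2 3
  simp only [harcs, harcs', add_assoc, ← arcs_append]
  refine direct_identity hl ?_
  cases k with
  | pos =>
    simpa only [Crossing.underLeft, Crossing.overLeft, Kind.flip, hae] using
      weight_bigon β .pos (g c) (g e)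
  | neg =>
    simpa only [Crossing.underLeft, Crossing.overLeft, Kind.flip, hae] using
      weight_bigon β .neg (g e) (g c)
  | virt => exact weight_bigon β .virt (g c) (g c)

theorem nonempty_replacement_reverse_right (k : Kind) (a b c d e f : ℕ)
    (hin : (⟨{⟨k, a, b, c, d⟩, ⟨k.flip, e, d, f, b⟩}, 0⟩ : Code).incoming.Nodup)
    (hout : (⟨{⟨k, a, b, c, d⟩, ⟨k.flip, e, d, f, b⟩}, 0⟩ : Code).outgoing.Nodup) :
    Nonempty (Replacement β ⟨{⟨k, a, b, c, d⟩, ⟨k.flip, e, d, f, b⟩}, 0⟩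
      ⟨0, {(a, f), (e, c)}⟩) := by
  obtain ⟨φ, ψ, hφ⟩ := exists_colored_reverse_right (X := X) k
  refine ⟨.bigon β (c := b) (d := d) hin hout ?_ ?_ φ ψ (fun g => hφ g a b c d e f)
    fun g haf hec P hl => ?_⟩
  · rfl
  · rw [outgoing_pair]
    simp only [pair_eq_add]
    abel
  have harcs : ∀ t, (⟨k, a, b, c, d⟩ : Crossing).arcs t =
      arcs ![a, e, f, c, b, d] (resolve t 0 4 3 5) := Crossing.arcs_mk ![a, e, f, c, b, d] k 0 4 3 5
  have harcs' : ∀ t, (⟨k.flip, e, d, f, b⟩ : Crossing).arcs t =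
      arcs ![a, e, f, c, b, d] (resolve t 1 5 2 4) :=
    Crossing.arcs_mk ![a, e, f, c, b, d] k.flip 1 5 2 4
  simp only [harcs, harcs', add_assoc, ← arcs_append]
  refine reverse_right_identity hl ?_
  cases k with
  | pos =>
    simpa only [Crossing.underLeft, Crossing.overLeft, Kind.flip, haf, hec] using
      weight_bigon β .pos (g c) (g f)
  | neg =>
    simpa only [Crossing.underLeft, Crossing.overLeft, Kind.flip, haf, hec] using
      weight_bigon β .neg (g f) (g c)
  | virt => exact weight_bigon β .virt (g c) (g c)

theorem nonempty_replacement_reverse_left (k : Kind) (a b c d e f : ℕ)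
    (hin : (⟨{⟨k, a, b, c, d⟩, ⟨k.flip, c, e, a, f⟩}, 0⟩ : Code).incoming.Nodup)
    (hout : (⟨{⟨k, a, b, c, d⟩, ⟨k.flip, c, e, a, f⟩}, 0⟩ : Code).outgoing.Nodup) :
    Nonempty (Replacement β ⟨{⟨k, a, b, c, d⟩, ⟨k.flip, c, e, a, f⟩}, 0⟩
      ⟨0, {(b, f), (e, d)}⟩) := by
  obtain ⟨φ, ψ, hφ⟩ := exists_colored_reverse_left (X := X) k
  refine ⟨.bigon β (c := a) (d := c) hin hout ?_ ?_ φ ψ (fun g => hφ g a b c d e f)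
    fun g hbf hed P hl => ?_⟩
  · rw [incoming_pair]
    simp only [pair_eq_add]
    abel
  · rw [outgoing_pair]
    simp only [pair_eq_add]
    abel
  have harcs : ∀ t, (⟨k, a, b, c, d⟩ : Crossing).arcs t =
      arcs ![b, e, f, d, a, c] (resolve t 4 0 5 3) := Crossing.arcs_mk ![b, e, f, d, a, c] k 4 0 5 3
  have harcs' : ∀ t, (⟨k.flip, c, e, a, f⟩ : Crossing).arcs t =
      arcs ![b, e, f, d, a, c] (resolve t 5 1 4 2) :=
    Crossing.arcs_mk ![b, e, f, d, a, c] k.flip 5 1 4 2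
  simp only [harcs, harcs', add_assoc, ← arcs_append]
  refine reverse_left_identity hl ?_
  cases k with
  | pos => exact weight_bigon β .pos (g c) (g a)
  | neg => exact weight_bigon β .neg (g a) (g c)
  | virt => exact weight_bigon β .virt (g c) (g c)

/-- The state sums of the two sides of a triangle move agree if the weights of the crossings
satisfy the triangle relations. -/
theorem evaluate_triangle (g g' : ℕ → X) (k₁ k₂ k₃ : Kind) {a₁ a₂ a₃ b₁ b₂ b₃ p q r : ℕ}
    {P : Multiset (Sym2 ℕ)} (hl : Separated ![a₁, a₂, a₃, b₁, b₂, b₃, p, q, r] [6, 7, 8] P)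
    {c₁ c₂ c₃ d₁ d₂ d₃ : Crossing}
    (hc₁ : c₁ = ⟨k₁, a₁, a₂, p, q⟩) (hc₂ : c₂ = ⟨k₂, q, a₃, r, b₃⟩) (hc₃ : c₃ = ⟨k₃, p, r, b₁, b₂⟩)
    (hd₁ : d₁ = ⟨k₃, a₂, a₃, p, q⟩) (hd₂ : d₂ = ⟨k₂, a₁, p, b₁, r⟩) (hd₃ : d₃ = ⟨k₁, r, q, b₂, b₃⟩)
    (h : TriangleRelations β.δ
      (weight β k₃ (g c₃.underLeft) (g c₃.overLeft)) (weight β k₂ (g c₂.underLeft) (g c₂.overLeft))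
      (weight β k₁ (g c₁.underLeft) (g c₁.overLeft)) (weight β k₁ (g' d₃.underLeft) (g' d₃.overLeft))
      (weight β k₂ (g' d₂.underLeft) (g' d₂.overLeft))
      (weight β k₃ (g' d₁.underLeft) (g' d₁.overLeft))) :
    evaluate β.δ (AddMonoidAlgebra.single P 1 * (⟨{c₁, c₂, c₃}, 0⟩ : Code).skein β g) =
      evaluate β.δ (AddMonoidAlgebra.single P 1 * (⟨{d₁, d₂, d₃}, 0⟩ : Code).skein β g') := by
  simp only [Multiset.insert_eq_cons, evaluate_skein_cons, evaluate_skein_one]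
  let l := ![a₁, a₂, a₃, b₁, b₂, b₃, p, q, r]
  have h₁ : ∀ t, c₁.arcs t = arcs l (resolve t 0 1 6 7) := hc₁ ▸ Crossing.arcs_mk l k₁ 0 1 6 7
  have h₂ : ∀ t, c₂.arcs t = arcs l (resolve t 7 2 8 5) := hc₂ ▸ Crossing.arcs_mk l k₂ 7 2 8 5
  have h₃ : ∀ t, c₃.arcs t = arcs l (resolve t 6 8 3 4) := hc₃ ▸ Crossing.arcs_mk l k₃ 6 8 3 4
  have h₁' : ∀ t, d₁.arcs t = arcs l (resolve t 1 2 6 7) := hd₁ ▸ Crossing.arcs_mk l k₃ 1 2 6 7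
  have h₂' : ∀ t, d₂.arcs t = arcs l (resolve t 0 6 3 8) := hd₂ ▸ Crossing.arcs_mk l k₂ 0 6 3 8
  have h₃' : ∀ t, d₃.arcs t = arcs l (resolve t 8 7 4 5) := hd₃ ▸ Crossing.arcs_mk l k₁ 8 7 4 5
  simp only [h₁, h₂, h₃, h₁', h₂', h₃', add_assoc, ← arcs_append]
  have := triangle_identity hl h
  simp only [List.append_assoc] at this
  subst hc₁ hc₂ hc₃ hd₁ hd₂ hd₃
  exact this

/-- The edges inside a triangle are separated from all others. -/
theorem separated_triangle {a₁ a₂ a₃ b₁ b₂ b₃ p q r : ℕ} {P : Multiset (Sym2 ℕ)}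
    (hin : ({a₁, a₂, a₃} + {p, q, r} : Multiset ℕ).Nodup)
    (hout : ({b₁, b₂, b₃} + {p, q, r} : Multiset ℕ).Nodup)
    (hP : ∀ e ∈ ({p, q, r} : Multiset ℕ), e ∉ vertices P) :
    Separated ![a₁, a₂, a₃, b₁, b₂, b₃, p, q, r] [6, 7, 8] P := by
  simp only [Multiset.insert_eq_cons, Multiset.cons_add, Multiset.singleton_add,
    Multiset.nodup_cons, Multiset.mem_cons, Multiset.mem_singleton, Multiset.nodup_singleton,
    not_or, and_true] at hin hout
  refine ⟨?_, by simpa using hP⟩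
  obtain ⟨⟨-, -, h1⟩, ⟨-, h2⟩, h3, ⟨h4, h4'⟩, h5⟩ := hin
  obtain ⟨⟨-, -, h1'⟩, ⟨-, h2'⟩, h3', -⟩ := hout
  simp [Fin.forall_fin_succ, h1, h2, h3, h4, h4', h5, h1', h2', h3', Ne.symm h4, Ne.symm h4',
    Ne.symm h5]

/-- Move III. By the exchange laws the two triangles impose the same condition on the colors of the
boundary edges. -/
theorem nonempty_replacement_triangle (a₁ a₂ a₃ b₁ b₂ b₃ p q r : ℕ)
    (hin : (⟨{⟨.pos, a₁, a₂, p, q⟩, ⟨.pos, q, a₃, r, b₃⟩, ⟨.pos, p, r, b₁, b₂⟩}, 0⟩ :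
      Code).incoming.Nodup)
    (hout : (⟨{⟨.pos, a₁, a₂, p, q⟩, ⟨.pos, q, a₃, r, b₃⟩, ⟨.pos, p, r, b₁, b₂⟩}, 0⟩ :
      Code).outgoing.Nodup) :
    Nonempty (Replacement β
      ⟨{⟨.pos, a₁, a₂, p, q⟩, ⟨.pos, q, a₃, r, b₃⟩, ⟨.pos, p, r, b₁, b₂⟩}, 0⟩
      ⟨{⟨.pos, a₂, a₃, p, q⟩, ⟨.pos, a₁, p, b₁, r⟩, ⟨.pos, r, q, b₂, b₃⟩}, 0⟩) := by
  have heq : (⟨{⟨.pos, a₁, a₂, p, q⟩, ⟨.pos, q, a₃, r, b₃⟩, ⟨.pos, p, r, b₁, b₂⟩}, 0⟩ :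
      Code).incoming = {a₁, a₂, a₃} + {p, q, r} := by
    rw [incoming_triple]; simp only [triple_eq_add]; abel
  have heq' : (⟨{⟨.pos, a₁, a₂, p, q⟩, ⟨.pos, q, a₃, r, b₃⟩, ⟨.pos, p, r, b₁, b₂⟩}, 0⟩ :
      Code).outgoing = {b₁, b₂, b₃} + {p, q, r} := by
    rw [outgoing_triple]; simp only [triple_eq_add]; abel
  rw [heq] at hin
  rw [heq'] at hout
  have hsep := fun P => separated_triangle (P := P) hin hout
  simp only [Multiset.insert_eq_cons, Multiset.cons_add, Multiset.singleton_add,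
    Multiset.nodup_cons, Multiset.mem_cons, Multiset.mem_singleton, Multiset.nodup_singleton,
    not_or, and_true] at hin hout
  -- The color of `p` on the left-hand side is the `y` with `underBy y z = a`, where `z`, `a` are
  -- the colors of `a₁`, `a₂`.
  let i := fun z : X => Equiv.ofBijective _ (under_bijective z)
  have hi : ∀ y z a : X, y = (i z).symm a ↔ a = underBy y z := fun x y z => by
    rw [Equiv.eq_symm_apply, eq_comm]; rfl
  have hT : ∀ g : ℕ → X, (⟨{⟨.pos, a₁, a₂, p, q⟩, ⟨.pos, q, a₃, r, b₃⟩, ⟨.pos, p, r, b₁, b₂⟩}, 0⟩ :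
      Code).Colored g ↔ (g a₂ = underBy (g p) (g a₁) ∧ g q = overBy (g a₁) (g p)) ∧
      (g a₃ = underBy (g r) (g q) ∧ g b₃ = overBy (g q) (g r)) ∧
      (g r = underBy (g b₁) (g p) ∧ g b₂ = overBy (g p) (g b₁)) := fun g => by
    simp [Code.Colored, Crossing.colored_pos]
  have hT' : ∀ g : ℕ → X, (⟨{⟨.pos, a₂, a₃, p, q⟩, ⟨.pos, a₁, p, b₁, r⟩, ⟨.pos, r, q, b₂, b₃⟩}, 0⟩ :
      Code).Colored g ↔ (g a₃ = underBy (g p) (g a₂) ∧ g q = overBy (g a₂) (g p)) ∧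
      (g p = underBy (g b₁) (g a₁) ∧ g r = overBy (g a₁) (g b₁)) ∧
      (g q = underBy (g b₂) (g r) ∧ g b₃ = overBy (g r) (g b₂)) := fun g => by
    simp [Code.Colored, Crossing.colored_pos]
  refine ⟨.ofFormula {p, q, r} {p, q, r} {a₁, a₂, a₃} {b₁, b₂, b₃} heq heq'
    (by rw [incoming_triple]; simp only [triple_eq_add]; abel)
    (by rw [outgoing_triple]; simp only [triple_eq_add]; abel)
    (fun g => ∀ y, g a₂ = underBy y (g a₁) →
      g b₂ = overBy y (g b₁) ∧
      g a₃ = underBy (underBy (g b₁) y) (overBy (g a₁) y) ∧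
      g b₃ = overBy (overBy (g a₁) y) (underBy (g b₁) y))
    (fun g e =>
      if e = p then (i (g a₁)).symm (g a₂)
      else if e = q then overBy (g a₁) ((i (g a₁)).symm (g a₂))
      else underBy (g b₁) ((i (g a₁)).symm (g a₂)))
    (fun g e =>
      if e = p then underBy (g b₁) (g a₁)
      else if e = q then underBy (g b₂) (overBy (g a₁) (g b₁))
      else overBy (g a₁) (g b₁))
    (fun g h hgh => ?_) (fun g h hgh => ?_) (fun g h hgh => ?_) (fun g => ?_) (fun g => ?_)
    (fun g g' hg hg' hgg P hP _ => ?_)⟩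
  · simp only [hgh a₁ (by simp; tauto) (by simp; tauto), hgh a₂ (by simp; tauto) (by simp; tauto),
      hgh a₃ (by simp; tauto) (by simp; tauto), hgh b₁ (by simp; tauto) (by simp; tauto),
      hgh b₂ (by simp; tauto) (by simp; tauto), hgh b₃ (by simp; tauto) (by simp; tauto), imp_self]
  · simp only [hgh a₁ (by simp; tauto), hgh a₂ (by simp; tauto), hgh b₁ (by simp; tauto)]
  · simp only [hgh a₁ (by simp; tauto), hgh b₂ (by simp; tauto), hgh b₁ (by simp; tauto)]
  · rw [hT]
    have hqp : q ≠ p := by tauto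
    have hrp : r ≠ p := by tauto
    have hrq : r ≠ q := by tauto
    simp only [Multiset.insert_eq_cons, Multiset.mem_cons, Multiset.mem_singleton, forall_eq_or_imp,
      forall_eq, if_true, if_neg hqp, if_neg hrp, if_neg hrq]
    constructor
    · rintro ⟨⟨h1, h2⟩, ⟨h3, h4⟩, h5, h6⟩
      have hp := (hi _ _ _).2 h1
      rw [← hp]
      refine ⟨fun y hy => ?_, rfl, h2, h5⟩
      obtain rfl : g p = y := (under_bijective (g a₁)).1 (h1.symm.trans hy)
      rw [← h2, ← h5]
      exact ⟨h6, h3, h4⟩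
    · rintro ⟨hB, hp, hq, hr⟩
      rw [← hp] at hq hr
      have h1 := (hi _ _ _).1 hp
      obtain ⟨h2, h3, h4⟩ := hB _ h1
      rw [← hq, ← hr] at h3 h4
      exact ⟨⟨h1, hq⟩, ⟨h3, h4⟩, hr, h2⟩
  · rw [hT']
    have hqp : q ≠ p := by tauto
    have hrp : r ≠ p := by tauto
    have hrq : r ≠ q := by tauto
    simp only [Multiset.insert_eq_cons, Multiset.mem_cons, Multiset.mem_singleton, forall_eq_or_imp,
      forall_eq, if_true, if_neg hqp, if_neg hrp, if_neg hrq]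
    constructor
    · rintro ⟨⟨h1, h2⟩, ⟨h3, h4⟩, h5, h6⟩
      refine ⟨fun y hy => ?_, h3, by rw [h5, h4], h4⟩
      have hb₂ : g b₂ = overBy y (g b₁) := (under_bijective (g r)).1 <| by
        dsimp only
        rw [← h5, h2, h4, h3, hy, Biquandle.under_over]
      refine ⟨hb₂, ?_, ?_⟩
      · rw [h1, h3, hy, Biquandle.under_under]
      · rw [h6, h4, hb₂, Biquandle.over_over]
    · rintro ⟨hB, hp, hq, hr⟩
      obtain ⟨h2, h3, h4⟩ := hB _ ((hi _ _ _).1 rfl)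
      have hy := (hi _ _ _).1 (rfl : (i (g a₁)).symm (g a₂) = _)
      generalize (i (g a₁)).symm (g a₂) = y at *
      rw [← hr] at hq
      refine ⟨⟨?_, ?_⟩, ⟨hp, hr⟩, hq, ?_⟩
      · rw [h3, hp, hy, Biquandle.under_under]
      · rw [hq, hr, hp, h2, hy, Biquandle.under_over]
      · rw [h4, hr, h2, Biquandle.over_over]
  · refine evaluate_triangle β g g' .pos .pos .pos (hsep P hP) rfl rfl rfl rfl rfl rfl ?_
    obtain ⟨⟨h1, h2⟩, ⟨h3, h4⟩, h5, h6⟩ := (hT g).1 hg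
    obtain ⟨⟨h1', h2'⟩, ⟨h3', h4'⟩, h5', h6'⟩ := (hT' g').1 hg'
    have ha₁ := hgg a₁ (by simp; tauto) (by simp; tauto)
    have ha₂ := hgg a₂ (by simp; tauto) (by simp; tauto)
    have hb₁ := hgg b₁ (by simp; tauto) (by simp; tauto)
    have hb₂ := hgg b₂ (by simp; tauto) (by simp; tauto)
    simp only [Crossing.underLeft, Crossing.overLeft]
    rw [h5, h2, h3', h4', ← ha₁, ← ha₂, ← hb₁, ← hb₂, h1, h6]
    exact weight_triangle β (g b₁) (g p) (g a₁)

theorem nonempty_replacement_virtual_triangle (k : Kind) (a₁ a₂ a₃ b₁ b₂ b₃ p q r : ℕ)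
    (hin : (⟨{⟨.virt, a₁, a₂, p, q⟩, ⟨.virt, q, a₃, r, b₃⟩, ⟨k, p, r, b₁, b₂⟩}, 0⟩ :
      Code).incoming.Nodup)
    (hout : (⟨{⟨.virt, a₁, a₂, p, q⟩, ⟨.virt, q, a₃, r, b₃⟩, ⟨k, p, r, b₁, b₂⟩}, 0⟩ :
      Code).outgoing.Nodup) :
    Nonempty (Replacement β
      ⟨{⟨.virt, a₁, a₂, p, q⟩, ⟨.virt, q, a₃, r, b₃⟩, ⟨k, p, r, b₁, b₂⟩}, 0⟩
      ⟨{⟨k, a₂, a₃, p, q⟩, ⟨.virt, a₁, p, b₁, r⟩, ⟨.virt, r, q, b₂, b₃⟩}, 0⟩) := by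
  have heq : (⟨{⟨.virt, a₁, a₂, p, q⟩, ⟨.virt, q, a₃, r, b₃⟩, ⟨k, p, r, b₁, b₂⟩}, 0⟩ :
      Code).incoming = {a₁, a₂, a₃} + {p, q, r} := by
    rw [incoming_triple]; simp only [triple_eq_add]; abel
  have heq' : (⟨{⟨.virt, a₁, a₂, p, q⟩, ⟨.virt, q, a₃, r, b₃⟩, ⟨k, p, r, b₁, b₂⟩}, 0⟩ :
      Code).outgoing = {b₁, b₂, b₃} + {p, q, r} := by
    rw [outgoing_triple]; simp only [triple_eq_add]; abel
  rw [heq] at hin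
  rw [heq'] at hout
  have hsep := fun P => separated_triangle (P := P) hin hout
  simp only [Multiset.insert_eq_cons, Multiset.cons_add, Multiset.singleton_add,
    Multiset.nodup_cons, Multiset.mem_cons, Multiset.mem_singleton, Multiset.nodup_singleton,
    not_or, and_true] at hin hout
  have hT : ∀ g : ℕ → X, (⟨{⟨.virt, a₁, a₂, p, q⟩, ⟨.virt, q, a₃, r, b₃⟩, ⟨k, p, r, b₁, b₂⟩}, 0⟩ :
      Code).Colored g ↔ (g q = g a₁ ∧ g p = g a₂) ∧ (g b₃ = g q ∧ g r = g a₃) ∧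
      (⟨k, p, r, b₁, b₂⟩ : Crossing).Colored g := fun g => by
    simp [Code.Colored, Crossing.colored_virt]
  have hT' : ∀ g : ℕ → X, (⟨{⟨k, a₂, a₃, p, q⟩, ⟨.virt, a₁, p, b₁, r⟩, ⟨.virt, r, q, b₂, b₃⟩}, 0⟩ :
      Code).Colored g ↔ (⟨k, a₂, a₃, p, q⟩ : Crossing).Colored g ∧
      (g r = g a₁ ∧ g b₁ = g p) ∧ (g b₃ = g r ∧ g b₂ = g q) := fun g => by
    simp [Code.Colored, Crossing.colored_virt]
  refine ⟨.ofFormula {p, q, r} {p, q, r} {a₁, a₂, a₃} {b₁, b₂, b₃} heq heq'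
    (by rw [incoming_triple]; simp only [triple_eq_add]; abel)
    (by rw [outgoing_triple]; simp only [triple_eq_add]; abel)
    (fun g => g b₃ = g a₁ ∧ (⟨k, a₂, a₃, b₁, b₂⟩ : Crossing).Colored g)
    (fun g e => if e = p then g a₂ else if e = q then g a₁ else g a₃)
    (fun g e => if e = p then g b₁ else if e = q then g b₂ else g a₁)
    (fun g h hgh => ?_) (fun g h hgh => ?_) (fun g h hgh => ?_) (fun g => ?_) (fun g => ?_)
    (fun g g' hg hg' hgg P hP _ => ?_)⟩
  · rw [Crossing.colored_congr k (hgh a₂ (by simp; tauto) (by simp; tauto))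
      (hgh a₃ (by simp; tauto) (by simp; tauto)) (hgh b₁ (by simp; tauto) (by simp; tauto))
      (hgh b₂ (by simp; tauto) (by simp; tauto)), hgh a₁ (by simp; tauto) (by simp; tauto),
      hgh b₃ (by simp; tauto) (by simp; tauto)]
    exact id
  · simp only [hgh a₁ (by simp; tauto), hgh a₂ (by simp; tauto), hgh a₃ (by simp; tauto)]
  · simp only [hgh a₁ (by simp; tauto), hgh b₂ (by simp; tauto), hgh b₁ (by simp; tauto)]
  · rw [hT]
    have hqp : q ≠ p := by tauto
    have hrp : r ≠ p := by tauto
    have hrq : r ≠ q := by tauto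
    simp only [Multiset.insert_eq_cons, Multiset.mem_cons, Multiset.mem_singleton, forall_eq_or_imp,
      forall_eq, if_true, if_neg hqp, if_neg hrp, if_neg hrq]
    constructor
    · rintro ⟨⟨h1, h2⟩, ⟨h3, h4⟩, h5⟩
      exact ⟨⟨h3.trans h1, (Crossing.colored_congr k h2 h4 rfl rfl).1 h5⟩, h2, h1, h4⟩
    · rintro ⟨⟨h1, h2⟩, h3, h4, h5⟩
      exact ⟨⟨h4, h3⟩, ⟨h1.trans h4.symm, h5⟩, (Crossing.colored_congr k h3 h5 rfl rfl).2 h2⟩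
  · rw [hT']
    have hqp : q ≠ p := by tauto
    have hrp : r ≠ p := by tauto
    have hrq : r ≠ q := by tauto
    simp only [Multiset.insert_eq_cons, Multiset.mem_cons, Multiset.mem_singleton, forall_eq_or_imp,
      forall_eq, if_true, if_neg hqp, if_neg hrp, if_neg hrq]
    constructor
    · rintro ⟨h1, ⟨h2, h3⟩, h4, h5⟩
      exact ⟨⟨h4.trans h2, (Crossing.colored_congr k rfl rfl h3.symm h5.symm).1 h1⟩,
        h3.symm, h5.symm, h2⟩
    · rintro ⟨⟨h1, h2⟩, h3, h4, h5⟩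
      exact ⟨(Crossing.colored_congr k rfl rfl h3 h4).2 h2, ⟨h5, h3.symm⟩, h1.trans h5.symm,
        h4.symm⟩
  · refine evaluate_triangle β g g' .virt .virt k (hsep P hP) rfl rfl rfl rfl rfl rfl ?_
    obtain ⟨⟨h1, h2⟩, ⟨h3, h4⟩, h5⟩ := (hT g).1 hg
    obtain ⟨h1', ⟨h2', h3'⟩, h4', h5'⟩ := (hT' g').1 hg'
    have ha₂ := hgg a₂ (by simp; tauto) (by simp; tauto)
    have ha₃ := hgg a₃ (by simp; tauto) (by simp; tauto)
    have hb₁ := hgg b₁ (by simp; tauto) (by simp; tauto)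
    have hb₂ := hgg b₂ (by simp; tauto) (by simp; tauto)
    have hp : g p = g' a₂ := h2.trans ha₂
    have hb : g b₁ = g' p := hb₁.trans h3'
    cases k with
    | pos =>
      simp only [Crossing.underLeft, Crossing.overLeft]
      rw [hp, hb]
      exact weight_virtual_triangle β _ _ _ _ _ _ _ _ _
    | neg =>
      simp only [Crossing.underLeft, Crossing.overLeft]
      rw [hp, hb]
      exact weight_virtual_triangle β _ _ _ _ _ _ _ _ _
    | virt => exact weight_virtual_triangle β (weight β .virt (g p) (g p)) _ _ _ _ _ _ _ _

/-- Every local move is a replacement, provided that every edge begins at most once and ends at most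
once in the piece of the diagram to which it is applied. -/
theorem LocalMove.nonempty_replacement {T T' : Code} (h : LocalMove T T')
    (hin : T.incoming.Nodup) (hout : T.outgoing.Nodup) : Nonempty (Replacement β T T') := by
  cases h with
  | kink_right k a b m => exact nonempty_replacement_kink_right β k a b m hin hout
  | kink_left k a b m => exact nonempty_replacement_kink_left β k a b m hin hout
  | direct k a b c d e f => exact nonempty_replacement_direct β k a b c d e f hin hout
  | reverse_right k a b c d e f => exact nonempty_replacement_reverse_right β k a b c d e f hin hout
  | reverse_left k a b c d e f => exact nonempty_replacement_reverse_left β k a b c d e f hin hout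
  | triangle a₁ a₂ a₃ b₁ b₂ b₃ p q r =>
    exact nonempty_replacement_triangle β a₁ a₂ a₃ b₁ b₂ b₃ p q r hin hout
  | virtual_triangle k a₁ a₂ a₃ b₁ b₂ b₃ p q r =>
    exact nonempty_replacement_virtual_triangle β k a₁ a₂ a₃ b₁ b₂ b₃ p q r hin hout

end LocalMoves

/-! ### Colorings and homomorphisms from the fundamental biquandle -/

namespace Diagram

variable {D : Diagram} {X : Type u} [Biquandle X]

/-- The value of a word under an assignment of colors to the edges. -/
noncomputable def Word.eval (f : D.Edge → X) : D.Word → X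
  | .gen e => f e
  | .underBy a b => Biquandle.underBy (a.eval f) (b.eval f)
  | .overBy a b => Biquandle.overBy (a.eval f) (b.eval f)
  | .underInv a b => (Equiv.ofBijective _ (under_bijective (b.eval f))).symm (a.eval f)
  | .overInv a b => (Equiv.ofBijective _ (over_bijective (b.eval f))).symm (a.eval f)
  | .sideFst a b =>
    ((Equiv.ofBijective _ Biquandle.sideways_bijective).symm (a.eval f, b.eval f)).1
  | .sideSnd a b =>
    ((Equiv.ofBijective _ Biquandle.sideways_bijective).symm (a.eval f, b.eval f)).2

theorem Word.eval_eq_of_wordRel {f : D.Edge → X} (hf : D.IsColoring f) {a b : D.Word}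
    (h : D.WordRel a b) : a.eval f = b.eval f := by
  have hS : ∀ a b : X, (fun p : X × X => (Biquandle.overBy p.2 p.1, Biquandle.underBy p.1 p.2))
      ((Equiv.ofBijective _ Biquandle.sideways_bijective).symm (a, b)) = (a, b) := fun a b =>
    (Equiv.ofBijective _ Biquandle.sideways_bijective).apply_symm_apply (a, b)
  have hS' : ∀ a b : X, (Equiv.ofBijective _ Biquandle.sideways_bijective).symm
      (Biquandle.overBy b a, Biquandle.underBy a b) = (a, b) := fun a b =>
    (Equiv.ofBijective _ Biquandle.sideways_bijective).symm_apply_apply (a, b)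
  induction h with
  | refl a => rfl
  | symm _ ih => exact ih.symm
  | trans _ _ ih ih' => exact ih.trans ih'
  | congr_under _ _ ih ih' => simp only [eval, ih, ih']
  | congr_over _ _ ih ih' => simp only [eval, ih, ih']
  | congr_underInv _ _ ih ih' => simp only [eval, ih, ih']
  | congr_overInv _ _ ih ih' => simp only [eval, ih, ih']
  | congr_sideFst _ _ ih ih' => simp only [eval, ih, ih']
  | congr_sideSnd _ _ ih ih' => simp only [eval, ih, ih']
  | under_self a => exact Biquandle.under_self _
  | under_underInv a b =>
    exact (Equiv.ofBijective _ (under_bijective (b.eval f))).apply_symm_apply (a.eval f)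
  | underInv_under a b =>
    exact (Equiv.ofBijective _ (under_bijective (b.eval f))).symm_apply_apply (a.eval f)
  | over_overInv a b =>
    exact (Equiv.ofBijective _ (over_bijective (b.eval f))).apply_symm_apply (a.eval f)
  | overInv_over a b =>
    exact (Equiv.ofBijective _ (over_bijective (b.eval f))).symm_apply_apply (a.eval f)
  | over_side a b => exact congrArg Prod.fst (hS (a.eval f) (b.eval f))
  | under_side a b => exact congrArg Prod.snd (hS (a.eval f) (b.eval f))
  | sideFst_side a b => exact congrArg Prod.fst (hS' (a.eval f) (b.eval f))
  | sideSnd_side a b => exact congrArg Prod.snd (hS' (a.eval f) (b.eval f))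
  | under_under x y z => exact Biquandle.under_under _ _ _
  | under_over x y z => exact Biquandle.under_over _ _ _
  | over_over x y z => exact Biquandle.over_over _ _ _
  | through e e' h => exact hf.through e e' h
  | crossing_under c => exact hf.underBy c
  | crossing_over c => exact hf.overBy c

/-- A homomorphism from the fundamental biquandle colors the edges by its values on the
generators. -/
theorem ColoringHom.isColoring (f : D.ColoringHom X) :
    D.IsColoring fun e => f.toFun (D.generator e) where
  through e e' h := congrArg f.toFun (Quotient.sound (s := D.wordSetoid) (.through e e' h))
  underBy c := (congrArg f.toFun (Quotient.sound (s := D.wordSetoid) (.crossing_under c))).trans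
    (f.map_under (D.generator _) (D.generator _))
  overBy c := (congrArg f.toFun (Quotient.sound (s := D.wordSetoid) (.crossing_over c))).trans
    (f.map_over (D.generator _) (D.generator _))

/-- Colorings are the same as homomorphisms from the fundamental biquandle. -/
noncomputable def coloringHomEquiv (D : Diagram) (X : Type u) [Biquandle X] :
    D.ColoringHom X ≃ {f : D.Edge → X // D.IsColoring f} :=
  Equiv.ofBijective (fun f => ⟨fun e => f.toFun (D.generator e), f.isColoring⟩) <| by
    refine ⟨fun f g h => D.coloringHom_injective X (congrArg Subtype.val h), fun ⟨f, hf⟩ => ?_⟩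
    refine ⟨⟨Quotient.lift (Word.eval f) fun _ _ h => Word.eval_eq_of_wordRel hf h, ?_, ?_⟩, rfl⟩
    · rintro ⟨a⟩ ⟨b⟩
      rfl
    · rintro ⟨a⟩ ⟨b⟩
      rfl

theorem fst_mem (D : Diagram) {m : ℕ × ℕ} (h : m ∈ D.marks) : m.1 ∈ D.incoming := by
  simp only [Code.incoming, Multiset.mem_add]
  exact Or.inr (Multiset.mem_map_of_mem _ h)

theorem snd_mem (D : Diagram) {m : ℕ × ℕ} (h : m ∈ D.marks) : m.2 ∈ D.incoming := by
  rw [D.mem_incoming_iff]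
  simp only [Code.outgoing, Multiset.mem_add]
  exact Or.inr (Multiset.mem_map_of_mem _ h)

/-- The coloring condition for a diagram only involves the labels of its edges, so it can be stated for
colorings of all labels. -/
theorem isColoring_iff (g : ℕ → X) :
    (D.IsColoring fun e => g e.1) ↔ D.toCode.Colored g := by
  constructor
  · rintro ⟨h1, h2, h3⟩
    refine ⟨fun c hc => ?_, fun m hm => ?_⟩
    · rw [Crossing.Colored]
      split
      · rename_i hk
        exact ⟨(h1 _ _ (.rising c hc hk)).symm, (h1 _ _ (.falling c hc hk)).symm⟩
      · rename_i hk
        exact ⟨h2 ⟨c, hc, hk⟩, h3 ⟨c, hc, hk⟩⟩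
    · exact h1 ⟨m.1, D.fst_mem hm⟩ ⟨m.2, D.snd_mem hm⟩ (.mark _ _ hm)
  · rintro ⟨h1, h2⟩
    have key : ∀ c : D.ClassicalCrossing,
        g c.1.underRight = Biquandle.underBy (g c.1.underLeft) (g c.1.overLeft) ∧
          g c.1.overRight = Biquandle.overBy (g c.1.overLeft) (g c.1.underLeft) := by
      intro c
      have := h1 c.1 c.2.1
      rw [Crossing.Colored] at this
      split at this
      · rename_i hk
        exact absurd hk c.2.2
      · exact this
    refine ⟨fun e e' h => ?_, fun c => (key c).1, fun c => (key c).2⟩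
    cases h with
    | mark _ _ h => exact h2 _ h
    | rising c hc hk =>
      have := h1 c hc
      rw [Crossing.Colored, hk] at this
      exact this.1.symm
    | falling c hc hk =>
      have := h1 c hc
      rw [Crossing.Colored, hk] at this
      exact this.2.symm

/-! ### The state sum as an evaluated skein element -/

/-- The system of arcs of a state. -/
noncomputable def stateArcs (D : Diagram) (s : D.State) : Multiset (Sym2 ℕ) :=
  (∑ c ∈ D.crossings.toFinset with c.kind = .virt, c.arcs .virt) +
      ∑ c : D.ClassicalCrossing, c.1.arcs (s c) +
    D.markArcs

end Diagram

/-- The closed curves of a system of arcs, counted by classes of edges under any relation that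
generates the same equivalence. -/
theorem circles_eq_card_quot {P : Multiset (Sym2 ℕ)} {p : ℕ → Prop}
    {r : {e // p e} → {e // p e} → Prop} (hp : ∀ v, p v → v ∈ vertices P)
    (hr : ∀ u v, r u v → ArcAdj P u.1 v.1)
    (hP : ∀ u v, ArcAdj P u v → ∃ hu hv, Quot.mk r ⟨u, hu⟩ = Quot.mk r ⟨v, hv⟩) :
    circles P = Nat.card (Quot r) := by
  classical
  let φ : Quot r → Quot (ArcAdj P) := Quot.lift (fun u => Quot.mk _ u.1) fun u v h =>
    Quot.sound (hr u v h)
  let ψ : Quot (ArcAdj P) → Option (Quot r) := Quot.lift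
    (fun u => if hu : p u then some (Quot.mk r ⟨u, hu⟩) else none) fun u v h => by
      obtain ⟨hu, hv, he⟩ := hP u v h
      simp only [dif_pos hu, dif_pos hv, he]
  have hφ : φ.Injective := by
    rintro ⟨u⟩ ⟨v⟩ h
    have h' : ψ (φ (Quot.mk r u)) = ψ (φ (Quot.mk r v)) := congrArg ψ h
    simpa [φ, ψ, u.2, v.2] using h'
  rw [← Nat.card_range_of_injective hφ, circles, ← Nat.card_coe_set_eq]
  congr 1
  congr 1
  ext x
  constructor
  · rintro ⟨u, ⟨e, he, hu⟩, rfl⟩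
    obtain ⟨w, rfl⟩ := Sym2.mem_iff_exists.1 hu
    obtain ⟨hu, -, -⟩ := hP u w he
    exact ⟨Quot.mk r ⟨u, hu⟩, rfl⟩
  · rintro ⟨⟨u⟩, rfl⟩
    exact ⟨u.1, hp u.1 u.2, rfl⟩

theorem Crossing.mem_vertices_arcs (c : Crossing) (t : Smoothing) (v : ℕ) :
    v ∈ vertices (c.arcs t) ↔ v = c.sw ∨ v = c.se ∨ v = c.nw ∨ v = c.ne := by
  cases t <;> simp [vertices, Crossing.arcs, VirtualLink.arcs, resolve] <;> tauto

theorem Crossing.mem_arcs {c : Crossing} {t : Smoothing} {u v : ℕ} (h : s(u, v) ∈ c.arcs t) :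
    ∃ p ∈ resolve t c.sw c.se c.nw c.ne, (u = p.1 ∧ v = p.2) ∨ (u = p.2 ∧ v = p.1) := by
  obtain ⟨p, hp, h⟩ := List.mem_map.1 (Multiset.mem_coe.1 h)
  refine ⟨p, hp, ?_⟩
  rcases Sym2.eq_iff.1 h with ⟨h1, h2⟩ | ⟨h1, h2⟩
  · exact Or.inl ⟨h1.symm, h2.symm⟩
  · exact Or.inr ⟨h2.symm, h1.symm⟩

namespace Diagram

variable (D : Diagram)

theorem mem_stateArcs (s : D.State) (e : Sym2 ℕ) :
    e ∈ D.stateArcs s ↔ (∃ c ∈ D.crossings, c.kind = .virt ∧ e ∈ c.arcs .virt) ∨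
      (∃ c : D.ClassicalCrossing, e ∈ c.1.arcs (s c)) ∨ ∃ m ∈ D.marks, s(m.1, m.2) = e := by
  simp only [stateArcs, Multiset.mem_add, Multiset.mem_sum, Finset.mem_filter,
    Multiset.mem_toFinset, Code.markArcs, Multiset.mem_map, Finset.mem_univ, true_and, and_assoc,
    or_assoc]

theorem arcAdj_of_stateAdj {s : D.State} {u v : D.Edge} (h : D.StateAdj s u v) :
    ArcAdj (D.stateArcs s) u.1 v.1 := by
  rw [ArcAdj, mem_stateArcs]
  cases h with
  | through e e' h =>
    cases h with
    | mark _ _ h => exact Or.inr (Or.inr ⟨_, h, rfl⟩)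
    | rising c hc hk => exact Or.inl ⟨c, hc, hk, by simp [Crossing.arcs, VirtualLink.arcs, resolve]⟩
    | falling c hc hk => exact Or.inl ⟨c, hc, hk, by simp [Crossing.arcs, VirtualLink.arcs, resolve]⟩
  | along_left c h => exact Or.inr (Or.inl ⟨c, by simp [Crossing.arcs, VirtualLink.arcs, resolve, h]⟩)
  | along_right c h => exact Or.inr (Or.inl ⟨c, by simp [Crossing.arcs, VirtualLink.arcs, resolve, h]⟩)
  | against_bottom c h => exact Or.inr (Or.inl ⟨c, by simp [Crossing.arcs, VirtualLink.arcs, resolve, h]⟩)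
  | against_top c h => exact Or.inr (Or.inl ⟨c, by simp [Crossing.arcs, VirtualLink.arcs, resolve, h]⟩)
  | virt_rising c h => exact Or.inr (Or.inl ⟨c, by simp [Crossing.arcs, VirtualLink.arcs, resolve, h]⟩)
  | virt_falling c h => exact Or.inr (Or.inl ⟨c, by simp [Crossing.arcs, VirtualLink.arcs, resolve, h]⟩)

theorem exists_stateAdj_of_arcAdj {s : D.State} {u v : ℕ} (h : ArcAdj (D.stateArcs s) u v) :
    ∃ hu hv, Quot.mk (D.StateAdj s) ⟨u, hu⟩ = Quot.mk (D.StateAdj s) ⟨v, hv⟩ := by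
  have key : ∀ {x y : D.Edge}, D.StateAdj s x y → ((u = x.1 ∧ v = y.1) ∨ (u = y.1 ∧ v = x.1)) →
      ∃ hu hv, Quot.mk (D.StateAdj s) ⟨u, hu⟩ = Quot.mk (D.StateAdj s) ⟨v, hv⟩ := by
    rintro x y hxy (⟨rfl, rfl⟩ | ⟨rfl, rfl⟩)
    · exact ⟨x.2, y.2, Quot.sound hxy⟩
    · exact ⟨y.2, x.2, (Quot.sound hxy).symm⟩
  rw [ArcAdj, mem_stateArcs] at h
  rcases h with ⟨c, hc, hk, h⟩ | ⟨c, h⟩ | ⟨m, hm, h⟩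
  · obtain ⟨p, hp, h⟩ := Crossing.mem_arcs h
    simp only [resolve, List.mem_cons, List.not_mem_nil, or_false] at hp
    rcases hp with rfl | rfl
    · exact key (.through _ _ (.rising c hc hk)) h
    · exact key (.through _ _ (.falling c hc hk)) h
  · obtain ⟨p, hp, h⟩ := Crossing.mem_arcs h
    cases hs : s c <;> rw [hs] at hp <;>
      simp only [resolve, List.mem_cons, List.not_mem_nil, or_false] at hp <;>
      rcases hp with rfl | rfl
    · exact key (.along_left c hs) h
    · exact key (.along_right c hs) h
    · exact key (.against_bottom c hs) h
    · exact key (.against_top c hs) h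
    · exact key (.virt_rising c hs) h
    · exact key (.virt_falling c hs) h
  · refine key (x := ⟨m.1, D.fst_mem hm⟩) (y := ⟨m.2, D.snd_mem hm⟩) (.through _ _ (.mark _ _ hm)) ?_
    rcases Sym2.eq_iff.1 h with ⟨h1, h2⟩ | ⟨h1, h2⟩
    · exact Or.inl ⟨h1.symm, h2.symm⟩
    · exact Or.inr ⟨h2.symm, h1.symm⟩

theorem mem_vertices_stateArcs (s : D.State) {e : ℕ} (he : e ∈ D.incoming) :
    e ∈ vertices (D.stateArcs s) := by
  have key : ∀ c ∈ D.crossings, e = c.sw ∨ e = c.se → e ∈ vertices (D.stateArcs s) := by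
    intro c hc h
    have hv : ∀ t, e ∈ vertices (c.arcs t) := fun t => (c.mem_vertices_arcs t e).2 (by tauto)
    by_cases hk : c.kind = .virt
    · obtain ⟨a, ha, hea⟩ := hv .virt
      exact ⟨a, (D.mem_stateArcs s a).2 (Or.inl ⟨c, hc, hk, ha⟩), hea⟩
    · obtain ⟨a, ha, hea⟩ := hv (s ⟨c, hc, hk⟩)
      exact ⟨a, (D.mem_stateArcs s a).2 (Or.inr (Or.inl ⟨⟨c, hc, hk⟩, ha⟩)), hea⟩
  simp only [Code.incoming, Multiset.mem_add, Multiset.mem_map] at he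
  rcases he with (⟨c, hc, rfl⟩ | ⟨c, hc, rfl⟩) | ⟨m, hm, rfl⟩
  · exact key c hc (Or.inl rfl)
  · exact key c hc (Or.inr rfl)
  · exact ⟨_, (D.mem_stateArcs s _).2 (Or.inr (Or.inr ⟨m, hm, rfl⟩)), by simp⟩

theorem circles_stateArcs (s : D.State) : circles (D.stateArcs s) = D.curves s :=
  circles_eq_card_quot (fun _ h => D.mem_vertices_stateArcs s h)
    (fun _ _ h => D.arcAdj_of_stateAdj h) fun _ _ h => D.exists_stateAdj_of_arcAdj h

theorem nodup_crossings : D.crossings.Nodup := by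
  have := D.nodup_incoming
  rw [Code.incoming, add_assoc, Multiset.nodup_add] at this
  exact this.1.of_map _

section StateSum

variable {X : Type u} [Biquandle X] {R : Type v} [CommRing R] (β : Biquandle.VirtualBracket X R)

/-- The writhe correction at a crossing, as an exponent of `w`. -/
def _root_.VirtualLink.Kind.sign : Kind → ℤ
  | .pos => -1
  | .neg => 1
  | .virt => 0

theorem zpow_sum {G ι : Type*} [CommGroup G] (w : G) (s : Finset ι) (n : ι → ℤ) :
    ∏ i ∈ s, w ^ n i = w ^ ∑ i ∈ s, n i := by
  classical
  induction s using Finset.induction_on with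
  | empty => simp
  | insert i s hi ih => rw [Finset.prod_insert hi, Finset.sum_insert hi, ih, zpow_add]

theorem sum_sign : ∑ c : D.ClassicalCrossing, c.1.kind.sign = D.negSubPos := by
  have h1 : ∑ c : D.ClassicalCrossing, c.1.kind.sign =
      ∑ c ∈ D.crossings.toFinset with c.kind ≠ .virt, c.kind.sign :=
    (Finset.sum_subtype (p := fun c => c ∈ D.crossings ∧ c.kind ≠ .virt) _ (fun c => by simp)
      fun c => c.kind.sign).symm
  have h2 : ∑ c ∈ D.crossings.toFinset with c.kind ≠ .virt, c.kind.sign =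
      ∑ c ∈ D.crossings.toFinset, c.kind.sign := by
    refine Finset.sum_filter_of_ne fun c _ h hk => h ?_
    rw [hk]; rfl
  rw [h1, h2, Finset.sum, Multiset.toFinset_val, D.nodup_crossings.dedup, negSubPos]
  induction D.crossings using Multiset.induction with
  | empty => simp
  | cons c C ih =>
    rw [Multiset.map_cons, Multiset.sum_cons, ih, Multiset.countP_cons, Multiset.countP_cons]
    cases hk : c.kind <;> simp only [Kind.sign, reduceCtorEq, if_true, if_false] <;> push_cast <;>
      ring

theorem weight_eq {k : Kind} (hk : k ≠ .virt) (x y : X) (t : Smoothing) :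
    weight β k x y t = ((β.w ^ k.sign : Rˣ) : R) * coefficient β k t x y := by
  cases k with
  | pos => simp [weight, Kind.sign]
  | neg => simp [weight, Kind.sign]
  | virt => exact absurd rfl hk

theorem skein_of_virt (g : ℕ → X) {c : Crossing} (hc : c.kind = .virt) :
    c.skein β g = AddMonoidAlgebra.single (c.arcs .virt) 1 := by
  rw [Crossing.skein, sum_smoothing, hc]
  simp [weight]

/-- The skein element of a diagram is the formal sum of its states. -/
theorem skein_eq_sum (g : ℕ → X) : D.toCode.skein β g =
    ∑ s : D.State, AddMonoidAlgebra.single (D.stateArcs s)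
      (∏ c : D.ClassicalCrossing, weight β c.1.kind (g c.1.underLeft) (g c.1.overLeft) (s c)) := by
  have h1 : (D.crossings.map (Crossing.skein β g)).prod =
      ∏ c ∈ D.crossings.toFinset, c.skein β g := by
    rw [Finset.prod, Multiset.toFinset_val, D.nodup_crossings.dedup]
  have h2 : ∏ c ∈ D.crossings.toFinset with c.kind = .virt, c.skein β g =
      AddMonoidAlgebra.single (∑ c ∈ D.crossings.toFinset with c.kind = .virt, c.arcs .virt) 1 := by
    rw [Finset.prod_congr rfl fun c hc => skein_of_virt β g (Finset.mem_filter.1 hc).2,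
      AddMonoidAlgebra.prod_single, Finset.prod_const_one]
  have h3 : ∏ c ∈ D.crossings.toFinset with ¬ c.kind = .virt, c.skein β g =
      ∏ c : D.ClassicalCrossing, c.1.skein β g := Finset.prod_subtype _ (by simp) _
  have h4 : ∏ c : D.ClassicalCrossing, c.1.skein β g =
      ∑ s : D.State, AddMonoidAlgebra.single (∑ c : D.ClassicalCrossing, c.1.arcs (s c))
        (∏ c : D.ClassicalCrossing,
          weight β c.1.kind (g c.1.underLeft) (g c.1.overLeft) (s c)) := by
    simp only [Crossing.skein]
    rw [Finset.prod_univ_sum, Fintype.piFinset_univ]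
    simp only [AddMonoidAlgebra.prod_single]
  rw [Code.skein, h1, ← Finset.prod_filter_mul_prod_filter_not _ (fun c => c.kind = .virt), h2, h3,
    h4, Finset.mul_sum, Finset.sum_mul]
  refine Finset.sum_congr rfl fun s _ => ?_
  rw [AddMonoidAlgebra.single_mul_single, AddMonoidAlgebra.single_mul_single, one_mul, mul_one]
  rfl

theorem stateSum_eq_evaluate {f : D.ColoringHom X} {g : ℕ → X}
    (h : ∀ e : D.Edge, f.toFun (D.generator e) = g e.1) :
    D.stateSum β f = evaluate β.δ (D.toCode.skein β g) := by
  rw [skein_eq_sum, map_sum, stateSum]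
  refine Finset.sum_congr rfl fun s _ => ?_
  rw [evaluate_single, circles_stateArcs, stateValue,
    Finset.prod_congr rfl fun c _ => weight_eq β c.2.2 _ _ (s c), Finset.prod_mul_distrib,
    ← sum_sign, ← Units.coe_prod, zpow_sum]
  simp only [h]
  simp only [underLeft, overLeft]
  ring

end StateSum

end Diagram

/-! ### Effect of a change inside a diagram on its state sums -/

section Context

variable {X : Type u} [Biquandle X] {R : Type v} [CommRing R] (β : Biquandle.VirtualBracket X R)

theorem Code.mem_edges {T : Code} {c : Crossing} (h : c ∈ T.crossings) :
    c.sw ∈ T.incoming ∧ c.se ∈ T.incoming ∧ c.nw ∈ T.outgoing ∧ c.ne ∈ T.outgoing := by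
  simp only [incoming, outgoing, Multiset.mem_add]
  exact ⟨Or.inl (Or.inl (Multiset.mem_map_of_mem _ h)), Or.inl (Or.inr (Multiset.mem_map_of_mem _ h)),
    Or.inl (Or.inl (Multiset.mem_map_of_mem _ h)), Or.inl (Or.inr (Multiset.mem_map_of_mem _ h))⟩

theorem Code.mem_edges_of_mark {T : Code} {m : ℕ × ℕ} (h : m ∈ T.marks) :
    m.1 ∈ T.incoming ∧ m.2 ∈ T.outgoing := by
  simp only [incoming, outgoing, Multiset.mem_add]
  exact ⟨Or.inr (Multiset.mem_map_of_mem _ h), Or.inr (Multiset.mem_map_of_mem _ h)⟩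

theorem Crossing.skein_congr {g h : ℕ → X} {c : Crossing} (hsw : g c.sw = h c.sw)
    (hnw : g c.nw = h c.nw) : c.skein β g = c.skein β h := by
  have h1 : g c.underLeft = h c.underLeft := by
    rw [Crossing.underLeft]
    split
    · exact hsw
    · exact hnw
  have h2 : g c.overLeft = h c.overLeft := by
    rw [Crossing.overLeft]
    split
    · exact hnw
    · exact hsw
  rw [Crossing.skein, Crossing.skein, h1, h2]

theorem Code.skein_congr {g h : ℕ → X} {T : Code} (hin : ∀ e ∈ T.incoming, g e = h e)
    (hout : ∀ e ∈ T.outgoing, g e = h e) : T.skein β g = T.skein β h := by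
  rw [Code.skein, Code.skein, Multiset.map_congr rfl fun c hc =>
    Crossing.skein_congr β (hin _ (mem_edges hc).1) (hout _ (mem_edges hc).2.2.1)]

/-- If two elements of the algebra evaluate equally next to all systems of arcs that avoid `N`, then
they do so next to a piece of a diagram whose edges avoid `N`. -/
theorem evaluate_context {N : Set ℕ} {z z' : AddMonoidAlgebra R (Multiset (Sym2 ℕ))}
    (hz : ∀ P : Multiset (Sym2 ℕ), (∀ e ∈ N, e ∉ vertices P) →
      evaluate β.δ (AddMonoidAlgebra.single P 1 * z) =
        evaluate β.δ (AddMonoidAlgebra.single P 1 * z'))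
    (g : ℕ → X) (S : Code) (hin : ∀ e ∈ S.incoming, e ∉ N) (hout : ∀ e ∈ S.outgoing, e ∉ N) :
    evaluate β.δ (S.skein β g * z) = evaluate β.δ (S.skein β g * z') := by
  have hmarks : ∀ e ∈ N, e ∉ vertices S.markArcs := by
    rintro e he ⟨a, ha, hea⟩
    obtain ⟨m, hm, rfl⟩ := Multiset.mem_map.1 ha
    rcases Sym2.mem_iff.1 hea with rfl | rfl
    · exact hin _ (Code.mem_edges_of_mark hm).1 he
    · exact hout _ (Code.mem_edges_of_mark hm).2 he
  have hC : ∀ c ∈ S.crossings, ∀ e ∈ N, ∀ t, e ∉ vertices (c.arcs t) := by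
    intro c hc e he t h
    obtain ⟨h1, h2, h3, h4⟩ := Code.mem_edges hc
    rcases (c.mem_vertices_arcs t e).1 h with rfl | rfl | rfl | rfl
    exacts [hin _ h1 he, hin _ h2 he, hout _ h3 he, hout _ h4 he]
  have key : ∀ (C : Multiset Crossing), (∀ c ∈ C, ∀ e ∈ N, ∀ t, e ∉ vertices (c.arcs t)) →
      ∀ P : Multiset (Sym2 ℕ), (∀ e ∈ N, e ∉ vertices P) →
      evaluate β.δ (AddMonoidAlgebra.single P 1 * ((C.map (Crossing.skein β g)).prod * z)) =
        evaluate β.δ (AddMonoidAlgebra.single P 1 * ((C.map (Crossing.skein β g)).prod * z')) := by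
    intro C
    induction C using Multiset.induction with
    | empty => simpa using fun P hP => hz P hP
    | cons c C ih =>
      intro hC P hP
      simp only [Multiset.map_cons, Multiset.prod_cons, mul_assoc]
      rw [evaluate_skein_mul, evaluate_skein_mul]
      refine Finset.sum_congr rfl fun t _ => ?_
      rw [ih (fun c' hc' => hC c' (Multiset.mem_cons_of_mem hc'))]
      intro e he h
      rw [vertices_add] at h
      exact h.elim (hP e he) (hC c (Multiset.mem_cons_self _ _) e he t)
  have := key S.crossings hC S.markArcs hmarks
  rwa [mul_left_comm, mul_left_comm _ _ z', ← mul_assoc, ← mul_assoc] at this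

/-- A change of labels `σ` that turns systems of arcs `P` whose vertices contain `W`, united with
fixed arcs `Q`, into systems with the same number of closed curves turns state sums into equal state
sums. -/
theorem evaluate_relabel {σ : ℕ → ℕ} {Q : Multiset (Sym2 ℕ)} {W : Set ℕ}
    (hσ : ∀ P : Multiset (Sym2 ℕ), W ⊆ vertices P →
      circles (P + Q) = circles (P.map (Sym2.map σ)))
    {g g' : ℕ → X} {S : Code} (hin : ∀ e ∈ S.incoming, g e = g' (σ e))
    (hout : ∀ e ∈ S.outgoing, g e = g' (σ e)) (hW : W ⊆ {e | e ∈ S.incoming}) :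
    evaluate β.δ (S.skein β g * AddMonoidAlgebra.single Q 1) =
      evaluate β.δ ((S.relabel σ).skein β g') := by
  have hmarks : (S.relabel σ).markArcs = S.markArcs.map (Sym2.map σ) := by
    simp [Code.markArcs, Code.relabel, Function.comp_def]
  let ρ : Crossing → Crossing := fun c => ⟨c.kind, σ c.sw, σ c.se, σ c.nw, σ c.ne⟩
  have key : ∀ C : Multiset Crossing,
      (∀ c ∈ C, g c.sw = g' (σ c.sw) ∧ g c.nw = g' (σ c.nw)) →
      ∀ P : Multiset (Sym2 ℕ), (∀ e ∈ W, e ∈ vertices P ∨ ∃ c ∈ C, e = c.sw ∨ e = c.se) →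
      evaluate β.δ (AddMonoidAlgebra.single P 1 *
          ((C.map (Crossing.skein β g)).prod * AddMonoidAlgebra.single Q 1)) =
        evaluate β.δ (AddMonoidAlgebra.single (P.map (Sym2.map σ)) 1 *
          (((C.map ρ).map (Crossing.skein β g')).prod)) := by
    intro C
    induction C using Multiset.induction with
    | empty =>
      intro _ P hP
      simp [AddMonoidAlgebra.single_mul_single, hσ P fun e he => by simpa using hP e he]
    | cons c C ih =>
      intro hC P hP
      simp only [Multiset.map_cons, Multiset.prod_cons, mul_assoc]
      rw [evaluate_skein_mul, evaluate_skein_mul]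
      obtain ⟨hsw, hnw⟩ := hC c (Multiset.mem_cons_self _ _)
      have hu : g c.underLeft = g' (ρ c).underLeft := by
        simp only [Crossing.underLeft, ρ]
        cases c.kind <;> assumption
      have ho : g c.overLeft = g' (ρ c).overLeft := by
        simp only [Crossing.overLeft, ρ]
        cases c.kind <;> assumption
      refine Finset.sum_congr rfl fun t _ => ?_
      have harcs : (ρ c).arcs t = (c.arcs t).map (Sym2.map σ) := by cases t <;> rfl
      rw [ih (fun c' hc' => hC c' (Multiset.mem_cons_of_mem hc')), hu, ho, Multiset.map_add, harcs]
      intro e he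
      rw [vertices_add, Set.mem_union, Crossing.mem_vertices_arcs]
      rcases hP e he with h | ⟨c', hc', h⟩
      · exact Or.inl (Or.inl h)
      · rcases Multiset.mem_cons.1 hc' with rfl | hc'
        · exact Or.inl (Or.inr (by tauto))
        · exact Or.inr ⟨c', hc', h⟩
  rw [Code.skein, Code.skein, hmarks, mul_right_comm, mul_comm,
    mul_comm (Multiset.prod _) (AddMonoidAlgebra.single (S.markArcs.map _) _)]
  refine key S.crossings (fun c hc => ?_) S.markArcs fun e he => ?_
  · obtain ⟨h1, -, h3, -⟩ := Code.mem_edges hc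
    exact ⟨hin _ h1, hout _ h3⟩
  · have he := hW he
    simp only [Set.mem_ofPred_eq, Code.incoming, Multiset.mem_add, Multiset.mem_map] at he
    rcases he with (⟨c, hc, rfl⟩ | ⟨c, hc, rfl⟩) | ⟨m, hm, rfl⟩
    · exact Or.inr ⟨c, hc, Or.inl rfl⟩
    · exact Or.inr ⟨c, hc, Or.inr rfl⟩
    · exact Or.inl ⟨_, Multiset.mem_map_of_mem _ hm, by simp⟩

theorem Code.colored_relabel (σ : ℕ → ℕ) (g : ℕ → X) (T : Code) :
    (T.relabel σ).Colored g ↔ T.Colored (g ∘ σ) := by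
  simp only [Colored, relabel, Multiset.mem_map, forall_exists_index, and_imp,
    forall_apply_eq_imp_iff₂, Function.comp]
  refine and_congr (forall₂_congr fun c _ => ?_) Iff.rfl
  exact Crossing.colored_congr c.kind rfl rfl rfl rfl

end Context

/-! ### Invariance under the moves of diagrams -/

namespace Diagram

variable {X : Type u} [Biquandle X] {R : Type v} [CommRing R] (β : Biquandle.VirtualBracket X R)

/-- The colorings of two diagrams correspond to each other in such a way that corresponding
colorings have the same state sum. -/
def SameStateSums (D D' : Diagram) : Prop :=
  ∃ φ : D.ColoringHom X ≃ D'.ColoringHom X, ∀ f, D'.stateSum β (φ f) = D.stateSum β f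

variable {β}

theorem SameStateSums.refl (D : Diagram) : SameStateSums β D D :=
  ⟨Equiv.refl _, fun _ => rfl⟩

theorem SameStateSums.symm {D D' : Diagram} (h : SameStateSums β D D') : SameStateSums β D' D := by
  obtain ⟨φ, hφ⟩ := h
  exact ⟨φ.symm, fun f => by rw [← hφ, φ.apply_symm_apply]⟩

theorem SameStateSums.trans {D D' D'' : Diagram} (h : SameStateSums β D D')
    (h' : SameStateSums β D' D'') : SameStateSums β D D'' := by
  obtain ⟨φ, hφ⟩ := h
  obtain ⟨ψ, hψ⟩ := h'
  exact ⟨φ.trans ψ, fun f => by rw [Equiv.trans_apply, hψ, hφ]⟩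

theorem _root_.exists_equiv_of_existsUnique {α β : Type*} (r : α → β → Prop)
    (h : ∀ a, ∃! b, r a b) (h' : ∀ b, ∃! a, r a b) : ∃ φ : α ≃ β, ∀ a, r a (φ a) := by
  choose f hf hf' using fun a => (h a)
  choose g hg hg' using fun b => (h' b)
  exact ⟨⟨f, g, fun a => (hg' _ _ (hf a)).symm, fun b => (hf' _ _ (hg b)).symm⟩, hf⟩

/-- A relation between colorings of all labels that induces a correspondence between the colorings
of two diagrams. The diagrams must have edges: otherwise there is a coloring even if `X` is empty,
and it does not extend to all labels. -/
theorem sameStateSums_of_relation {D D' : Diagram} (hD : ∃ e, e ∈ D.incoming)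
    (hD' : ∃ e, e ∈ D'.incoming) (ρ : (ℕ → X) → (ℕ → X) → Prop)
    (lift : ∀ g, D.toCode.Colored g → ∃ g', D'.toCode.Colored g' ∧ ρ g g')
    (lift' : ∀ g', D'.toCode.Colored g' → ∃ g, D.toCode.Colored g ∧ ρ g g')
    (unique : ∀ g h g' h', D.toCode.Colored g → D.toCode.Colored h → D'.toCode.Colored g' →
      D'.toCode.Colored h' → ρ g g' → ρ h h' → (∀ e ∈ D.incoming, g e = h e) →
      ∀ e ∈ D'.incoming, g' e = h' e)
    (unique' : ∀ g h g' h', D.toCode.Colored g → D.toCode.Colored h → D'.toCode.Colored g' →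
      D'.toCode.Colored h' → ρ g g' → ρ h h' → (∀ e ∈ D'.incoming, g' e = h' e) →
      ∀ e ∈ D.incoming, g e = h e)
    (evaluate_eq : ∀ g g', D.toCode.Colored g → D'.toCode.Colored g' → ρ g g' →
      evaluate β.δ (D.toCode.skein β g) = evaluate β.δ (D'.toCode.skein β g')) :
    SameStateSums β D D' := by
  classical
  have extend : ∀ (D : Diagram), (∃ e, e ∈ D.incoming) → ∀ f : D.ColoringHom X,
      ∃ g : ℕ → X, D.toCode.Colored g ∧ ∀ e : D.Edge, f.toFun (D.generator e) = g e.1 := by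
    rintro D ⟨e₀, he₀⟩ f
    let g : ℕ → X := fun e => if he : e ∈ D.incoming then f.toFun (D.generator ⟨e, he⟩)
      else f.toFun (D.generator ⟨e₀, he₀⟩)
    have h : ∀ e : D.Edge, f.toFun (D.generator e) = g e.1 := fun e => by
      simp only [g, dif_pos e.2]
    refine ⟨g, (isColoring_iff g).1 ?_, h⟩
    convert f.isColoring using 2 with e
    exact (h e).symm
  have restrict : ∀ (D : Diagram) (g : ℕ → X), D.toCode.Colored g →
      ∃ f : D.ColoringHom X, ∀ e : D.Edge, f.toFun (D.generator e) = g e.1 := by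
    intro D g hg
    refine ⟨(D.coloringHomEquiv X).symm ⟨fun e => g e.1, (isColoring_iff g).2 hg⟩, fun e => ?_⟩
    have := (D.coloringHomEquiv X).apply_symm_apply ⟨fun e => g e.1, (isColoring_iff g).2 hg⟩
    exact congrFun (congrArg Subtype.val this) e
  obtain ⟨φ, hφ⟩ := exists_equiv_of_existsUnique
    (fun (f : D.ColoringHom X) (f' : D'.ColoringHom X) => ∃ g g', D.toCode.Colored g ∧
      D'.toCode.Colored g' ∧ ρ g g' ∧ (∀ e : D.Edge, f.toFun (D.generator e) = g e.1) ∧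
      ∀ e : D'.Edge, f'.toFun (D'.generator e) = g' e.1)
    (fun f => by
      obtain ⟨g, hg, hfg⟩ := extend D hD f
      obtain ⟨g', hg', hρ⟩ := lift g hg
      obtain ⟨f', hfg'⟩ := restrict D' g' hg'
      refine ⟨f', ⟨g, g', hg, hg', hρ, hfg, hfg'⟩, ?_⟩
      rintro h' ⟨k, k', hk, hk', hρ', hfk, hhk'⟩
      refine D'.coloringHom_injective X (funext fun e => ?_)
      dsimp only
      rw [hfg', hhk']
      exact unique k g k' g' hk hg hk' hg' hρ' hρ
        (fun e he => (hfk ⟨e, he⟩).symm.trans (hfg ⟨e, he⟩)) e.1 e.2)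
    (fun f' => by
      obtain ⟨g', hg', hfg'⟩ := extend D' hD' f'
      obtain ⟨g, hg, hρ⟩ := lift' g' hg'
      obtain ⟨f, hfg⟩ := restrict D g hg
      refine ⟨f, ⟨g, g', hg, hg', hρ, hfg, hfg'⟩, ?_⟩
      rintro h ⟨k, k', hk, hk', hρ', hhk, hfk'⟩
      refine D.coloringHom_injective X (funext fun e => ?_)
      dsimp only
      rw [hfg, hhk]
      exact unique' k g k' g' hk hg hk' hg' hρ' hρ
        (fun e he => (hfk' ⟨e, he⟩).symm.trans (hfg' ⟨e, he⟩)) e.1 e.2)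
  refine ⟨φ, fun f => ?_⟩
  obtain ⟨g, g', hg, hg', hρ, hfg, hfg'⟩ := hφ f
  rw [stateSum_eq_evaluate D β hfg, stateSum_eq_evaluate D' β hfg', evaluate_eq g g' hg hg' hρ]

theorem sameStateSums_of_relabel {D D' : Diagram} (σ : Equiv.Perm ℕ)
    (h : D'.toCode = D.toCode.relabel σ) : SameStateSums β D D' := by
  have hin : D'.incoming = D.incoming.map σ := by
    simp [h, Code.incoming, Code.relabel]
  by_cases hD : ∃ e, e ∈ D.incoming
  · obtain ⟨e, he⟩ := hD
    refine sameStateSums_of_relation ⟨e, he⟩ ⟨σ e, hin ▸ Multiset.mem_map_of_mem _ he⟩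
      (fun g g' => g = g' ∘ σ) (fun g hg => ⟨g ∘ σ.symm, ?_, ?_⟩) (fun g' hg' => ⟨_, ?_, rfl⟩)
      ?_ ?_ ?_
    · rw [h, Code.colored_relabel]
      simpa [Function.comp_def] using hg
    · simp [Function.comp_def]
    · rwa [h, Code.colored_relabel] at hg'
    · rintro _ _ g' h' - - - - rfl rfl heq e he
      rw [hin, Multiset.mem_map] at he
      obtain ⟨e, he, rfl⟩ := he
      exact heq e he
    · rintro _ _ g' h' - - - - rfl rfl heq e he
      exact heq (σ e) (hin ▸ Multiset.mem_map_of_mem _ he)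
    · rintro _ g' - - rfl
      have := evaluate_relabel β (σ := σ) (Q := 0) (W := ∅) (g := g' ∘ σ) (g' := g') (S := D.toCode)
        (fun P _ => by rw [add_zero, circles_map_of_injective σ.injective]) (fun _ _ => rfl)
        (fun _ _ => rfl) (Set.empty_subset _)
      rw [h, ← this, ← AddMonoidAlgebra.one_def, mul_one]
  -- A diagram without edges is not changed by a change of labels.
  · have h0 : D.incoming = 0 := Multiset.eq_zero_of_forall_notMem (not_exists.1 hD)
    have hC : D.crossings = 0 := by
      have := congrArg Multiset.card h0
      simp [Code.incoming] at this
      tauto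
    have hM : D.marks = 0 := by
      have := congrArg Multiset.card h0
      simp [Code.incoming] at this
      tauto
    have : D' = D := by
      have heq : D'.toCode = D.toCode := by
        rw [h]
        ext1 <;> simp [Code.relabel, hC, hM]
      cases D
      cases D'
      cases heq
      rfl
    rw [this]
    exact .refl D

/-- Removing a marked point contracts the arc between `a` and `b`. The number of closed curves stays
the same because the edge `b` also ends elsewhere, so this arc is not a whole curve. -/
theorem sameStateSums_of_unmark {D D' : Diagram} {a b : ℕ} {S : Code} (hab : a ≠ b)
    (h : D.toCode = S.join ⟨0, {(a, b)}⟩)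
    (h' : D'.toCode = S.relabel (Function.update id b a)) : SameStateSums β D D' := by
  set σ := Function.update id b a with hσ
  have hσb : σ b = a := by simp [σ]
  have hσne : ∀ e, e ≠ b → σ e = e := fun e he => by simp [σ, he]
  have hin : D.incoming = S.incoming + {a} := by
    simp only [h, Code.incoming, Code.join, Multiset.map_add]
    simp only [Multiset.map_zero, add_zero, Multiset.map_singleton, add_assoc]
  have hout : D.outgoing = S.outgoing + {b} := by
    simp only [h, Code.outgoing, Code.join, Multiset.map_add]
    simp only [Multiset.map_zero, add_zero, Multiset.map_singleton, add_assoc]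
  have hin' : D'.incoming = S.incoming.map σ := by
    simp [h', Code.incoming, Code.relabel]
  have hb : b ∈ S.incoming := by
    have : b ∈ D.incoming := by rw [D.mem_incoming_iff, hout]; simp
    rw [hin] at this
    simpa [hab.symm] using this
  have ha' : a ∈ D'.incoming := by
    rw [hin', ← hσb]; exact Multiset.mem_map_of_mem _ hb
  have hcol : ∀ g : ℕ → X, D.toCode.Colored g ↔ S.Colored g ∧ g a = g b := fun g => by
    rw [h, Code.colored_join]; simp [Code.Colored]
  have hcomp : ∀ g : ℕ → X, g a = g b → g ∘ σ = g := fun g hg => by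
    funext e
    by_cases he : e = b
    · subst he; rw [Function.comp, hσb, hg]
    · rw [Function.comp, hσne e he]
  -- The labels of the edges of the second diagram are `a` and those labels of the first that
  -- differ from `b`.
  have hedge : ∀ e ∈ D'.incoming, e ∈ D.incoming ∧ e ≠ b := by
    intro e he
    rw [hin', Multiset.mem_map] at he
    obtain ⟨x, hx, rfl⟩ := he
    rw [hin]
    by_cases hxb : x = b
    · subst hxb; rw [hσb]; simp [hab]
    · rw [hσne x hxb]; simp [hx, hxb]
  refine sameStateSums_of_relation ⟨b, hin ▸ by simp [hb]⟩ ⟨a, ha'⟩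
    (fun g g' => g = g' ∘ σ) (fun g hg => ?_) (fun g' hg' => ⟨g' ∘ σ, ?_, rfl⟩) ?_ ?_ ?_
  · obtain ⟨hS, hgab⟩ := (hcol g).1 hg
    refine ⟨g, ?_, (hcomp g hgab).symm⟩
    rwa [h', Code.colored_relabel, hcomp g hgab]
  · rw [h', Code.colored_relabel] at hg'
    refine (hcol _).2 ⟨hg', ?_⟩
    simp only [Function.comp, hσb, hσne a hab]
  · rintro _ _ g' k' - - - - rfl rfl heq e he
    have := heq e (hedge e he).1
    simpa only [Function.comp, hσne e (hedge e he).2] using this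
  · rintro _ _ g' k' - - - - rfl rfl heq e he
    refine heq _ ?_
    rw [hin] at he
    rcases Multiset.mem_add.1 he with he | he
    · rw [hin']; exact Multiset.mem_map_of_mem _ he
    · rw [Multiset.mem_singleton.1 he, hσne a hab]; exact ha'
  · rintro _ g' - - rfl
    have := evaluate_relabel β (σ := σ) (Q := {s(a, b)}) (W := {b}) (g := g' ∘ σ) (g' := g') (S := S)
      (fun P hP => by
        rw [add_comm, Multiset.singleton_add,
          circles_cons_eq_contract (Or.inr (hP (Set.mem_singleton b)))])
      (fun _ _ => rfl) (fun _ _ => rfl) (Set.singleton_subset_iff.2 hb)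
    rw [h', ← this, h, Code.skein_join]
    simp [Code.skein, Code.markArcs]

end Diagram

/-- A replacement can be undone. -/
def Replacement.symm {X : Type u} [Biquandle X] {R : Type v} [CommRing R]
    {β : Biquandle.VirtualBracket X R} {T T' : Code} (h : Replacement β T T') :
    Replacement β T' T where
  inner := h.inner'
  inner' := h.inner
  enter := h.enter
  leave := h.leave
  incoming_eq := h.incoming_eq'
  outgoing_eq := h.outgoing_eq'
  incoming_eq' := h.incoming_eq
  outgoing_eq' := h.outgoing_eq
  lift := h.lift'
  lift' := h.lift
  unique := h.unique'
  unique' := h.unique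
  evaluate_eq g g' hg hg' hgg P hP hP' :=
    (h.evaluate_eq g' g hg' hg (fun e he he' => (hgg e he' he).symm) P hP' hP).symm

namespace Diagram

variable {X : Type u} [Biquandle X] {R : Type v} [CommRing R] {β : Biquandle.VirtualBracket X R}

theorem incoming_join (S T : Code) : (S.join T).incoming = S.incoming + T.incoming := by
  simp only [Code.incoming, Code.join, Multiset.map_add]
  abel

theorem outgoing_join (S T : Code) : (S.join T).outgoing = S.outgoing + T.outgoing := by
  simp only [Code.outgoing, Code.join, Multiset.map_add]
  abel

section Replace

variable {D D' : Diagram} {S T T' : Code}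

/-- The inner edges of a piece of a diagram do not occur elsewhere. -/
theorem notMem_inner (r : Replacement β T T') (h : D.toCode = S.join T) :
    (∀ e ∈ S.incoming, e ∉ r.inner) ∧ (∀ e ∈ S.outgoing, e ∉ r.inner) ∧
      ∀ e ∈ r.enter, e ∉ r.inner := by
  have hin := D.nodup_incoming
  have hout := D.nodup_outgoing
  rw [h, incoming_join, r.incoming_eq, Multiset.nodup_add, Multiset.nodup_add,
    Multiset.disjoint_add_right] at hin
  rw [h, outgoing_join, r.outgoing_eq, Multiset.nodup_add, Multiset.nodup_add,
    Multiset.disjoint_add_right] at hout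
  exact ⟨fun e he he' => Multiset.disjoint_left.1 hin.2.2.2 he he',
    fun e he he' => Multiset.disjoint_left.1 hout.2.2.2 he he',
    fun e he he' => Multiset.disjoint_left.1 hin.2.1.2.2 he he'⟩

theorem mem_incoming_of_replacement (r : Replacement β T T') (h : D.toCode = S.join T) (e : ℕ) :
    e ∈ D.incoming ↔ e ∈ S.incoming ∨ e ∈ r.enter ∨ e ∈ r.inner := by
  rw [h, incoming_join, r.incoming_eq, Multiset.mem_add, Multiset.mem_add]

theorem exists_colored_of_replacement (r : Replacement β T T') (h : D.toCode = S.join T)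
    (h' : D'.toCode = S.join T') {g : ℕ → X} (hg : D.toCode.Colored g) :
    ∃ g', D'.toCode.Colored g' ∧ ∀ e ∉ r.inner, e ∉ r.inner' → g e = g' e := by
  rw [h, Code.colored_join] at hg
  obtain ⟨g', hg', hgg⟩ := r.lift g hg.2
  obtain ⟨h1, h2, -⟩ := notMem_inner r.symm h'
  refine ⟨g', ?_, fun e _ he => (hgg e he).symm⟩
  rw [h', Code.colored_join]
  exact ⟨(Code.colored_congr (fun e he => hgg e (h1 e he)) fun e he => hgg e (h2 e he)).2 hg.1, hg'⟩

/-- The colors in one diagram determine the colors in the other. -/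
theorem eq_of_replacement (r : Replacement β T T') (h : D.toCode = S.join T)
    (h' : D'.toCode = S.join T') {g k g' k' : ℕ → X} (hg' : D'.toCode.Colored g')
    (hk' : D'.toCode.Colored k') (hgg : ∀ e ∉ r.inner, e ∉ r.inner' → g e = g' e)
    (hkk : ∀ e ∉ r.inner, e ∉ r.inner' → k e = k' e) (hgk : ∀ e ∈ D.incoming, g e = k e) :
    ∀ e ∈ D'.incoming, g' e = k' e := by
  classical
  -- The coloring that agrees with `k'` on the diagram and with `g'` elsewhere.
  let m : ℕ → X := fun e => if e ∈ D'.incoming then k' e else g' e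
  have hm : ∀ e ∈ D'.incoming, m e = k' e := fun e he => if_pos he
  have hmcol : D'.toCode.Colored m :=
    (Code.colored_congr hm fun e he => hm e ((D'.mem_incoming_iff e).2 he)).2 hk'
  rw [h', Code.colored_join] at hmcol hg'
  obtain ⟨h1, -, h3⟩ := notMem_inner r h
  have := r.unique' g' m hg'.2 hmcol.2 fun e he => by
    by_cases heD : e ∈ D'.incoming
    · rw [hm e heD]
      rcases (mem_incoming_of_replacement r.symm h' e).1 heD with hS | hJ | hI
      · have hi := h1 e hS
        rw [← hgg e hi he, ← hkk e hi he,
          hgk e ((mem_incoming_of_replacement r h e).2 (Or.inl hS))]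
      · have hi := h3 e hJ
        rw [← hgg e hi he, ← hkk e hi he,
          hgk e ((mem_incoming_of_replacement r h e).2 (Or.inr (Or.inl hJ)))]
      · exact absurd hI he
    · exact (if_neg heD).symm
  intro e he
  rw [this, hm e he]

theorem sameStateSums_of_replacement (r : Replacement β T T') (h : D.toCode = S.join T)
    (h' : D'.toCode = S.join T') (hD : ∃ e, e ∈ D.incoming) (hD' : ∃ e, e ∈ D'.incoming) :
    SameStateSums β D D' := by
  refine sameStateSums_of_relation hD hD'
    (fun g g' => ∀ e ∉ r.inner, e ∉ r.inner' → g e = g' e)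
    (fun g hg => exists_colored_of_replacement r h h' hg) (fun g' hg' => ?_)
    (fun g k g' k' _ _ hg' hk' hgg hkk hgk => eq_of_replacement r h h' hg' hk' hgg hkk hgk)
    (fun g k g' k' hg hk _ _ hgg hkk hgk => eq_of_replacement r.symm h' h hg hk
      (fun e he he' => (hgg e he' he).symm) (fun e he he' => (hkk e he' he).symm) hgk)
    (fun g g' hg hg' hgg => ?_)
  · obtain ⟨g, hg, hgg⟩ := exists_colored_of_replacement r.symm h' h hg'
    exact ⟨g, hg, fun e he he' => (hgg e he' he).symm⟩
  · obtain ⟨h1, h2, -⟩ := notMem_inner r h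
    obtain ⟨h1', h2', -⟩ := notMem_inner r.symm h'
    rw [h, Code.colored_join] at hg
    rw [h', Code.colored_join] at hg'
    rw [h, h', Code.skein_join, Code.skein_join,
      ← Code.skein_congr β (fun e he => hgg e (h1 e he) (h1' e he))
        fun e he => hgg e (h2 e he) (h2' e he)]
    refine evaluate_context β (N := {e | e ∈ r.inner ∨ e ∈ r.inner'}) (fun P hP => ?_) g S
      (fun e he he' => he'.elim (h1 e he) (h1' e he)) (fun e he he' => he'.elim (h2 e he) (h2' e he))
    exact r.evaluate_eq g g' hg.2 hg'.2 hgg P (fun e he => hP e (Or.inl he))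
      fun e he => hP e (Or.inr he)

end Replace

theorem _root_.VirtualLink.LocalMove.exists_mem_incoming {T T' : Code} (h : LocalMove T T') :
    (∃ e, e ∈ T.incoming) ∧ ∃ e, e ∈ T'.incoming := by
  cases h <;> exact ⟨Multiset.exists_mem_of_ne_zero (by simp [Code.incoming]),
    Multiset.exists_mem_of_ne_zero (by simp [Code.incoming])⟩

theorem sameStateSums_of_move {D D' : Diagram} (h : Move D D') : SameStateSums β D D' := by
  cases h with
  | relabel σ h => exact sameStateSums_of_relabel σ h
  | unmark a b S hab h h' => exact sameStateSums_of_unmark hab h h'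
  | replace S T T' hT h h' =>
    have hin := D.nodup_incoming
    have hout := D.nodup_outgoing
    rw [h, incoming_join, Multiset.nodup_add] at hin
    rw [h, outgoing_join, Multiset.nodup_add] at hout
    obtain ⟨r⟩ := hT.nonempty_replacement β hin.2.1 hout.2.1
    obtain ⟨⟨e, he⟩, e', he'⟩ := hT.exists_mem_incoming
    refine sameStateSums_of_replacement r h h' ⟨e, ?_⟩ ⟨e', ?_⟩
    · rw [h, incoming_join]; exact Multiset.mem_add.2 (Or.inr he)
    · rw [h', incoming_join]; exact Multiset.mem_add.2 (Or.inr he')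

theorem sameStateSums_of_equivalent {D D' : Diagram} (h : D.Equivalent D') :
    SameStateSums β D D' := by
  induction h with
  | rel _ _ h => exact sameStateSums_of_move h
  | refl => exact .refl _
  | symm _ _ _ ih => exact ih.symm
  | trans _ _ _ _ _ ih ih' => exact ih.trans ih'

end Diagram

end VirtualLink

theorem mainTheorem2 {X : Type u} [Biquandle X] {R : Type v} [CommRing R]
    (β : Biquandle.VirtualBracket X R) :
    (∀ L L' : VirtualLink.Diagram, L.Equivalent L' →
      L.bracketMultiplicity β = L'.bracketMultiplicity β) ∧
    (∀ L : VirtualLink.Diagram,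
      Cardinal.sum (L.bracketMultiplicity β) = Cardinal.lift.{v} (L.countingInvariant X)) ∧
    (∀ [Finite X],
      (∀ L L' : VirtualLink.Diagram, L.Equivalent L' →
        L.bracketMultiset β = L'.bracketMultiset β) ∧
      (∀ L : VirtualLink.Diagram,
        (Multiset.card (L.bracketMultiset β) : Cardinal.{u}) = L.countingInvariant X)) := by
  have counting : ∀ L : VirtualLink.Diagram,
      L.countingInvariant X = Cardinal.mk (L.ColoringHom X) := fun L =>
    (Cardinal.mk_congr (L.coloringHomEquiv X)).symm
  refine ⟨fun L L' h => ?_, fun L => ?_, ⟨fun L L' h => ?_, fun L => ?_⟩⟩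
  · obtain ⟨φ, hφ⟩ := VirtualLink.Diagram.sameStateSums_of_equivalent (β := β) h
    funext r
    exact Cardinal.mk_congr (φ.subtypeEquiv fun f => by rw [hφ])
  · rw [counting]
    exact (Cardinal.mk_sigma _).symm.trans ((Cardinal.mk_congr
      ((Equiv.sigmaFiberEquiv (L.stateSum β)).trans Equiv.ulift.symm)).trans (Cardinal.mk_uLift _))
  · obtain ⟨φ, hφ⟩ := VirtualLink.Diagram.sameStateSums_of_equivalent (β := β) h
    let _ := Fintype.ofFinite (L.ColoringHom X)
    let _ := Fintype.ofFinite (L'.ColoringHom X)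
    have huniv : (Finset.univ : Finset (L'.ColoringHom X)) =
        (Finset.univ : Finset (L.ColoringHom X)).map φ.toEmbedding := by simp
    rw [VirtualLink.Diagram.bracketMultiset, VirtualLink.Diagram.bracketMultiset, huniv,
      Finset.map_val, Multiset.map_map]
    exact Multiset.map_congr rfl fun f _ => (hφ f).symm
  · let _ := Fintype.ofFinite (L.ColoringHom X)
    rw [counting, Cardinal.mk_fintype, VirtualLink.Diagram.bracketMultiset, Multiset.card_map]
    rfl
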